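/- Let $\Sigma$ be a finite alphabet, $c\ge 1$ an integer and $m=2^\ell$ with $\ell\ge 1$; identify $[m]=\{0,\dots,m-1\}$ with the bit vectors of length $\ell$ and let $\oplus$ denote bitwise XOR. A simple tabulation hash function $h\colon\Sigma^c\to[m]$ is given by $h(x_1,\dots,x_c)=h_1(x_1)\oplus\cdots\oplus h_c(x_c)$, where $h_1,\dots,h_c\colon\Sigma\to[m]$ are independent, uniformly random functions. Let $S\subseteq\Sigma^c$ with $n=|S|$, and let $v\colon\Sigma^c\times[m]\to[-1,1]$ be a value function such that $Q=\{i\in[m] : \exists x\in\Sigma^c,\ v(x,i)\ne 0\}$ satisfies $|Q|\le m^\varepsilon$, where $\varepsilon<\tfrac14$ is a constant. Write $\mathcal C(x)=(x+1)\ln(x+1)-x$, and let $\gamma\ge 1$. There are positive constants $K_1,\kappa,D$ depending only on $c$ and $\gamma$, and a positive constant $K_2$ depending only on $c$, $\gamma$ and $\varepsilon$, such that the following hold for all such $\Sigma,m,S,v$. 1. Let $V=\sum_{x\in S}v(x,h(x))$. Then for every $t>0$, $$\Pr\bigl[|V-\mathbb E[V]|\ge t\bigr]\le K_1\exp\bigl(-\kappa\,\sigma^2\,\mathcal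 C(t/\sigma^2)\bigr)+K_2\,\frac{n}{m^\gamma},\qquad \sigma^2=\mathrm{Var}[V],$$ where the exponential is read as its limit $0$ if $\sigma^2=0$. 2. For $j\in[m]$ let $V_j=\sum_{x\in S}v(x,h(x)\oplus j)$. Then $\mu=\mathbb E[V_j]$ does not depend on $j$, and $$\Pr\Bigl[\sum_{j\in[m]}(V_j-\mu)^2> D\sum_{x\in S}\sum_{k\in[m]}v(x,k)^2\Bigr]\le K_2\,\frac{n}{m^\gamma}.$$ Both statements are query invariant: for every $q\in\Sigma^c$ and $y\in[m]$, the bounds, with the same constants, also hold when $h$ is conditioned on $h(q)=y$. In part 1 the expectation and variance are then those of the conditional distribution. In part 2 the bound then holds both with $\mu$ the unconditional mean and with $\mu$ replaced, in the $j$th term, by the conditional expectation $\mathbb E[V_j\mid h(q)=y]$. -/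

import Mathlib

open MeasureTheory ProbabilityTheory

namespace SimpleTabulation

/-- The hash range `[m]` for `m = 2 ^ k`, identified with bit vectors of length `k`.
Addition in `Fin k → ZMod 2` is bitwise XOR. -/
abbrev Bin (k : ℕ) : Type := Fin k → ZMod 2

/-- Keys: words of `c` characters over the alphabet `A`. -/
abbrev Key (c : ℕ) (A : Type*) := Fin c → A

/-- An outcome of the random experiment: one character table `A → [2 ^ k]` for each of the `c`
positions. -/
def Tables (c k : ℕ) (A : Type*) := Fin c → A → Bin k

instance (c k : ℕ) (A : Type*) : MeasurableSpace (Tables c k A) := ⊤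

/-- The simple tabulation hash function given by the tables `T`: the XOR of the `c` table
entries. -/
def Tables.hash {c k : ℕ} {A : Type*} (T : Tables c k A) (x : Key c A) : Bin k :=
  ∑ i, T i (x i)

/-- The law of simple tabulation: all the tables are independent and fully random, that is,
the tuple of tables is uniformly distributed. -/
noncomputable def law (c k : ℕ) (A : Type*) : Measure (Tables c k A) :=
  uniformOn Set.univ

/-- The law of simple tabulation conditioned on the event that the query key `q` has hash
value `y`. -/
noncomputable def queryLaw {c k : ℕ} {A : Type*} (q : Key c A) (y : Bin k) :
    Measure (Tables c k A) :=
  ProbabilityTheory.cond (law c k A) {T | T.hash q = y}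

/-- A property of the random hash function holds in a query invariant way: it holds for the
simple tabulation hash function, and also after conditioning on the hash value of any key. -/
def QueryInvariantly {c k : ℕ} {A : Type*} (property : Measure (Tables c k A) → Prop) : Prop :=
  property (law c k A) ∧ ∀ (q : Key c A) (y : Bin k), property (queryLaw q y)

/-- The function `𝒞(x) = (x + 1) ln (x + 1) - x`. -/
noncomputable def bennett (x : ℝ) : ℝ := (x + 1) * Real.log (x + 1) - x

/-- `exp (-κ s 𝒞(t / s))`, where `s` is a variance; at `s = 0` it is given by its limit `0` as
`s` decreases to `0` (for `κ, t > 0`). -/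
noncomputable def bennettTail (κ s t : ℝ) : ℝ :=
  open Classical in if s = 0 then 0 else Real.exp (-(κ * (s * bennett (t / s))))

/-- `X` is strongly concentrated under `P` with additive error `err`, the constants hidden in
`O(exp (-Ω(σ² 𝒞(t / σ²))))` being `K` (for `O`) and `κ` (for `Ω`). -/
def StronglyConcentrated {Ω : Type*} [MeasurableSpace Ω] (P : Measure Ω) (X : Ω → ℝ)
    (K κ err : ℝ) : Prop :=
  ∀ t : ℝ, 0 < t → P.real {ω | t ≤ |X ω - ∫ ω', X ω' ∂P|} ≤ K * bennettTail κ Var[X; P] t + err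

/-- `V_j = ∑_{x ∈ S} v(x, h(x) ⊕ j)`. -/
def shiftedSum {c k : ℕ} {A : Type*} (S : Finset (Key c A)) (v : Key c A → Bin k → ℝ)
    (j : Bin k) (T : Tables c k A) : ℝ :=
  ∑ x ∈ S, v x (T.hash x + j)

/-- `V = ∑_{x ∈ S} v(x, h(x))`. -/
def valueSum {c k : ℕ} {A : Type*} (S : Finset (Key c A)) (v : Key c A → Bin k → ℝ)
    (T : Tables c k A) : ℝ :=
  ∑ x ∈ S, v x (T.hash x)

/-- Under `P`, the event `∑_j (V_j - a_j)² > D ∑_{x ∈ S} ∑_k v(x, k)²` has probability at most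
`err`. -/
def SquaresBounded {c k : ℕ} {A : Type*} (P : Measure (Tables c k A)) (S : Finset (Key c A))
    (v : Key c A → Bin k → ℝ) (a : Bin k → ℝ) (D err : ℝ) : Prop :=
  P.real {T | D * ∑ x ∈ S, ∑ b : Bin k, v x b ^ 2 < ∑ j : Bin k, (shiftedSum S v j T - a j) ^ 2}
    ≤ err

end SimpleTabulation

open scoped BigOperators

-- Write m = 2^k. Since the support Q of v has at most m^(1/4) elements, Var[V] is comparable to
-- `weight S v` / m. Both parts go by induction on the number of positions in which the keys may
-- differ (`AgreeOff`), starting from a single key.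
--
-- Call a character light in a position if its keys carry less than a fraction m^(-1/(4c)) of the
-- weight. By `exists_light_partition`, at most m^(1/4) keys have no light character. With high
-- probability only boundedly many of these hash into any given shift of Q
-- (`pr_exists_card_filter_le`). Every other key is assigned to a position i where its character is
-- light. Such a class is grouped by the i-th character: each group varies in one position fewer, so
-- the induction hypothesis applies to it, and given the other tables the vector (V_j - μ)_j of the
-- class is a sum of independent random shifts of the group vectors (`cenVec_addRow`).
--
-- For the squares (`exists_square_bound`), expand the squared norm of this sum. The diagonal terms
-- are bounded by induction. The cross terms, revealed one group at a time, are martingale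
-- differences with small variance, because the nontrivial Fourier coefficients of the group vectors
-- are small: these are Rademacher-type chaoses with controlled moments (`expect_chaos_pow_le`). An
-- exponential supermartingale finishes the argument (`pr_sqn_sum_shift_le`).
--
-- For the tail (`exists_tail_bound`), V - μ on a class is a sum of independent centred variables,
-- one per character. The square bound controls their total variance. The inductive tail bound, with
-- a union bound over all shifts, makes them at most some M. Bennett's inequality then applies, and
-- `exists_truncation_level` chooses M so that only constants and powers of 1/m are lost.
--
-- Conditioning on h(q) = y makes the contribution of q constant and keeps the other hash values
-- pairwise independent. Keys sharing the i-th character with q form one extra group for the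
-- induction; the remaining keys of the class do not use the table entry of q in position i, so for
-- them the conditioning has no effect. Elsewhere conditioning costs at most a factor m, absorbed by
-- raising γ.

universe u

namespace SimpleTabulation

/-! ### Averages and probabilities on finite uniform spaces -/

section Average

lemma indicator_nonneg {Ω : Type*} (p : Ω → Prop) (ω : Ω) :
    0 ≤ Set.indicator {ω | p ω} (1 : Ω → ℝ) ω :=
  Set.indicator_nonneg (fun _ _ => zero_le_one) _

lemma indicator_le_of_imp {Ω : Type*} {p : Ω → Prop} {f : Ω → ℝ} {ω : Ω}
    (h0 : 0 ≤ f ω) (h : p ω → 1 ≤ f ω) :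
    Set.indicator {ω | p ω} (1 : Ω → ℝ) ω ≤ f ω := by
  by_cases hp : p ω
  · rw [Set.indicator_of_mem (by exact hp)]; exact h hp
  · rw [Set.indicator_of_notMem (by exact hp)]; exact h0

variable {Ω : Type*} [Fintype Ω]

/-- The probability of an event under the uniform distribution on a finite type. -/
noncomputable def pr (p : Ω → Prop) : ℝ := 𝔼 ω, Set.indicator {ω | p ω} (1 : Ω → ℝ) ω

lemma expect_le_of_le [Nonempty Ω] {f : Ω → ℝ} {C : ℝ} (h : ∀ ω, f ω ≤ C) : 𝔼 ω, f ω ≤ C :=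
  Finset.expect_le Finset.univ_nonempty fun ω _ => h ω

lemma expect_mono {f g : Ω → ℝ} (h : ∀ ω, f ω ≤ g ω) : 𝔼 ω, f ω ≤ 𝔼 ω, g ω :=
  Finset.expect_le_expect fun ω _ => h ω

lemma expect_nonneg {f : Ω → ℝ} (h : ∀ ω, 0 ≤ f ω) : 0 ≤ 𝔼 ω, f ω :=
  Finset.expect_nonneg fun ω _ => h ω

lemma pr_nonneg (p : Ω → Prop) : 0 ≤ pr p := expect_nonneg (indicator_nonneg p)

lemma pr_le_expect {p : Ω → Prop} {f : Ω → ℝ} (h0 : ∀ ω, 0 ≤ f ω) (h : ∀ ω, p ω → 1 ≤ f ω) :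
    pr p ≤ 𝔼 ω, f ω :=
  expect_mono fun ω => indicator_le_of_imp (h0 ω) (h ω)

lemma pr_mono {p q : Ω → Prop} (h : ∀ ω, p ω → q ω) : pr p ≤ pr q :=
  pr_le_expect (indicator_nonneg q) fun ω hp => by
    rw [Set.indicator_of_mem (by exact h ω hp)]; simp

lemma pr_le_one [Nonempty Ω] (p : Ω → Prop) : pr p ≤ 1 :=
  (pr_le_expect (f := fun _ => 1) (fun _ => zero_le_one) fun _ _ => le_rfl).trans_eq
    (Finset.expect_const Finset.univ_nonempty _)

lemma pr_eq_zero {p : Ω → Prop} (h : ∀ ω, ¬ p ω) : pr p = 0 :=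
  le_antisymm ((pr_le_expect (f := fun _ => 0) (fun _ => le_rfl)
    fun ω hp => (h ω hp).elim).trans_eq (by simp)) (pr_nonneg p)

lemma pr_exists_le {ι : Type*} (s : Finset ι) (p : ι → Ω → Prop) :
    pr (fun ω => ∃ i ∈ s, p i ω) ≤ ∑ i ∈ s, pr (p i) := by
  unfold pr
  rw [← Finset.expect_sum_comm]
  refine pr_le_expect (fun ω => Finset.sum_nonneg fun i _ => indicator_nonneg (p i) ω) ?_
  rintro ω ⟨i, hi, hp⟩
  refine le_trans ?_ (Finset.single_le_sum (f := fun i => Set.indicator {ω | p i ω} (1 : Ω → ℝ) ω)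
    (fun i _ => indicator_nonneg (p i) ω) hi)
  change 1 ≤ Set.indicator {ω | p i ω} (1 : Ω → ℝ) ω
  rw [Set.indicator_of_mem (by exact hp)]; simp

lemma pr_or_le (p q : Ω → Prop) : pr (fun ω => p ω ∨ q ω) ≤ pr p + pr q := by
  unfold pr
  rw [← Finset.expect_add_distrib]
  refine pr_le_expect (fun ω => add_nonneg (indicator_nonneg p ω) (indicator_nonneg q ω)) ?_
  rintro ω (hp | hq)
  · have := indicator_nonneg q ω
    rw [Set.indicator_of_mem (show ω ∈ {ω | p ω} from hp)]; simpa using this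
  · have := indicator_nonneg p ω
    rw [Set.indicator_of_mem (show ω ∈ {ω | q ω} from hq)]; simpa using this

lemma pr_le_div {p : Ω → Prop} {f : Ω → ℝ} {a : ℝ} (ha : 0 < a) (h0 : ∀ ω, 0 ≤ f ω)
    (h : ∀ ω, p ω → a ≤ f ω) : pr p ≤ (𝔼 ω, f ω) / a := by
  rw [Finset.expect_div]
  exact pr_le_expect (fun ω => div_nonneg (h0 ω) ha.le) fun ω hp => (one_le_div ha).2 (h ω hp)

end Average

section Product

lemma expect_prod_pi {ι β : Type*} [Fintype ι] [DecidableEq ι] [Fintype β]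
    (f : ι → β → ℝ) : 𝔼 g : ι → β, ∏ i, f i (g i) = ∏ i, 𝔼 b, f i b := by
  simp only [Fintype.expect_eq_sum_div_card, Finset.prod_div_distrib]
  rw [Finset.prod_univ_sum, Fintype.piFinset_univ]
  simp

end Product

/-! ### Resampling a single character table -/

section Rows

variable {c k : ℕ} {A : Type*}

noncomputable instance [Fintype A] [DecidableEq A] : Fintype (Tables c k A) :=
  inferInstanceAs (Fintype (Fin c → A → Bin k))

instance : Nonempty (Tables c k A) := inferInstanceAs (Nonempty (Fin c → A → Bin k))

/-- Add the function `g` to the `i`th character table. -/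
def addRow (T : Tables c k A) (i : Fin c) (g : A → Bin k) : Tables c k A :=
  fun l a => T l a + if l = i then g a else 0

lemma bin_add_self (b : Bin k) : b + b = 0 := by
  ext l; exact CharTwo.add_self_eq_zero _

lemma bin_add_cancel (a b : Bin k) : a + b + b = a := by
  rw [add_assoc, bin_add_self, add_zero]

lemma addRow_addRow (T : Tables c k A) (i : Fin c) (g : A → Bin k) :
    addRow (addRow T i g) i g = T := by
  funext l a
  by_cases h : l = i <;> simp [addRow, h, bin_add_cancel]

lemma hash_addRow (T : Tables c k A) (i : Fin c) (g : A → Bin k) (x : Key c A) :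
    (addRow T i g).hash x = T.hash x + g (x i) := by
  simp [Tables.hash, addRow, Finset.sum_add_distrib]

variable [DecidableEq A]

lemma hash_addRow_single_of_ne (T : Tables c k A) {i : Fin c} {x y : Key c A} (h : x i ≠ y i)
    (s : Bin k) : (addRow T i (Pi.single (y i) s)).hash x = T.hash x := by
  rw [hash_addRow, Pi.single_eq_of_ne h, add_zero]

variable [Fintype A]

lemma expect_addRow (i : Fin c) (g : A → Bin k) (f : Tables c k A → ℝ) :
    𝔼 T, f (addRow T i g) = 𝔼 T, f T :=
  Fintype.expect_equiv ⟨fun T => addRow T i g, fun T => addRow T i g,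
    fun T => addRow_addRow T i g, fun T => addRow_addRow T i g⟩ _ _ fun _ => rfl

lemma expect_resample (i : Fin c) (f : Tables c k A → ℝ) :
    𝔼 T, f T = 𝔼 T, 𝔼 g : A → Bin k, f (addRow T i g) := by
  rw [Finset.expect_comm]
  simp_rw [expect_addRow]
  rw [Finset.expect_const Finset.univ_nonempty]

/-- Used to condition on everything but one table: `bad` depends on the tables before the fresh
random row is added, and outside it only the randomness of that row is needed. -/
lemma pr_le_of_resample (i : Fin c) (bad : Tables c k A → Prop) (p : Tables c k A → Prop) {e : ℝ}
    (he : 0 ≤ e)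
    (h : ∀ T, ¬ bad T → pr (fun g : A → Bin k => p (addRow T i g)) ≤ e) : pr p ≤ pr bad + e := by
  have h1 : pr p = 𝔼 T, pr (fun g : A → Bin k => p (addRow T i g)) :=
    expect_resample i _
  rw [h1, ← Finset.expect_const (Finset.univ_nonempty (α := Tables c k A)) e, pr,
    ← Finset.expect_add_distrib]
  refine expect_mono fun T => ?_
  by_cases hb : bad T
  · rw [Set.indicator_of_mem (by exact hb)]
    have := pr_le_one (fun g : A → Bin k => p (addRow T i g))
    simp only [Pi.one_apply]; linarith
  · rw [Set.indicator_of_notMem (by exact hb), zero_add]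
    exact h T hb

lemma expect_add_right (u : Bin k → ℝ) (b : Bin k) : 𝔼 s, u (b + s) = 𝔼 s, u s :=
  Fintype.expect_equiv (Equiv.addLeft b) _ _ fun _ => rfl

/-- The entry of table `i` at `x i` is uniform and independent of everything `f` sees, so `T.hash x`
is uniform given `f`. All independence used later comes from this. -/
lemma expect_hash_mul (i : Fin c) (x : Key c A) (u : Bin k → ℝ) (f : Tables c k A → ℝ)
    (hf : ∀ s T, f (addRow T i (Pi.single (x i) s)) = f T) :
    𝔼 T : Tables c k A, u (T.hash x) * f T = (𝔼 b, u b) * 𝔼 T, f T := by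
  have h1 : 𝔼 T : Tables c k A, u (T.hash x) * f T =
      𝔼 s : Bin k, 𝔼 T : Tables c k A, u (T.hash x + s) * f T := by
    rw [← Finset.expect_const (Finset.univ_nonempty (α := Bin k))
      (𝔼 T : Tables c k A, u (T.hash x) * f T)]
    refine Finset.expect_congr rfl fun s _ => ?_
    rw [← expect_addRow i (Pi.single (x i) s)]
    refine Finset.expect_congr rfl fun T _ => ?_
    rw [hf, hash_addRow, Pi.single_eq_same]
  rw [h1, Finset.expect_comm, Finset.mul_expect]
  refine Finset.expect_congr rfl fun T _ => ?_
  rw [← Finset.expect_mul, expect_add_right]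

lemma expect_hash [NeZero c] (x : Key c A) (u : Bin k → ℝ) :
    𝔼 T : Tables c k A, u (T.hash x) = 𝔼 b, u b := by
  have := expect_hash_mul (k := k) 0 x u (fun _ => 1) fun _ _ => rfl
  simpa [Finset.expect_const (Finset.univ_nonempty (α := Tables c k A))] using this

end Rows

/-! ### Fourier analysis on bit vectors -/

section Fourier

variable {k : ℕ}

/-- The sign `(-1) ^ z` of a bit. -/
def sgn (z : ZMod 2) : ℝ := if z = 0 then 1 else -1

lemma zmod_two_cases (z : ZMod 2) : z = 0 ∨ z = 1 := by
  revert z; decide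

lemma sgn_add (a b : ZMod 2) : sgn (a + b) = sgn a * sgn b := by
  have h : (1 : ZMod 2) + 1 = 0 := by decide
  rcases zmod_two_cases a with rfl | rfl <;> rcases zmod_two_cases b with rfl | rfl <;>
    simp [sgn, h]

/-- The character of `[2 ^ k]` with index `u`. -/
def chi (u b : Bin k) : ℝ := ∏ i, sgn (u i * b i)

lemma chi_add (u a b : Bin k) : chi u (a + b) = chi u a * chi u b := by
  simp [chi, mul_add, sgn_add, Finset.prod_mul_distrib]

lemma chi_comm (u b : Bin k) : chi u b = chi b u := by
  simp [chi, mul_comm]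

lemma chi_sq (u b : Bin k) : chi u b * chi u b = 1 := by
  rw [← chi_add, bin_add_self]
  simp [chi, sgn]

lemma chi_eq_or (u b : Bin k) : chi u b = 1 ∨ chi u b = -1 :=
  mul_self_eq_one_iff.1 (chi_sq u b)

lemma card_bin (k : ℕ) : Fintype.card (Bin k) = 2 ^ k := by
  simp [ZMod.card]

lemma sum_chi_left (b : Bin k) : ∑ u : Bin k, chi u b = if b = 0 then (2 : ℝ) ^ k else 0 := by
  have h : ∑ u : Bin k, chi u b = ∏ i, ∑ z : ZMod 2, sgn (z * b i) := by
    rw [Finset.prod_univ_sum, Fintype.piFinset_univ]; rfl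
  have h2 : ∀ i, ∑ z : ZMod 2, sgn (z * b i) = if b i = 0 then 2 else 0 := by
    intro i
    have h3 : ∑ z : ZMod 2, sgn (z * b i) = sgn (0 * b i) + sgn (1 * b i) := Fin.sum_univ_two _
    rw [h3]
    rcases zmod_two_cases (b i) with h | h <;> rw [h] <;> norm_num [sgn]
  rw [h]
  simp_rw [h2]
  split_ifs with hb
  · simp [hb]
  · obtain ⟨i, hi⟩ := Function.ne_iff.1 hb
    exact Finset.prod_eq_zero (Finset.mem_univ i) (if_neg hi)

lemma sum_chi_right {u : Bin k} (hu : u ≠ 0) : ∑ b : Bin k, chi u b = 0 := by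
  simp_rw [chi_comm u]
  rw [sum_chi_left, if_neg hu]

lemma bin_add_eq_zero {a b : Bin k} : a + b = 0 ↔ a = b := by
  constructor
  · intro h
    rw [← bin_add_cancel a b, h, zero_add]
  · rintro rfl; exact bin_add_self a

/-- The Fourier transform on `[2 ^ k]`. -/
def ft (f : Bin k → ℝ) (u : Bin k) : ℝ := ∑ b, f b * chi u b

lemma sum_ft_sq (f : Bin k → ℝ) : ∑ u, ft f u ^ 2 = 2 ^ k * ∑ b, f b ^ 2 := by
  have h1 : ∀ u, ft f u ^ 2 = ∑ a, ∑ b, f a * f b * chi u (a + b) := by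
    intro u
    rw [ft, sq, Finset.sum_mul_sum]
    refine Finset.sum_congr rfl fun a _ => Finset.sum_congr rfl fun b _ => ?_
    rw [chi_add]; ring
  simp_rw [h1]
  rw [Finset.sum_comm, Finset.mul_sum]
  refine Finset.sum_congr rfl fun a _ => ?_
  rw [Finset.sum_comm]
  simp_rw [← Finset.mul_sum, sum_chi_left, bin_add_eq_zero]
  simp; ring

lemma ft_sq_le (f : Bin k → ℝ) (u : Bin k) (Q : Finset (Bin k)) (hQ : ∀ b, f b ≠ 0 → b ∈ Q) :
    ft f u ^ 2 ≤ Q.card * ∑ b, f b ^ 2 := by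
  have h1 : ft f u = ∑ b ∈ Q, f b * chi u b := by
    refine (Finset.sum_subset (Finset.subset_univ Q) fun b _ hb => ?_).symm
    rw [not_imp_comm.1 (hQ b) hb, zero_mul]
  rw [h1]
  refine sq_sum_le_card_mul_sum_sq.trans ?_
  refine mul_le_mul_of_nonneg_left ?_ (Nat.cast_nonneg _)
  refine le_trans (Finset.sum_le_sum_of_subset_of_nonneg (Finset.subset_univ Q) fun b _ _ =>
    sq_nonneg _) (le_of_eq <| Finset.sum_congr rfl fun b _ => ?_)
  rw [mul_pow, sq (chi u b), chi_sq, mul_one]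

lemma ft_correlation (f g : Bin k → ℝ) (u : Bin k) :
    ft (fun s => ∑ j, f j * g (j + s)) u = ft f u * ft g u := by
  rw [ft]
  simp_rw [Finset.sum_mul]
  rw [Finset.sum_comm, ft, Finset.sum_mul]
  refine Finset.sum_congr rfl fun j _ => ?_
  rw [ft, Finset.mul_sum]
  refine Fintype.sum_equiv (Equiv.addLeft j) _ _ fun s => ?_
  simp only [Equiv.coe_addLeft]
  rw [chi_add]
  linear_combination (-(f j * g (j + s) * chi u s)) * chi_sq u j

/-- By Parseval, since correlation becomes a product of transforms. A flat spectrum of `g` thus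
gains over Cauchy–Schwarz, which would cost a factor `2 ^ k`. -/
lemma sum_correlation_sq_le (f g : Bin k → ℝ) {β : ℝ} (h : ∀ u, ft g u ^ 2 ≤ β) :
    ∑ s, (∑ j, f j * g (j + s)) ^ 2 ≤ β * ∑ j, f j ^ 2 := by
  have hk : (0 : ℝ) < 2 ^ k := by positivity
  refine le_of_mul_le_mul_left ?_ hk
  rw [← sum_ft_sq]
  simp_rw [ft_correlation, mul_pow]
  rw [mul_left_comm, ← sum_ft_sq, Finset.mul_sum]
  refine Finset.sum_le_sum fun u _ => ?_
  rw [mul_comm]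
  exact mul_le_mul_of_nonneg_right (h u) (sq_nonneg _)

end Fourier

/-! ### Moments of hash chaoses -/

section Khintchine

variable {k : ℕ} {A : Type*} [Fintype A] [DecidableEq A]

lemma expect_exp_chi {u : Bin k} (hu : u ≠ 0) (t : ℝ) :
    𝔼 b, Real.exp (t * chi u b) = Real.cosh t := by
  have h : ∀ b, Real.exp (t * chi u b) = Real.cosh t + chi u b * Real.sinh t := by
    intro b
    rcases chi_eq_or u b with h | h <;> rw [h, Real.cosh_eq, Real.sinh_eq] <;> ring_nf
  simp_rw [h]
  rw [Finset.expect_add_distrib, ← Finset.expect_mul, Fintype.expect_eq_sum_div_card (chi u),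
    sum_chi_right hu]
  simp

lemma expect_exp_sum_chi_le {u : Bin k} (hu : u ≠ 0) (w : A → ℝ) :
    𝔼 g : A → Bin k, Real.exp (∑ a, w a * chi u (g a)) ≤ Real.exp ((∑ a, w a ^ 2) / 2) := by
  simp_rw [Real.exp_sum]
  rw [expect_prod_pi (fun a b => Real.exp (w a * chi u b)), Finset.sum_div, Real.exp_sum]
  refine Finset.prod_le_prod (fun a _ => expect_nonneg fun _ => (Real.exp_pos _).le) fun a _ => ?_
  rw [expect_exp_chi hu]
  exact Real.cosh_le_exp_half_sq _

/-- For `u ≠ 0` the values `chi u (g a)` are independent fair signs. After normalising to unit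
variance, y^(2p)/(2p)! ≤ e^y + e^(-y), and each exponential has mean at most e^(1/2) ≤ 2. -/
lemma expect_sum_chi_pow_le {u : Bin k} (hu : u ≠ 0) (w : A → ℝ) (p : ℕ) :
    𝔼 g : A → Bin k, (∑ a, w a * chi u (g a)) ^ (2 * p) ≤
      4 * (2 * p).factorial * (∑ a, w a ^ 2) ^ p := by
  have hfac : (1 : ℝ) ≤ (2 * p).factorial := by exact_mod_cast Nat.factorial_pos _
  rcases (Finset.sum_nonneg fun a (_ : a ∈ Finset.univ) => sq_nonneg (w a)).eq_or_lt with h0 | h0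
  · have hw : ∀ a, w a = 0 := fun a => by
      have := (Finset.sum_eq_zero_iff_of_nonneg fun a _ => sq_nonneg (w a)).1 h0.symm a
        (Finset.mem_univ a)
      simpa using this
    rcases Nat.eq_zero_or_pos p with rfl | hp
    · simp
    · simp [hw, hp.ne']
  set σ := Real.sqrt (∑ a, w a ^ 2) with hσ
  have hσ0 : 0 < σ := Real.sqrt_pos.2 h0
  have hσ2 : σ ^ 2 = ∑ a, w a ^ 2 := Real.sq_sqrt h0.le
  have key : ∀ ε : ℝ, ε ^ 2 = 1 →
      𝔼 g : A → Bin k, Real.exp (∑ a, (ε * w a / σ) * chi u (g a)) ≤ 2 := by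
    intro ε hε
    refine (expect_exp_sum_chi_le hu _).trans ?_
    have : ∑ a, (ε * w a / σ) ^ 2 = 1 := by
      simp_rw [div_pow, mul_pow, hε, one_mul, ← Finset.sum_div, hσ2]
      exact div_self h0.ne'
    rw [this]
    have h2 := Real.exp_one_lt_d9
    have h3 : Real.exp (1 / 2) ^ 2 = Real.exp 1 := by rw [← Real.exp_nat_mul]; norm_num
    nlinarith [Real.exp_pos (1 / 2 : ℝ)]
  have h1 : ∀ g : A → Bin k, (∑ a, w a * chi u (g a)) ^ (2 * p) ≤
      ((2 * p).factorial * σ ^ (2 * p)) * (Real.exp (∑ a, (1 * w a / σ) * chi u (g a)) +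
        Real.exp (∑ a, ((-1) * w a / σ) * chi u (g a))) := by
    intro g
    set y := (∑ a, w a * chi u (g a)) / σ with hy
    have e1 : ∑ a, (1 * w a / σ) * chi u (g a) = y := by
      rw [hy, Finset.sum_div]; refine Finset.sum_congr rfl fun a _ => by ring
    have e2 : ∑ a, ((-1) * w a / σ) * chi u (g a) = -y := by
      rw [hy, Finset.sum_div, ← Finset.sum_neg_distrib]
      refine Finset.sum_congr rfl fun a _ => by ring
    have e3 : ∑ a, w a * chi u (g a) = y * σ := by rw [hy]; field_simp
    rw [e1, e2, e3, mul_pow]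
    have h4 := Real.pow_div_factorial_le_exp |y| (abs_nonneg y) (2 * p)
    rw [pow_mul |y|, sq_abs, ← pow_mul, div_le_iff₀ (by positivity)] at h4
    have h5 : Real.exp |y| ≤ Real.exp y + Real.exp (-y) := by
      rcases abs_cases y with ⟨h, _⟩ | ⟨h, _⟩ <;> rw [h] <;>
        linarith [Real.exp_pos y, Real.exp_pos (-y)]
    calc y ^ (2 * p) * σ ^ (2 * p) ≤
          ((Real.exp y + Real.exp (-y)) * (2 * p).factorial) * σ ^ (2 * p) := by
          refine mul_le_mul_of_nonneg_right (h4.trans ?_) (by positivity)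
          exact mul_le_mul_of_nonneg_right h5 (by positivity)
      _ = _ := by ring
  refine (expect_mono h1).trans ?_
  rw [← Finset.mul_expect, Finset.expect_add_distrib, pow_mul σ, hσ2]
  have := key 1 (by norm_num)
  have := key (-1) (by norm_num)
  have h6 : 0 ≤ ((2 * p).factorial : ℝ) * (∑ a, w a ^ 2) ^ p := by positivity
  nlinarith

end Khintchine

section Jensen

/-- Minkowski's inequality for p-th moments, obtained from convexity with weights `t i / τ`. The
hypothesis `h0` covers indices where the weight vanishes. -/
lemma expect_sum_pow_le {Ω ι : Type*} [Fintype Ω] (s : Finset ι) (f : ι → Ω → ℝ) (t : ι → ℝ)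
    {p : ℕ} (hp : p ≠ 0) {K : ℝ} (hf : ∀ i ∈ s, ∀ ω, 0 ≤ f i ω) (ht : ∀ i ∈ s, 0 ≤ t i)
    (h0 : ∀ i ∈ s, t i = 0 → ∀ ω, f i ω = 0)
    (h : ∀ i ∈ s, 𝔼 ω, f i ω ^ p ≤ K * t i ^ p) :
    𝔼 ω, (∑ i ∈ s, f i ω) ^ p ≤ K * (∑ i ∈ s, t i) ^ p := by
  rcases (Finset.sum_nonneg ht).eq_or_lt with hs | hs
  · have h1 : ∀ i ∈ s, t i = 0 := (Finset.sum_eq_zero_iff_of_nonneg ht).1 hs.symm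
    rw [← hs, zero_pow hp, mul_zero]
    refine le_of_eq (Finset.expect_eq_zero fun ω _ => ?_)
    rw [Finset.sum_eq_zero fun i hi => h0 i hi (h1 i hi) ω, zero_pow hp]
  set τ := ∑ i ∈ s, t i
  have h1 : ∀ ω, (∑ i ∈ s, f i ω) ^ p ≤
      ∑ i ∈ s, (t i / τ) * ((τ / t i) ^ p * f i ω ^ p) := by
    intro ω
    have := Real.pow_arith_mean_le_arith_mean_pow s (fun i => t i / τ) (fun i => τ / t i * f i ω)
      (fun i hi => div_nonneg (ht i hi) hs.le) (by rw [← Finset.sum_div]; exact div_self hs.ne')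
      (fun i hi => mul_nonneg (div_nonneg hs.le (ht i hi)) (hf i hi ω)) p
    simp_rw [mul_pow] at this
    refine le_trans (le_of_eq ?_) this
    congr 1
    refine Finset.sum_congr rfl fun i hi => ?_
    by_cases hti : t i = 0
    · rw [h0 i hi hti ω]; simp
    · field_simp
  refine (expect_mono h1).trans ?_
  rw [Finset.expect_sum_comm]
  have h2 : ∀ i ∈ s, 𝔼 ω, (t i / τ) * ((τ / t i) ^ p * f i ω ^ p) ≤ (t i / τ) * (K * τ ^ p) := by
    intro i hi
    rw [← Finset.mul_expect, ← Finset.mul_expect]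
    by_cases hti : t i = 0
    · simp [hti]
    refine mul_le_mul_of_nonneg_left ?_ (div_nonneg (ht i hi) hs.le)
    refine (mul_le_mul_of_nonneg_left (h i hi) (by have := ht i hi; positivity)).trans_eq ?_
    rw [div_pow]
    field_simp
  refine (Finset.sum_le_sum h2).trans_eq ?_
  rw [← Finset.sum_mul, ← Finset.sum_div, div_self hs.ne', one_mul]

end Jensen

section Chaos

variable {c k : ℕ} {A : Type*}

/-- The keys of `S` agree in all the positions outside of `J`. -/
def AgreeOff (J : Finset (Fin c)) (S : Finset (Key c A)) : Prop :=
  ∀ x ∈ S, ∀ y ∈ S, ∀ i ∉ J, x i = y i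

lemma AgreeOff.mono {J : Finset (Fin c)} {S S' : Finset (Key c A)} (h : AgreeOff J S)
    (hs : S' ⊆ S) : AgreeOff J S' :=
  fun x hx y hy => h x (hs hx) y (hs hy)

lemma AgreeOff.card_le_one {S : Finset (Key c A)} (h : AgreeOff ∅ S) : S.card ≤ 1 :=
  Finset.card_le_one.2 fun x hx y hy => funext fun i => h x hx y hy i (Finset.notMem_empty i)

variable [DecidableEq A]

lemma AgreeOff.filter {J : Finset (Fin c)} {S : Finset (Key c A)} (h : AgreeOff J S) (i : Fin c)
    (a : A) : AgreeOff (J.erase i) (S.filter fun x => x i = a) := by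
  intro x hx y hy l hl
  rw [Finset.mem_filter] at hx hy
  by_cases hli : l = i
  · rw [hli, hx.2, hy.2]
  · exact h x hx.1 y hy.1 l fun hlJ => hl (Finset.mem_erase.2 ⟨hli, hlJ⟩)

variable [Fintype A]

/-- Resampling one table turns the sum into a Rademacher sum whose coefficients are the group sums.
Khintchine handles the signs, Minkowski the p-th moment of the sum of squared coefficients, and the
groups vary in one position fewer. -/
lemma expect_chaos_pow_le {u : Bin k} (hu : u ≠ 0) {p : ℕ} (hp : p ≠ 0) (J : Finset (Fin c)) :
    ∀ (S : Finset (Key c A)), AgreeOff J S → ∀ w : Key c A → ℝ,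
      𝔼 T : Tables c k A, (∑ x ∈ S, w x * chi u (T.hash x)) ^ (2 * p) ≤
        (4 * (2 * p).factorial) ^ J.card * (∑ x ∈ S, w x ^ 2) ^ p := by
  induction J using Finset.induction_on with
  | empty =>
    intro S hS w
    refine expect_le_of_le fun T => ?_
    rw [Finset.card_empty, pow_zero, one_mul, pow_mul]
    refine pow_le_pow_left₀ (sq_nonneg _) ?_ p
    refine sq_sum_le_card_mul_sum_sq.trans ?_
    have h1 : (S.card : ℝ) ≤ 1 := by exact_mod_cast hS.card_le_one
    simp_rw [mul_pow, sq (chi _ _), chi_sq, mul_one]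
    exact mul_le_of_le_one_left (Finset.sum_nonneg fun _ _ => sq_nonneg _) h1
  | insert i J hi ih =>
    intro S hS w
    have hG : ∀ a, AgreeOff J (S.filter fun x => x i = a) := fun a => by
      simpa [Finset.erase_insert hi] using hS.filter i a
    rw [expect_resample i]
    have h1 : ∀ (T : Tables c k A) (g : A → Bin k),
        ∑ x ∈ S, w x * chi u ((addRow T i g).hash x) =
          ∑ a, (∑ x ∈ S with x i = a, w x * chi u (T.hash x)) * chi u (g a) := by
      intro T g
      rw [← Finset.sum_fiberwise S (fun x => x i)]
      refine Finset.sum_congr rfl fun a _ => ?_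
      rw [Finset.sum_mul]
      refine Finset.sum_congr rfl fun x hx => ?_
      rw [hash_addRow, chi_add, (Finset.mem_filter.1 hx).2]; ring
    simp_rw [h1]
    refine (expect_mono fun T => expect_sum_chi_pow_le hu _ p).trans ?_
    rw [← Finset.mul_expect, Finset.card_insert_of_notMem hi, pow_succ', mul_assoc _ (_ ^ _),
      ← Finset.sum_fiberwise S (fun x => x i)]
    refine mul_le_mul_of_nonneg_left ?_ (by positivity)
    refine expect_sum_pow_le _ _ _ hp (fun _ _ _ => sq_nonneg _)
      (fun _ _ => Finset.sum_nonneg fun _ _ => sq_nonneg _) ?_ ?_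
    · intro a _ h0 T
      have h2 := (Finset.sum_eq_zero_iff_of_nonneg (s := S.filter fun x => x i = a)
        (f := fun x => w x ^ 2) fun x _ => sq_nonneg (w x)).1 h0
      refine sq_eq_zero_iff.2 (Finset.sum_eq_zero fun x hx => ?_)
      have h3 : w x = 0 := by simpa using h2 x hx
      rw [h3, zero_mul]
    · intro a _
      simp_rw [← pow_mul]
      exact ih _ (hG a) w

end Chaos

/-! ### Squared norm of a sum of random shifts -/

section RandomShifts

variable {k : ℕ} {A : Type*}

/-- The squared Euclidean norm of a function on `[2 ^ k]`. -/
def sqn (f : Bin k → ℝ) : ℝ := ∑ j, f j ^ 2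

lemma sqn_nonneg (f : Bin k → ℝ) : 0 ≤ sqn f := Finset.sum_nonneg fun _ _ => sq_nonneg _

lemma sqn_shift (f : Bin k → ℝ) (s : Bin k) : sqn (fun j => f (j + s)) = sqn f :=
  Fintype.sum_equiv (Equiv.addRight s) _ _ fun _ => rfl

lemma sqn_add (f g : Bin k → ℝ) :
    sqn (fun j => f j + g j) = sqn f + 2 * ∑ j, f j * g j + sqn g := by
  simp only [sqn, Finset.mul_sum, ← Finset.sum_add_distrib]
  exact Finset.sum_congr rfl fun j _ => by ring

lemma sqn_sum_le {ι : Type*} (s : Finset ι) (f : ι → Bin k → ℝ) :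
    sqn (fun j => ∑ i ∈ s, f i j) ≤ s.card * ∑ i ∈ s, sqn (f i) := by
  unfold sqn
  rw [Finset.sum_comm, Finset.mul_sum]
  exact Finset.sum_le_sum fun j _ => sq_sum_le_card_mul_sum_sq

/-- Uses e^x ≤ 1 + x + x² for |x| ≤ 1, which `hl` ensures. The linear term averages to zero because
`g` has sum zero, and the quadratic one is bounded by Parseval. -/
lemma expect_exp_correlation_le {f g : Bin k → ℝ} {l Θ β : ℝ} (hg : ∑ j, g j = 0)
    (hβ : ∀ u, ft g u ^ 2 ≤ β) (hf : sqn f ≤ Θ) (hl : 4 * l ^ 2 * (Θ * sqn g) ≤ 1) :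
    𝔼 s, Real.exp (l * (2 * ∑ j, f j * g (j + s))) ≤ Real.exp (l ^ 2 * (4 * Θ * β / 2 ^ k)) := by
  have hβ0 : 0 ≤ β := (sq_nonneg _).trans (hβ 0)
  have h1 : ∀ s, Real.exp (l * (2 * ∑ j, f j * g (j + s))) ≤
      1 + 2 * l * ∑ j, f j * g (j + s) + 4 * l ^ 2 * (∑ j, f j * g (j + s)) ^ 2 := by
    intro s
    have hcs : (∑ j, f j * g (j + s)) ^ 2 ≤ Θ * sqn g := by
      refine (Finset.sum_mul_sq_le_sq_mul_sq Finset.univ f fun j => g (j + s)).trans ?_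
      change sqn f * sqn (fun j => g (j + s)) ≤ _
      rw [sqn_shift]
      exact mul_le_mul_of_nonneg_right hf (sqn_nonneg g)
    have h2 : |l * (2 * ∑ j, f j * g (j + s))| ≤ 1 := by
      rw [← sq_le_one_iff_abs_le_one]
      refine le_trans ?_ hl
      calc _ = 4 * l ^ 2 * (∑ j, f j * g (j + s)) ^ 2 := by ring
        _ ≤ _ := mul_le_mul_of_nonneg_left hcs (by positivity)
    have h3 := (abs_le.1 (Real.abs_exp_sub_one_sub_id_le h2)).2
    nlinarith
  have hm : ∑ s, ∑ j, f j * g (j + s) = 0 := by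
    rw [Finset.sum_comm]
    refine Finset.sum_eq_zero fun j _ => ?_
    rw [← Finset.mul_sum]
    have : ∑ s, g (j + s) = ∑ s, g s := Fintype.sum_equiv (Equiv.addLeft j) _ _ fun _ => rfl
    rw [this, hg, mul_zero]
  refine (expect_mono h1).trans ?_
  rw [Finset.expect_add_distrib, Finset.expect_add_distrib, ← Finset.mul_expect,
    ← Finset.mul_expect, Finset.expect_const Finset.univ_nonempty,
    Fintype.expect_eq_sum_div_card, hm, Fintype.expect_eq_sum_div_card, card_bin]
  have h4 : ∑ s, (∑ j, f j * g (j + s)) ^ 2 ≤ β * Θ :=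
    (sum_correlation_sq_le f g hβ).trans (mul_le_mul_of_nonneg_left hf hβ0)
  refine le_trans ?_ (Real.add_one_le_exp _)
  have h5 : (∑ s, (∑ j, f j * g (j + s)) ^ 2) / ((2 ^ k : ℕ) : ℝ) ≤ β * Θ / 2 ^ k := by
    push_cast
    exact div_le_div_of_nonneg_right h4 (by positivity)
  have h6 := mul_le_mul_of_nonneg_left h5 (by positivity : 0 ≤ 4 * l ^ 2)
  calc _ ≤ 1 + 2 * l * (0 / ((2 ^ k : ℕ) : ℝ)) + 4 * l ^ 2 * (β * Θ / 2 ^ k) := by linarith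
    _ = _ := by ring

variable [Fintype A] [DecidableEq A]

lemma expect_eval (a : A) (F : Bin k → (A → Bin k) → ℝ)
    (hF : ∀ b g s, F b (g + Pi.single a s) = F b g) :
    𝔼 g : A → Bin k, F (g a) g = 𝔼 b, 𝔼 g, F b g := by
  have h1 : ∀ s : Bin k, 𝔼 g : A → Bin k, F (g a) g = 𝔼 g : A → Bin k, F (g a + s) g := by
    intro s
    refine (Fintype.expect_equiv (Equiv.addRight (Pi.single a s : A → Bin k)) _ _ fun g => ?_).symm
    simp [hF]
  calc 𝔼 g : A → Bin k, F (g a) g = 𝔼 _s : Bin k, 𝔼 g : A → Bin k, F (g a) g :=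
        (Finset.expect_const Finset.univ_nonempty _).symm
    _ = 𝔼 g : A → Bin k, 𝔼 s : Bin k, F (g a + s) g := by
        rw [Finset.expect_congr rfl fun s _ => h1 s, Finset.expect_comm]
    _ = 𝔼 g : A → Bin k, 𝔼 b : Bin k, F b g :=
        Finset.expect_congr rfl fun g _ => expect_add_right (fun b => F b g) _
    _ = _ := Finset.expect_comm _ _ _

/-- An exponential supermartingale argument by induction on the revealed shifts, with a threshold
`θ` that grows with the diagonal terms. -/
lemma pr_sqn_sum_shift_le (B : A → Bin k → ℝ) (β : A → ℝ) {l Θ : ℝ} (hl0 : 0 ≤ l)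
    (hΘ : 0 ≤ Θ) (s : Finset A)
    (h0 : ∀ a ∈ s, ∑ j, B a j = 0) (hβ : ∀ a ∈ s, ∀ u, ft (B a) u ^ 2 ≤ β a)
    (hl : ∀ a ∈ s, 4 * l ^ 2 * (Θ * sqn (B a)) ≤ 1) :
    ∀ (f : Bin k → ℝ) (θ : ℝ), θ + ∑ a ∈ s, sqn (B a) ≤ Θ →
      pr (fun g : A → Bin k =>
          θ + ∑ a ∈ s, sqn (B a) < sqn (fun j => f j + ∑ a ∈ s, B a (j + g a))) ≤
        Real.exp (l * (sqn f - θ) + l ^ 2 * ∑ a ∈ s, 4 * Θ * β a / 2 ^ k) := by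
  induction s using Finset.induction_on with
  | empty =>
    intro f θ _
    rcases lt_or_ge θ (sqn f) with h | h
    · refine (pr_le_one _).trans (Real.one_le_exp ?_)
      simpa using mul_nonneg hl0 (sub_nonneg.2 h.le)
    · rw [pr_eq_zero fun g => by simpa using h]
      exact (Real.exp_pos _).le
  | insert a s ha ih =>
    intro f θ hθ
    have hB : ∀ a' ∈ insert a s, 0 ≤ β a' := fun a' h => (sq_nonneg _).trans (hβ a' h 0)
    rw [Finset.sum_insert ha] at hθ ⊢
    have hsum : 0 ≤ ∑ a ∈ s, sqn (B a) := Finset.sum_nonneg fun a _ => sqn_nonneg _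
    -- Above the running threshold the claimed bound is at least one. This replaces a stopping time:
    -- otherwise `sqn f ≤ θ ≤ Θ`, as the cross-term estimate requires.
    rcases lt_or_ge θ (sqn f) with h | h
    · refine (pr_le_one _).trans (Real.one_le_exp (add_nonneg
        (mul_nonneg hl0 (sub_nonneg.2 h.le)) (mul_nonneg (sq_nonneg _)
          (Finset.sum_nonneg fun a' h' => ?_))))
      have := hB a' h'
      positivity
    have ih' := ih (fun a h => h0 a (Finset.mem_insert_of_mem h))
      (fun a h => hβ a (Finset.mem_insert_of_mem h)) (fun a h => hl a (Finset.mem_insert_of_mem h))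
    have h1 : pr (fun g : A → Bin k => θ + (sqn (B a) + ∑ a ∈ s, sqn (B a)) <
        sqn (fun j => f j + ∑ a ∈ insert a s, B a (j + g a))) =
        𝔼 b, pr (fun g : A → Bin k => (θ + sqn (B a)) + ∑ a ∈ s, sqn (B a) <
          sqn (fun j => (f j + B a (j + b)) + ∑ a ∈ s, B a (j + g a))) := by
      simp_rw [Finset.sum_insert ha, ← add_assoc]
      refine expect_eval a (fun b => Set.indicator {g : A → Bin k |
        θ + sqn (B a) + ∑ a ∈ s, sqn (B a) <
          sqn (fun j => f j + B a (j + b) + ∑ a ∈ s, B a (j + g a))} (1 : (A → Bin k) → ℝ)) ?_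
      intro b g t
      have : ∀ j, ∑ a' ∈ s, B a' (j + (g + Pi.single a t : A → Bin k) a') =
          ∑ a' ∈ s, B a' (j + g a') := by
        intro j
        refine Finset.sum_congr rfl fun a' ha' => ?_
        have : a' ≠ a := fun h => ha (h ▸ ha')
        simp [Pi.single_eq_of_ne this]
      simp only [Set.indicator_apply, Set.mem_ofPred_eq, this, Pi.one_apply]
    rw [h1]
    refine (expect_mono fun b => ih' _ _ (by linarith)).trans ?_
    -- The increase of the threshold cancels the diagonal term, so only the cross term is left.
    have h2 : ∀ b, l * (sqn (fun j => f j + B a (j + b)) - (θ + sqn (B a))) +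
        l ^ 2 * ∑ a ∈ s, 4 * Θ * β a / 2 ^ k =
        (l * (sqn f - θ) + l ^ 2 * ∑ a ∈ s, 4 * Θ * β a / 2 ^ k) +
          l * (2 * ∑ j, f j * B a (j + b)) := by
      intro b
      rw [sqn_add f fun j => B a (j + b), sqn_shift]; ring
    simp_rw [h2, Real.exp_add _ (l * (2 * _))]
    rw [← Finset.mul_expect, Finset.sum_insert ha, mul_add, ← add_assoc, add_right_comm,
      Real.exp_add _ (l ^ 2 * (4 * Θ * β a / 2 ^ k))]
    refine mul_le_mul_of_nonneg_left ?_ (Real.exp_pos _).le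
    have hai := Finset.mem_insert_self a s
    refine expect_exp_correlation_le (h0 a hai) (hβ a hai) ?_ (hl a hai)
    linarith [sqn_nonneg (B a)]

end RandomShifts

/-! ### Few keys hash into a small set -/

section SmallSets

variable {c k : ℕ} {A : Type*}

/-- If every position showed at most `u` characters, `X` would lie in a box with at most `u ^ c`
elements. -/
lemma exists_subset_injOn {u : ℕ} (X : Finset (Key c A)) (hX : u ^ c < X.card) :
    ∃ i : Fin c, ∃ F ⊆ X, F.card = u + 1 ∧ Set.InjOn (fun x : Key c A => x i) F := by
  classical
  by_contra! h
  have h1 : ∀ i : Fin c, (X.image fun x => x i).card ≤ u := by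
    intro i
    by_contra! hi
    obtain ⟨Y, hY, hcard⟩ := Finset.exists_subset_card_eq (Nat.succ_le_of_lt hi)
    have h2 : ∀ a ∈ Y, ∃ x ∈ X, x i = a := fun a ha => Finset.mem_image.1 (hY ha)
    choose r hr hri using h2
    refine h i (Y.attach.image fun a => r a.1 a.2) ?_ ?_ ?_
    · intro x hx
      obtain ⟨a, _, rfl⟩ := Finset.mem_image.1 hx
      exact hr _ _
    · rw [Finset.card_image_of_injective, Finset.card_attach, hcard]
      intro a b hab
      exact Subtype.ext (by rw [← hri a.1 a.2, ← hri b.1 b.2]; exact congrFun hab i)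
    · intro x hx y hy hxy
      obtain ⟨a, _, rfl⟩ := Finset.mem_image.1 (Finset.mem_coe.1 hx)
      obtain ⟨b, _, rfl⟩ := Finset.mem_image.1 (Finset.mem_coe.1 hy)
      have hab : a.1 = b.1 := by rw [← hri a.1 a.2, ← hri b.1 b.2]; exact hxy
      rw [Subtype.ext hab]
  have h2 : X ⊆ Fintype.piFinset fun i : Fin c => X.image fun x => x i := by
    intro x hx
    rw [Fintype.mem_piFinset]
    exact fun i => Finset.mem_image_of_mem (fun x : Key c A => x i) hx
  have h3 := Finset.card_le_card h2
  rw [Fintype.card_piFinset] at h3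
  have h4 : ∏ i : Fin c, (X.image fun x => x i).card ≤ ∏ _i : Fin c, u :=
    Finset.prod_le_prod' fun i _ => h1 i
  simp only [Finset.prod_const, Finset.card_univ, Fintype.card_fin] at h4
  omega

variable [Fintype A] [DecidableEq A]

lemma expect_indicator_mem (Q : Finset (Bin k)) :
    𝔼 b, Set.indicator (Q : Set (Bin k)) (1 : Bin k → ℝ) b = Q.card / 2 ^ k := by
  rw [Fintype.expect_eq_sum_div_card, card_bin]
  congr 1
  · simp [Set.indicator_apply]
  · push_cast; rfl

/-- Keys with distinct characters in position `i` use distinct entries of table `i`, so their hash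
values are fully independent. -/
lemma expect_prod_indicator_hash (i : Fin c) (Q : Finset (Bin k)) (F : Finset (Key c A))
    (hF : Set.InjOn (fun x : Key c A => x i) F) :
    𝔼 T : Tables c k A, ∏ x ∈ F, Set.indicator (Q : Set (Bin k)) (1 : Bin k → ℝ) (T.hash x) =
      (Q.card / 2 ^ k) ^ F.card := by
  induction F using Finset.induction_on with
  | empty => simp [Finset.expect_const (Finset.univ_nonempty (α := Tables c k A))]
  | insert x F hx ih =>
    simp_rw [Finset.prod_insert hx]
    rw [expect_hash_mul i x, expect_indicator_mem,
      ih (hF.mono (Finset.coe_subset.2 (Finset.subset_insert _ _))),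
      Finset.card_insert_of_notMem hx, pow_succ']
    intro s T
    refine Finset.prod_congr rfl fun y hy => ?_
    rw [hash_addRow_single_of_ne]
    intro hyx
    have := hF (Finset.mem_coe.2 (Finset.mem_insert_of_mem hy))
      (Finset.mem_coe.2 (Finset.mem_insert_self x F)) hyx
    exact hx (this ▸ hy)

lemma pr_pow_lt_card_filter_le (H : Finset (Key c A)) (Q : Finset (Bin k)) (u : ℕ) :
    pr (fun T : Tables c k A => u ^ c < (H.filter fun x => T.hash x ∈ Q).card) ≤
      c * (H.card * (Q.card / 2 ^ k)) ^ (u + 1) := by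
  classical
  let 𝓕 : Fin c → Finset (Finset (Key c A)) := fun i =>
    (H.powersetCard (u + 1)).filter fun F => Set.InjOn (fun x : Key c A => x i) F
  have h1 : pr (fun T : Tables c k A => u ^ c < (H.filter fun x => T.hash x ∈ Q).card) ≤
      pr (fun T : Tables c k A => ∃ i ∈ (Finset.univ : Finset (Fin c)),
        ∃ F ∈ 𝓕 i, ∀ x ∈ F, T.hash x ∈ Q) := by
    refine pr_mono fun T hT => ?_
    obtain ⟨i, F, hF, hcard, hinj⟩ := exists_subset_injOn _ hT
    refine ⟨i, Finset.mem_univ i, F, ?_, fun x hx => (Finset.mem_filter.1 (hF hx)).2⟩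
    rw [Finset.mem_filter, Finset.mem_powersetCard]
    exact ⟨⟨hF.trans (Finset.filter_subset _ _), hcard⟩, hinj⟩
  have h2 : ∀ i, pr (fun T : Tables c k A => ∃ F ∈ 𝓕 i, ∀ x ∈ F, T.hash x ∈ Q) ≤
      (H.card * (Q.card / 2 ^ k)) ^ (u + 1) := by
    intro i
    refine (pr_exists_le (𝓕 i) fun F (T : Tables c k A) => ∀ x ∈ F, T.hash x ∈ Q).trans ?_
    have h3 : ∀ F ∈ 𝓕 i, pr (fun T : Tables c k A => ∀ x ∈ F, T.hash x ∈ Q) ≤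
        (Q.card / 2 ^ k) ^ (u + 1) := by
      intro F hF
      rw [Finset.mem_filter, Finset.mem_powersetCard] at hF
      rw [← hF.1.2, ← expect_prod_indicator_hash i Q F hF.2]
      refine pr_le_expect (fun T => Finset.prod_nonneg fun x _ =>
        Set.indicator_nonneg (fun _ _ => zero_le_one) _) fun T hT => ?_
      rw [Finset.prod_eq_one]
      intro x hx
      rw [Set.indicator_of_mem (Finset.mem_coe.2 (hT x hx))]; rfl
    refine (Finset.sum_le_sum h3).trans ?_
    rw [Finset.sum_const, nsmul_eq_mul, mul_pow]
    refine mul_le_mul_of_nonneg_right ?_ (by positivity)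
    have h4 : (𝓕 i).card ≤ H.card ^ (u + 1) :=
      (Finset.card_filter_le _ _).trans
        ((Finset.card_powersetCard _ _).trans_le (Nat.choose_le_pow _ _))
    exact_mod_cast h4
  refine h1.trans ((pr_exists_le _ _).trans ((Finset.sum_le_sum fun i _ => h2 i).trans ?_))
  simp

lemma pr_pow_lt_card_filter_le_rpow {γ : ℝ} {u : ℕ} (hu : 2 * γ ≤ u) (H : Finset (Key c A))
    (Q : Finset (Bin k)) (hH : (H.card : ℝ) ≤ ((2 : ℝ) ^ k) ^ (1 / 4 : ℝ))
    (hQ : (Q.card : ℝ) ≤ ((2 : ℝ) ^ k) ^ (1 / 4 : ℝ)) :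
    pr (fun T : Tables c k A => u ^ c < (H.filter fun x => T.hash x ∈ Q).card) ≤
      c * ((2 : ℝ) ^ k) ^ (-γ) := by
  refine (pr_pow_lt_card_filter_le H Q u).trans ?_
  have h1 : (1 : ℝ) ≤ 2 ^ k := one_le_pow₀ one_le_two
  have h0 : (0 : ℝ) < 2 ^ k := by positivity
  generalize (2 : ℝ) ^ k = m at *
  refine mul_le_mul_of_nonneg_left ?_ (Nat.cast_nonneg _)
  -- The exponent is 1/4 + 1/4 - 1 = -1/2, so `u + 1` independent hits cost more than `γ` powers of
  -- m once `u ≥ 2γ`.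
  have h2 : (H.card : ℝ) * (Q.card / m) ≤ m ^ (-(1 / 2) : ℝ) := by
    have : m ^ (-(1 / 2) : ℝ) = m ^ (1 / 4 : ℝ) * (m ^ (1 / 4 : ℝ) / m) := by
      nth_rw 4 [← Real.rpow_one m]
      rw [← Real.rpow_sub h0, ← Real.rpow_add h0]
      norm_num
    rw [this]
    gcongr
  calc _ ≤ (m ^ (-(1 / 2) : ℝ)) ^ (u + 1) := pow_le_pow_left₀ (by positivity) h2 _
    _ = m ^ (-(1 / 2) * ((u + 1 : ℕ) : ℝ)) := by rw [Real.rpow_mul h0.le, Real.rpow_natCast]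
    _ ≤ m ^ (-γ) := by
        refine Real.rpow_le_rpow_of_exponent_le h1 ?_
        push_cast; linarith

end SmallSets

/-! ### Centred sums and their Fourier transforms -/

section Weights

variable {c k : ℕ} {A : Type*}

/-- The total weight `∑_{x ∈ S} ∑_b v(x, b)²`. -/
def weight (S : Finset (Key c A)) (v : Key c A → Bin k → ℝ) : ℝ := ∑ x ∈ S, sqn (v x)

/-- The value function recentred to have mean zero over the hash range, for every key. -/
noncomputable def cen (v : Key c A → Bin k → ℝ) (x : Key c A) (b : Bin k) : ℝ :=
  v x b - 𝔼 b', v x b'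

/-- The vector of the recentred sums `V_j - μ`. -/
noncomputable def cenVec (S : Finset (Key c A)) (v : Key c A → Bin k → ℝ) (T : Tables c k A)
    (j : Bin k) : ℝ :=
  ∑ x ∈ S, cen v x (T.hash x + j)

lemma weight_nonneg (S : Finset (Key c A)) (v : Key c A → Bin k → ℝ) : 0 ≤ weight S v :=
  Finset.sum_nonneg fun _ _ => sqn_nonneg _

lemma weight_mono {S S' : Finset (Key c A)} (h : S ⊆ S') (v : Key c A → Bin k → ℝ) :
    weight S v ≤ weight S' v :=
  Finset.sum_le_sum_of_subset_of_nonneg h fun _ _ _ => sqn_nonneg _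

lemma sum_eq_card_mul_expect (f : Bin k → ℝ) : ∑ b, f b = 2 ^ k * 𝔼 b, f b := by
  rw [Fintype.expect_eq_sum_div_card, card_bin]
  push_cast
  field_simp

lemma sum_cen (v : Key c A → Bin k → ℝ) (x : Key c A) : ∑ b, cen v x b = 0 := by
  simp only [cen, Finset.sum_sub_distrib, Finset.sum_const, Finset.card_univ, card_bin,
    nsmul_eq_mul]
  rw [sum_eq_card_mul_expect]; push_cast; ring

lemma expect_cen (v : Key c A → Bin k → ℝ) (x : Key c A) : 𝔼 b, cen v x b = 0 := by
  rw [Fintype.expect_eq_sum_div_card, sum_cen, zero_div]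

lemma sum_cenVec (S : Finset (Key c A)) (v : Key c A → Bin k → ℝ) (T : Tables c k A) :
    ∑ j, cenVec S v T j = 0 := by
  simp only [cenVec]
  rw [Finset.sum_comm]
  refine Finset.sum_eq_zero fun x _ => ?_
  rw [← sum_cen v x]
  exact Fintype.sum_equiv (Equiv.addLeft (T.hash x)) _ _ fun _ => rfl

lemma sqn_le_sqn_add_const {f : Bin k → ℝ} (hf : ∑ j, f j = 0) (a : ℝ) :
    sqn f ≤ sqn fun j => f j + a := by
  rw [sqn_add f fun _ => a]
  have h : ∑ j, f j * a = 0 := by rw [← Finset.sum_mul, hf, zero_mul]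
  rw [h]
  linarith [sqn_nonneg fun _ : Bin k => a]

lemma cenVec_add_const (S : Finset (Key c A)) (v : Key c A → Bin k → ℝ) (T : Tables c k A)
    (j : Bin k) : cenVec S v T j + ∑ x ∈ S, 𝔼 b, v x b = shiftedSum S v j T := by
  simp [cenVec, cen, shiftedSum]

lemma sqn_cenVec_le (S : Finset (Key c A)) (v : Key c A → Bin k → ℝ) (T : Tables c k A) :
    sqn (cenVec S v T) ≤ sqn fun j => shiftedSum S v j T := by
  simp_rw [← cenVec_add_const]
  exact sqn_le_sqn_add_const (sum_cenVec S v T) _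

lemma sqn_cen_le (v : Key c A → Bin k → ℝ) (x : Key c A) : sqn (cen v x) ≤ sqn (v x) := by
  refine (sqn_le_sqn_add_const (sum_cen v x) (𝔼 b, v x b)).trans_eq ?_
  simp [cen]

lemma eq_zero_of_weight_eq_zero {S : Finset (Key c A)} {v : Key c A → Bin k → ℝ}
    (h : weight S v = 0) : ∀ x ∈ S, ∀ b, v x b = 0 := by
  intro x hx b
  have h1 := (Finset.sum_eq_zero_iff_of_nonneg fun y _ => sqn_nonneg (v y)).1 h x hx
  have h2 := (Finset.sum_eq_zero_iff_of_nonneg fun b _ => sq_nonneg (v x b)).1 h1 b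
    (Finset.mem_univ b)
  simpa using h2

lemma cenVec_eq_zero_of_weight_eq_zero {S : Finset (Key c A)} {v : Key c A → Bin k → ℝ}
    (h : weight S v = 0) (T : Tables c k A) (j : Bin k) : cenVec S v T j = 0 := by
  refine Finset.sum_eq_zero fun x hx => ?_
  simp [cen, eq_zero_of_weight_eq_zero h x hx]

lemma sqn_cenVec_eq_zero {S : Finset (Key c A)} {v : Key c A → Bin k → ℝ}
    (h : weight S v = 0) (T : Tables c k A) : sqn (cenVec S v T) = 0 := by
  simp [sqn, cenVec_eq_zero_of_weight_eq_zero h T]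

lemma ft_cen (v : Key c A → Bin k → ℝ) (x : Key c A) {u : Bin k} (hu : u ≠ 0) :
    ft (cen v x) u = ft (v x) u := by
  simp only [ft, cen, sub_mul, Finset.sum_sub_distrib]
  rw [← Finset.mul_sum, sum_chi_right hu, mul_zero, sub_zero]

/-- Translating by the hash value multiplies the transform by a character, so each nontrivial
Fourier coefficient is a chaos in the hash values. -/
lemma ft_cenVec (S : Finset (Key c A)) (v : Key c A → Bin k → ℝ) (T : Tables c k A) {u : Bin k}
    (hu : u ≠ 0) : ft (cenVec S v T) u = ∑ x ∈ S, ft (v x) u * chi u (T.hash x) := by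
  simp only [ft, cenVec, Finset.sum_mul]
  rw [Finset.sum_comm]
  refine Finset.sum_congr rfl fun x _ => ?_
  rw [← Finset.sum_mul]
  change _ = ft (v x) u * _
  rw [← ft_cen v x hu, ft, Finset.sum_mul]
  refine Fintype.sum_equiv (Equiv.addLeft (T.hash x)) _ _ fun b => ?_
  simp only [Equiv.coe_addLeft, chi_add]
  linear_combination (-(cen v x (T.hash x + b) * chi u b)) * chi_sq u (T.hash x)

lemma ft_cenVec_zero (S : Finset (Key c A)) (v : Key c A → Bin k → ℝ) (T : Tables c k A) :
    ft (cenVec S v T) 0 = 0 := by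
  simp only [ft, chi_comm 0]
  rw [← sum_cenVec S v T]
  refine Finset.sum_congr rfl fun b _ => ?_
  simp [chi, sgn]

/-- The set of hash values where the value function does not vanish is contained in `Q`, which has
at most `m ^ (1 / 4)` elements. -/
def SmallSupport (v : Key c A → Bin k → ℝ) (Q : Finset (Bin k)) : Prop :=
  (∀ x b, v x b ≠ 0 → b ∈ Q) ∧ (Q.card : ℝ) ≤ ((2 : ℝ) ^ k) ^ (1 / 4 : ℝ)

lemma SmallSupport.shift {v : Key c A → Bin k → ℝ} {Q : Finset (Bin k)} (h : SmallSupport v Q)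
    (j : Bin k) : SmallSupport (fun x b => v x (b + j)) (Q.map (Equiv.addRight j).toEmbedding) := by
  refine ⟨fun x b hb => ?_, by rw [Finset.card_map]; exact h.2⟩
  rw [Finset.mem_map]
  exact ⟨b + j, h.1 x _ hb, bin_add_cancel b j⟩

variable [DecidableEq A]

lemma sum_weight_filter [Fintype A] (S : Finset (Key c A)) (v : Key c A → Bin k → ℝ) (i : Fin c) :
    ∑ a, weight (S.filter fun x => x i = a) v = weight S v :=
  Finset.sum_fiberwise S (fun x : Key c A => x i) _

lemma cenVec_addRow [Fintype A] (S : Finset (Key c A)) (v : Key c A → Bin k → ℝ)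
    (T : Tables c k A) (i : Fin c) (g : A → Bin k) (j : Bin k) :
    cenVec S v (addRow T i g) j =
      ∑ a, cenVec (S.filter fun x => x i = a) v T (j + g a) := by
  unfold cenVec
  rw [← Finset.sum_fiberwise S (fun x => x i)]
  refine Finset.sum_congr rfl fun a _ => Finset.sum_congr rfl fun x hx => ?_
  rw [hash_addRow, (Finset.mem_filter.1 hx).2]
  congr 1; abel

end Weights

/-! ### Light and heavy characters -/

section Partition

variable {c : ℕ} {A : Type*} [Fintype A] [DecidableEq A]

/-- A set of weighted keys splits into few keys and, for each position, a set such that the keys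
having a given character in this position have a small total weight. -/
lemma exists_light_partition {J : Finset (Fin c)} {S : Finset (Key c A)} (hS : AgreeOff J S)
    (w : Key c A → ℝ) (hw : ∀ x, 0 ≤ w x) (hW : 0 < ∑ x ∈ S, w x) {R : ℝ} (hR : 1 ≤ R) :
    ∃ κ : Key c A → Option (Fin c),
      ((S.filter fun x => κ x = none).card : ℝ) ≤ R ^ c ∧
      (∀ i a, ∑ x ∈ (S.filter fun x => κ x = some i).filter (fun x => x i = a), w x ≤
        (∑ x ∈ S, w x) / R) ∧
      ∀ i ∉ J, (S.filter fun x => κ x = some i) = ∅ := by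
  classical
  set W := ∑ x ∈ S, w x
  have hR0 : 0 < R := zero_lt_one.trans_le hR
  obtain ⟨light, hlight⟩ : ∃ light : Fin c → A → Prop, ∀ i a, light i a ↔
      ∑ x ∈ S.filter (fun x => x i = a), w x < W / R := ⟨_, fun _ _ => Iff.rfl⟩
  let κ : Key c A → Option (Fin c) := fun x =>
    if h : ∃ i, light i (x i) then some h.choose else none
  have hsome : ∀ x i, κ x = some i → light i (x i) := by
    intro x i h
    by_cases hx : ∃ i, light i (x i)
    · have : κ x = some hx.choose := dif_pos hx
      rw [this, Option.some_inj] at h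
      rw [← h]; exact hx.choose_spec
    · have : κ x = none := dif_neg hx
      rw [this] at h; cases h
  have hnone : ∀ x, κ x = none → ∀ i, ¬ light i (x i) := by
    intro x h i hi
    have : κ x = some (Exists.choose ⟨i, hi⟩) := dif_pos (⟨i, hi⟩ : ∃ i, light i (x i))
    rw [this] at h; cases h
  refine ⟨κ, ?_, ?_, ?_⟩
  -- Each heavy character accounts for at least W / R of the total weight W, so a position has at
  -- most R of them.
  · have h1 : ∀ i, ((Finset.univ.filter fun a => ¬ light i a).card : ℝ) ≤ R := by
      intro i
      have h2 : ∑ a, ∑ x ∈ S.filter (fun x => x i = a), w x = W :=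
        Finset.sum_fiberwise S (fun x : Key c A => x i) _
      have h3 : ∑ a ∈ Finset.univ.filter (fun a => ¬ light i a), W / R ≤ W := by
        refine le_trans ?_ h2.le
        refine (Finset.sum_le_sum (g := fun a => ∑ x ∈ S.filter (fun x => x i = a), w x)
          fun a ha => not_lt.1 ((hlight i a).not.1 (Finset.mem_filter.1 ha).2)).trans ?_
        exact Finset.sum_le_sum_of_subset_of_nonneg (Finset.subset_univ _)
          fun a _ _ => Finset.sum_nonneg fun x _ => hw x
      rw [Finset.sum_const, nsmul_eq_mul, mul_div_assoc', div_le_iff₀ hR0, mul_comm W] at h3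
      exact le_of_mul_le_mul_right h3 hW
    have h2 : (S.filter fun x => κ x = none) ⊆
        Fintype.piFinset fun i => Finset.univ.filter fun a => ¬ light i a := by
      intro x hx
      rw [Fintype.mem_piFinset]
      exact fun i => Finset.mem_filter.2 ⟨Finset.mem_univ _, hnone x (Finset.mem_filter.1 hx).2 i⟩
    have h3 := Finset.card_le_card h2
    rw [Fintype.card_piFinset] at h3
    calc ((S.filter fun x => κ x = none).card : ℝ)
        ≤ ∏ i : Fin c, ((Finset.univ.filter fun a => ¬ light i a).card : ℝ) := by exact_mod_cast h3
      _ ≤ ∏ _i : Fin c, R := Finset.prod_le_prod (fun _ _ => Nat.cast_nonneg _) fun i _ => h1 i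
      _ = R ^ c := by simp
  · intro i a
    rcases ((S.filter fun x => κ x = some i).filter (fun x => x i = a)).eq_empty_or_nonempty
      with h | ⟨x, hx⟩
    · rw [h, Finset.sum_empty]; positivity
    · rw [Finset.mem_filter, Finset.mem_filter] at hx
      have h1 : light i a := hx.2 ▸ hsome x i hx.1.2
      refine le_trans ?_ ((hlight i a).1 h1).le
      exact Finset.sum_le_sum_of_subset_of_nonneg
        (Finset.filter_subset_filter _ (Finset.filter_subset _ _)) fun x _ _ => hw x
  · intro i hi
    rw [Finset.filter_eq_empty_iff]
    intro x hx h
    have h1 : light i (x i) := hsome x i h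
    have h2 : (S.filter fun y => y i = x i) = S :=
      Finset.filter_true_of_mem fun y hy => hS y hy x hx i hi
    -- Outside `J` all keys share one character, which carries the whole weight and cannot be light.
    have h3 : W < W / R := by
      have h4 : ∑ y ∈ S.filter (fun y => y i = x i), w y < W / R := (hlight _ _).1 h1
      rwa [h2] at h4
    exact absurd h3 (not_lt.2 (div_le_self hW.le hR))

end Partition

/-! ### Stretched exponentials against powers -/

section Growth

lemma exists_exp_neg_rpow_le {a η : ℝ} (ha : 0 < a) (hη : 0 < η) (γ : ℝ) :
    ∃ K : ℝ, 0 ≤ K ∧ ∀ m : ℝ, 1 ≤ m → Real.exp (-(a * m ^ η)) ≤ K * m ^ (-γ) := by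
  obtain ⟨n, hn⟩ := exists_nat_ge (γ / η)
  refine ⟨n.factorial / a ^ n, by positivity, fun m hm => ?_⟩
  have hm0 : 0 < m := zero_lt_one.trans_le hm
  have h1 := Real.pow_div_factorial_le_exp (a * m ^ η) (by positivity) n
  have h2 : m ^ γ ≤ (m ^ η) ^ n := by
    rw [← Real.rpow_natCast, ← Real.rpow_mul hm0.le]
    refine Real.rpow_le_rpow_of_exponent_le hm ?_
    rw [div_le_iff₀ hη] at hn
    linarith
  have h3 : a ^ n * m ^ γ / n.factorial ≤ Real.exp (a * m ^ η) := by
    refine le_trans ?_ h1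
    rw [mul_pow]
    gcongr
  rw [Real.exp_neg, Real.rpow_neg hm0.le]
  have h4 : (n.factorial : ℝ) / a ^ n * (m ^ γ)⁻¹ = (a ^ n * m ^ γ / n.factorial)⁻¹ := by
    field_simp
  rw [h4]
  exact inv_anti₀ (by positivity) h3

end Growth

/-! ### The bound on squared deviations -/

section Squares

variable {c k : ℕ} {A : Type*}

/-- For each shift at most `r` terms are nonzero, so Cauchy–Schwarz loses only the factor `r`;
summing over shifts turns each key's contribution into `sqn (v x)`. -/
lemma sqn_cenVec_le_of_card_le {H : Finset (Key c A)} {v : Key c A → Bin k → ℝ}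
    {Q : Finset (Bin k)} (hQ : ∀ x b, v x b ≠ 0 → b ∈ Q) {T : Tables c k A} {r : ℕ}
    (h : ∀ j : Bin k, (H.filter fun x => T.hash x + j ∈ Q).card ≤ r) :
    sqn (cenVec H v T) ≤ r * weight H v := by
  refine (sqn_cenVec_le H v T).trans ?_
  have h1 : ∀ j, shiftedSum H v j T ^ 2 ≤ r * ∑ x ∈ H, v x (T.hash x + j) ^ 2 := by
    intro j
    have h2 : shiftedSum H v j T =
        ∑ x ∈ H.filter (fun x => T.hash x + j ∈ Q), v x (T.hash x + j) := by
      refine (Finset.sum_filter_of_ne fun x _ hx => hQ x _ hx).symm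
    rw [h2]
    refine sq_sum_le_card_mul_sum_sq.trans ?_
    refine mul_le_mul (by exact_mod_cast h j) ?_ (Finset.sum_nonneg fun _ _ => sq_nonneg _)
      (Nat.cast_nonneg _)
    exact Finset.sum_le_sum_of_subset_of_nonneg (Finset.filter_subset _ _) fun _ _ _ => sq_nonneg _
  refine (Finset.sum_le_sum fun j _ => h1 j).trans_eq ?_
  rw [← Finset.mul_sum, Finset.sum_comm]
  congr 1
  refine Finset.sum_congr rfl fun x _ => ?_
  exact Fintype.sum_equiv (Equiv.addLeft (T.hash x)) _ _ fun _ => rfl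

variable [Fintype A] [DecidableEq A]

/-- The union bound over `2 ^ k` shifts costs one power of m, hence `γ + 1` in `hu`. -/
lemma pr_exists_card_filter_le {γ : ℝ} {u : ℕ} (hu : 2 * (γ + 1) ≤ u) (H : Finset (Key c A))
    (hH : (H.card : ℝ) ≤ ((2 : ℝ) ^ k) ^ (1 / 4 : ℝ)) {v : Key c A → Bin k → ℝ}
    {Q : Finset (Bin k)} (hQ : SmallSupport v Q) :
    pr (fun T : Tables c k A => ∃ j : Bin k, u ^ c < (H.filter fun x => T.hash x + j ∈ Q).card) ≤
      c * H.card * ((2 : ℝ) ^ k) ^ (-γ) := by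
  rcases H.eq_empty_or_nonempty with rfl | hne
  · rw [pr_eq_zero fun T => by simp]
    simp
  have h1 : ∀ j : Bin k,
      pr (fun T : Tables c k A => u ^ c < (H.filter fun x => T.hash x + j ∈ Q).card) ≤
        c * ((2 : ℝ) ^ k) ^ (-(γ + 1)) := by
    intro j
    refine le_trans (pr_mono fun T hT => ?_)
      (pr_pow_lt_card_filter_le_rpow hu H _ hH (hQ.shift j).2)
    refine hT.trans_eq (congrArg _ (Finset.filter_congr fun x _ => ?_))
    rw [Finset.mem_map]
    constructor
    · exact fun h => ⟨_, h, bin_add_cancel _ _⟩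
    · rintro ⟨b, hb, hbx⟩
      rw [← hbx]
      simpa [bin_add_cancel] using hb
  have h2 := (pr_exists_le (Finset.univ : Finset (Bin k))
    fun j (T : Tables c k A) => u ^ c < (H.filter fun x => T.hash x + j ∈ Q).card).trans
    (Finset.sum_le_sum fun j _ => h1 j)
  simp only [Finset.mem_univ, true_and, Finset.sum_const, Finset.card_univ, card_bin,
    nsmul_eq_mul, Nat.cast_pow, Nat.cast_ofNat] at h2
  refine h2.trans ?_
  have hm : (0 : ℝ) < 2 ^ k := by positivity
  have h3 : (2 : ℝ) ^ k * (c * ((2 : ℝ) ^ k) ^ (-(γ + 1))) = c * 1 * ((2 : ℝ) ^ k) ^ (-γ) := by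
    rw [neg_add, Real.rpow_add hm, Real.rpow_neg_one]
    field_simp
  rw [h3]
  have h4 : (1 : ℝ) ≤ H.card := by exact_mod_cast hne.card_pos
  gcongr

/-- Markov's inequality for the 2p-th moment. The sum of squared coefficients is at most m^(1/4)
times the weight, and comparison with m^(1/2) gains m^(-1/4) for each of the p factors. -/
lemma pr_ft_cenVec_le (G : Finset (Key c A)) {v : Key c A → Bin k → ℝ} {Q : Finset (Bin k)}
    (hQ : SmallSupport v Q) {p : ℕ} (hp : p ≠ 0) {u : Bin k} (hu : u ≠ 0) :
    pr (fun T : Tables c k A =>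
        ((2 : ℝ) ^ k) ^ (1 / 2 : ℝ) * weight G v < ft (cenVec G v T) u ^ 2) ≤
      (4 * (2 * p).factorial) ^ c * ((2 : ℝ) ^ k) ^ (-(p / 4) : ℝ) := by
  rcases (weight_nonneg G v).eq_or_lt with h0 | h0
  · rw [pr_eq_zero fun T => ?_]
    · positivity
    · rw [← h0]
      simp [ft, cenVec_eq_zero_of_weight_eq_zero h0.symm T]
  have hm : (0 : ℝ) < 2 ^ k := by positivity
  set m : ℝ := 2 ^ k
  have h1 : ∑ x ∈ G, ft (v x) u ^ 2 ≤ m ^ (1 / 4 : ℝ) * weight G v := by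
    rw [weight, Finset.mul_sum]
    refine Finset.sum_le_sum fun x _ => (ft_sq_le (v x) u Q (hQ.1 x)).trans ?_
    exact mul_le_mul_of_nonneg_right hQ.2 (sqn_nonneg _)
  have h2 := expect_chaos_pow_le (k := k) hu hp (Finset.univ : Finset (Fin c)) G
    (fun _ _ _ _ i hi => (hi (Finset.mem_univ i)).elim) fun x => ft (v x) u
  rw [Finset.card_univ, Fintype.card_fin] at h2
  have h3 := pr_le_div (p := fun T : Tables c k A => m ^ (1 / 2 : ℝ) * weight G v <
      ft (cenVec G v T) u ^ 2) (f := fun T => (∑ x ∈ G, ft (v x) u * chi u (T.hash x)) ^ (2 * p))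
    (a := (m ^ (1 / 2 : ℝ) * weight G v) ^ p) (by positivity)
    (fun T => by rw [pow_mul]; positivity) (fun T hT => by
      rw [ft_cenVec G v T hu] at hT
      rw [pow_mul]
      exact pow_le_pow_left₀ (by positivity) hT.le p)
  refine h3.trans ?_
  rw [div_le_iff₀ (by positivity)]
  refine h2.trans ?_
  rw [mul_assoc]
  refine mul_le_mul_of_nonneg_left ?_ (by positivity)
  refine (pow_le_pow_left₀ (Finset.sum_nonneg fun _ _ => sq_nonneg _) h1 p).trans_eq ?_
  have h4 : m ^ (1 / 4 : ℝ) = m ^ (-(1 / 4) : ℝ) * m ^ (1 / 2 : ℝ) := by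
    rw [← Real.rpow_add hm]; norm_num
  have h5 : m ^ (-(p / 4) : ℝ) = (m ^ (-(1 / 4) : ℝ)) ^ p := by
    rw [← Real.rpow_natCast, ← Real.rpow_mul hm.le]; congr 1; ring
  rw [h4, h5, mul_assoc, mul_pow]

lemma pr_sqn_cenVec_addRow_le {S : Finset (Key c A)} {v : Key c A → Bin k → ℝ} {i : Fin c}
    {T : Tables c k A} {W D r b : ℝ} (hD : 0 ≤ D) (hW : 0 < W) (hr : 0 < r) (hb : 0 ≤ b)
    (hrb : r ^ 2 * b ≤ 2 ^ k) (hS : weight S v ≤ W)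
    (hG : ∀ a, weight (S.filter fun x => x i = a) v ≤ W / r ^ 2)
    (h1 : ∀ a, sqn (cenVec (S.filter fun x => x i = a) v T) ≤
      D * weight (S.filter fun x => x i = a) v)
    (h2 : ∀ a, ∀ u ≠ 0, ft (cenVec (S.filter fun x => x i = a) v T) u ^ 2 ≤
      b * weight (S.filter fun x => x i = a) v) :
    pr (fun g : A → Bin k => (1 + D) * W < sqn (cenVec S v (addRow T i g))) ≤
      Real.exp 1 * Real.exp (-(1 / (2 * (1 + D)) * r)) := by
  set B : A → Bin k → ℝ := fun a => cenVec (S.filter fun x => x i = a) v T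
  set w : A → ℝ := fun a => weight (S.filter fun x => x i = a) v
  have hw : ∀ a, 0 ≤ w a := fun a => weight_nonneg _ _
  have hsw : ∑ a, w a ≤ W := (sum_weight_filter S v i).trans_le hS
  have hD1 : 0 < 1 + D := by linarith
  -- The largest scale of `l` allowed by groups of norm D W / r²: the linear exponent becomes -r /
  -- (2 (1 + D)), while the quadratic one stays below 1 by `hrb` and contributes the factor e.
  set l : ℝ := r / (2 * (1 + D) * W)
  have hl0 : 0 ≤ l := by positivity
  have hsB : ∑ a, sqn (B a) ≤ D * W := by
    refine (Finset.sum_le_sum fun a _ => h1 a).trans ?_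
    rw [← Finset.mul_sum]
    exact mul_le_mul_of_nonneg_left hsw hD
  have key := pr_sqn_sum_shift_le B (fun a => b * w a) hl0 (Θ := (1 + D) * W) (by positivity)
    Finset.univ (fun a _ => sum_cenVec _ v T) (fun a _ u => ?_) (fun a _ => ?_) (fun _ => 0) W
    (by linarith)
  · refine le_trans (pr_mono fun g hg => ?_) (key.trans ?_)
    · refine lt_of_le_of_lt (by linarith : _ ≤ (1 + D) * W) (hg.trans_eq ?_)
      congr 1
      funext j
      rw [cenVec_addRow, zero_add]
    · rw [← Real.exp_add]
      refine Real.exp_le_exp.2 ?_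
      have e1 : sqn (fun _ : Bin k => (0 : ℝ)) = 0 := by simp [sqn]
      have e2 : l * (sqn (fun _ : Bin k => (0 : ℝ)) - W) = -(1 / (2 * (1 + D)) * r) := by
        rw [e1]; simp only [l]; field_simp; ring
      have e3 : l ^ 2 * ∑ a, 4 * ((1 + D) * W) * (b * w a) / 2 ^ k =
          (r ^ 2 * b) / 2 ^ k * ((∑ a, w a) / W) * (1 / (1 + D)) := by
        have : ∀ a, 4 * ((1 + D) * W) * (b * w a) / 2 ^ k =
            (4 * ((1 + D) * W) * b / 2 ^ k) * w a := fun a => by ring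
        simp_rw [this, ← Finset.mul_sum]
        simp only [l]; field_simp; ring
      rw [e2, e3]
      have e4 : (r ^ 2 * b) / 2 ^ k ≤ 1 := (div_le_one (by positivity)).2 hrb
      have e5 : (∑ a, w a) / W ≤ 1 := (div_le_one hW).2 hsw
      have e6 : 1 / (1 + D) ≤ 1 := (div_le_one hD1).2 (by linarith)
      have e7 : 0 ≤ (∑ a, w a) / W := div_nonneg (Finset.sum_nonneg fun a _ => hw a) hW.le
      have e8 : 0 ≤ (r ^ 2 * b) / 2 ^ k := by positivity
      have e9 := mul_le_one₀ (mul_le_one₀ e4 e7 e5) (by positivity) e6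
      linarith
  · by_cases hu : u = 0
    · rw [hu, ft_cenVec_zero]
      simpa using mul_nonneg hb (hw a)
    · exact h2 a u hu
  · have e1 : sqn (B a) ≤ D * (W / r ^ 2) :=
      (h1 a).trans (mul_le_mul_of_nonneg_left (hG a) hD)
    calc 4 * l ^ 2 * ((1 + D) * W * sqn (B a))
        ≤ 4 * l ^ 2 * ((1 + D) * W * (D * (W / r ^ 2))) := by gcongr
      _ = D / (1 + D) := by simp only [l]; field_simp; ring
      _ ≤ 1 := (div_le_one hD1).2 (by linarith)

end Squares

section SquareBound

variable {c k : ℕ} {A : Type*}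

lemma sqn_cenVec_le_card_mul (S : Finset (Key c A)) (v : Key c A → Bin k → ℝ)
    (T : Tables c k A) : sqn (cenVec S v T) ≤ S.card * weight S v := by
  refine (sqn_sum_le S fun x j => cen v x (T.hash x + j)).trans ?_
  refine mul_le_mul_of_nonneg_left (Finset.sum_le_sum fun x _ => ?_) (Nat.cast_nonneg _)
  refine le_trans (le_of_eq ?_) (sqn_cen_le v x)
  rw [← sqn_shift (cen v x) (T.hash x)]
  simp_rw [add_comm (T.hash x)]

lemma cenVec_eq_sum_partition {κ : Type*} [Fintype κ] [DecidableEq κ] (S : Finset (Key c A))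
    (f : Key c A → κ) (v : Key c A → Bin k → ℝ) (T : Tables c k A) (j : Bin k) :
    cenVec S v T j = ∑ o, cenVec (S.filter fun x => f x = o) v T j :=
  (Finset.sum_fiberwise S f _).symm

variable [DecidableEq A]

lemma sum_card_filter [Fintype A] (S : Finset (Key c A)) (i : Fin c) :
    ∑ a, ((S.filter fun x => x i = a).card : ℝ) = S.card := by
  have := Finset.sum_fiberwise S (fun x : Key c A => x i) fun _ => (1 : ℝ)
  simpa using this

variable [Fintype A]

/-- Errors proportional to the group size add up to an error proportional to `S.card`, so the union
bound does not involve the size of the alphabet. -/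
lemma pr_exists_char_le (S : Finset (Key c A)) (i : Fin c) (p : A → Tables c k A → Prop) {C : ℝ}
    (h : ∀ a, pr (p a) ≤ C * (S.filter fun x => x i = a).card) :
    pr (fun T => ∃ a, p a T) ≤ C * S.card := by
  have h1 := (pr_exists_le Finset.univ p).trans (Finset.sum_le_sum fun a _ => h a)
  rw [← Finset.mul_sum, sum_card_filter] at h1
  simpa using h1

lemma pr_exists_ft_cenVec_le {γ : ℝ} {p : ℕ} (hp : p ≠ 0) (hpγ : 4 * (γ + 1) ≤ p)
    (G : Finset (Key c A)) {v : Key c A → Bin k → ℝ} {Q : Finset (Bin k)}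
    (hQ : SmallSupport v Q) :
    pr (fun T : Tables c k A => ∃ u ≠ 0,
        ((2 : ℝ) ^ k) ^ (1 / 2 : ℝ) * weight G v < ft (cenVec G v T) u ^ 2) ≤
      (4 * (2 * p).factorial) ^ c * ((2 : ℝ) ^ k) ^ (-γ) * G.card := by
  rcases G.eq_empty_or_nonempty with rfl | hne
  · rw [pr_eq_zero fun T => by simp [weight, ft, cenVec]]
    simp
  have hm : (0 : ℝ) < 2 ^ k := by positivity
  have h1 := pr_exists_le (Finset.univ.filter fun u : Bin k => u ≠ 0)
    fun u (T : Tables c k A) => ((2 : ℝ) ^ k) ^ (1 / 2 : ℝ) * weight G v < ft (cenVec G v T) u ^ 2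
  simp only [Finset.mem_filter, Finset.mem_univ, true_and] at h1
  refine h1.trans ((Finset.sum_le_sum fun u hu =>
    pr_ft_cenVec_le G hQ hp (Finset.mem_filter.1 hu).2).trans ?_)
  rw [Finset.sum_const, nsmul_eq_mul]
  have h2 : ((Finset.univ.filter fun u : Bin k => u ≠ 0).card : ℝ) ≤ 2 ^ k := by
    have := Finset.card_filter_le (Finset.univ : Finset (Bin k)) fun u => u ≠ 0
    rw [Finset.card_univ, card_bin] at this
    exact_mod_cast this
  have h3 : ((2 : ℝ) ^ k) ^ (-(p / 4) : ℝ) ≤ ((2 : ℝ) ^ k) ^ (-(γ + 1)) :=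
    Real.rpow_le_rpow_of_exponent_le (one_le_pow₀ one_le_two) (by linarith)
  have h4 : (1 : ℝ) ≤ G.card := by exact_mod_cast hne.card_pos
  calc _ ≤ (2 : ℝ) ^ k * ((4 * (2 * p).factorial) ^ c * ((2 : ℝ) ^ k) ^ (-(γ + 1))) := by gcongr
    _ = (4 * (2 * p).factorial) ^ c * ((2 : ℝ) ^ k) ^ (-γ) * 1 := by
      rw [neg_add, Real.rpow_add hm, Real.rpow_neg_one]; field_simp
    _ ≤ _ := by gcongr

/-- The induction step on one class: groups have small norm by `hsq` and a flat spectrum by the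
chaos bound, and then row `i` is resampled. With r = m^(1/(8c)) the failure probability is a
stretched exponential, beaten into a power of m by `hK₁`. -/
lemma pr_light_sqn_cenVec_le {γ D K K₁ : ℝ} {p : ℕ} (hc : 0 < c) (hD : 0 ≤ D) (hp : p ≠ 0)
    (hpγ : 4 * (γ + 1) ≤ p) {S : Finset (Key c A)} {v : Key c A → Bin k → ℝ} {Q : Finset (Bin k)}
    (hQ : SmallSupport v Q) {i : Fin c} {W : ℝ} (hW : 0 < W) (hS : weight S v ≤ W)
    (hG : ∀ a, weight (S.filter fun x => x i = a) v ≤ W / ((2 : ℝ) ^ k) ^ (1 / (4 * c) : ℝ))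
    (hsq : ∀ a, pr (fun T : Tables c k A => D * weight (S.filter fun x => x i = a) v <
        sqn (cenVec (S.filter fun x => x i = a) v T)) ≤
      K * (S.filter fun x => x i = a).card * ((2 : ℝ) ^ k) ^ (-γ))
    (hK₁ : ∀ m : ℝ, 1 ≤ m →
      Real.exp (-(1 / (2 * (1 + D)) * m ^ (1 / (8 * c) : ℝ))) ≤ K₁ * m ^ (-γ)) :
    pr (fun T : Tables c k A => (1 + D) * W < sqn (cenVec S v T)) ≤
      (K + (4 * (2 * p).factorial) ^ c + Real.exp 1 * K₁) * S.card * ((2 : ℝ) ^ k) ^ (-γ) := by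
  rcases S.eq_empty_or_nonempty with rfl | hne
  · rw [pr_eq_zero fun T => ?_]
    · simp
    · simp only [sqn, cenVec, Finset.sum_empty]
      simp only [ne_eq, OfNat.ofNat_ne_zero, not_false_eq_true, zero_pow, Finset.sum_const_zero,
        not_lt]
      positivity
  have hm1 : (1 : ℝ) ≤ 2 ^ k := one_le_pow₀ one_le_two
  have hm : (0 : ℝ) < 2 ^ k := by positivity
  set m : ℝ := 2 ^ k with hmk
  have hcard : (1 : ℝ) ≤ S.card := by exact_mod_cast hne.card_pos
  have hcR : (1 : ℝ) ≤ c := by exact_mod_cast hc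
  have hr2 : (m ^ (1 / (8 * c) : ℝ)) ^ 2 = m ^ (1 / (4 * c) : ℝ) := by
    rw [← Real.rpow_natCast, ← Real.rpow_mul hm.le]; congr 1; field_simp; norm_num
  have hexp := hK₁ m hm1
  have hmγ : 0 < m ^ (-γ) := Real.rpow_pos_of_pos hm _
  have key := pr_le_of_resample i (fun T : Tables c k A =>
      (∃ a, D * weight (S.filter fun x => x i = a) v <
        sqn (cenVec (S.filter fun x => x i = a) v T)) ∨
      (∃ a, ∃ u ≠ 0, m ^ (1 / 2 : ℝ) * weight (S.filter fun x => x i = a) v <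
        ft (cenVec (S.filter fun x => x i = a) v T) u ^ 2))
    (fun T => (1 + D) * W < sqn (cenVec S v T))
    (e := Real.exp 1 * Real.exp (-(1 / (2 * (1 + D)) * m ^ (1 / (8 * c) : ℝ)))) (by positivity) ?_
  · refine key.trans ?_
    have h1 := pr_exists_char_le S i (fun a (T : Tables c k A) =>
      D * weight (S.filter fun x => x i = a) v < sqn (cenVec (S.filter fun x => x i = a) v T))
      (C := K * m ^ (-γ)) fun a => (hsq a).trans_eq (by ring)
    have h2 := pr_exists_char_le S i (fun a (T : Tables c k A) => ∃ u ≠ 0,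
      m ^ (1 / 2 : ℝ) * weight (S.filter fun x => x i = a) v <
        ft (cenVec (S.filter fun x => x i = a) v T) u ^ 2) fun a =>
          pr_exists_ft_cenVec_le hp hpγ (S.filter fun x => x i = a) hQ
    have h3 : Real.exp 1 * Real.exp (-(1 / (2 * (1 + D)) * m ^ (1 / (8 * c) : ℝ))) ≤
        Real.exp 1 * (K₁ * m ^ (-γ)) * S.card := by
      refine le_trans (mul_le_mul_of_nonneg_left hexp (Real.exp_pos _).le) ?_
      have : 0 ≤ Real.exp 1 * (K₁ * m ^ (-γ)) :=
        mul_nonneg (Real.exp_pos _).le ((Real.exp_pos _).le.trans hexp)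
      exact le_mul_of_one_le_right this hcard
    refine (add_le_add ((pr_or_le _ _).trans (add_le_add h1 h2)) h3).trans_eq ?_
    ring
  · intro T hT
    push Not at hT
    refine pr_sqn_cenVec_addRow_le hD hW (r := m ^ (1 / (8 * c) : ℝ)) (b := m ^ (1 / 2 : ℝ))
      (Real.rpow_pos_of_pos hm _) (Real.rpow_nonneg hm.le _) ?_ hS (by rwa [hr2]) hT.1 hT.2
    -- Here r² b = m^(1/(4c) + 1/2), and the exponent is at most 3/4.
    rw [hr2, ← hmk, ← Real.rpow_add hm]
    conv_rhs => rw [← Real.rpow_one m]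
    refine Real.rpow_le_rpow_of_exponent_le hm1 ?_
    have : (1 : ℝ) / (4 * c) ≤ 1 / 4 := by
      rw [div_le_div_iff₀ (by positivity) (by norm_num)]; linarith
    linarith

end SquareBound

lemma rpow_inv_pow_le {m : ℝ} (hm : 0 < m) {c : ℕ} (hc : 0 < c) :
    (m ^ (1 / (4 * c) : ℝ)) ^ c = m ^ (1 / 4 : ℝ) := by
  rw [← Real.rpow_natCast, ← Real.rpow_mul hm.le]
  congr 1
  have : (c : ℝ) ≠ 0 := by positivity
  field_simp

/-- The sum of the squared deviations of the `V_j` is bounded by their total weight, for sets of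
keys that agree outside of a set of `n` positions. -/
lemma exists_square_bound {c : ℕ} (hc : 0 < c) (n : ℕ) (γ : ℝ) :
    ∃ D K : ℝ, 1 ≤ D ∧ 0 ≤ K ∧ ∀ (A : Type u) [Fintype A] [DecidableEq A] (k : ℕ)
      (J : Finset (Fin c)) (S : Finset (Key c A)) (v : Key c A → Bin k → ℝ) (Q : Finset (Bin k)),
      J.card ≤ n → AgreeOff J S → SmallSupport v Q →
      pr (fun T : Tables c k A => D * weight S v < sqn (cenVec S v T)) ≤
        K * S.card * ((2 : ℝ) ^ k) ^ (-γ) := by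
  induction n with
  | zero =>
    refine ⟨1, 0, le_rfl, le_rfl, fun A _ _ k J S v Q hJ hS hQ => ?_⟩
    rw [pr_eq_zero fun T => ?_, zero_mul, zero_mul]
    rw [Finset.card_eq_zero.1 (Nat.le_zero.1 hJ)] at hS
    have h1 : (S.card : ℝ) ≤ 1 := by exact_mod_cast hS.card_le_one
    exact not_lt.2 ((sqn_cenVec_le_card_mul S v T).trans
      (mul_le_mul_of_nonneg_right h1 (weight_nonneg S v)))
  | succ n ih =>
    obtain ⟨D, K, hD, hK, ih⟩ := ih
    obtain ⟨u, hu⟩ := exists_nat_ge (2 * (γ + 1))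
    obtain ⟨p, hp⟩ := exists_nat_ge (4 * (γ + 1))
    have hp' : 4 * (γ + 1) ≤ ((p + 1 : ℕ) : ℝ) := by push_cast; linarith
    obtain ⟨K₁, hK₁0, hK₁⟩ := exists_exp_neg_rpow_le (a := 1 / (2 * (1 + D)))
      (η := 1 / (8 * c)) (by positivity) (by positivity) γ
    set C : ℝ := K + (4 * (2 * (p + 1)).factorial) ^ c + Real.exp 1 * K₁ with hC
    have hC0 : 0 ≤ C := by positivity
    refine ⟨(c + 1) * (c * (1 + D) + u ^ c), (c + 1) * (C + c), ?_, by positivity,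
      fun A _ _ k J S v Q hJ hS hQ => ?_⟩
    · have h1 : (1 : ℝ) ≤ c := by exact_mod_cast hc
      have h2 : (0 : ℝ) ≤ u ^ c := by positivity
      nlinarith [mul_le_mul h1 hD zero_le_one (by positivity)]
    have hm1 : (1 : ℝ) ≤ 2 ^ k := one_le_pow₀ one_le_two
    have hm : (0 : ℝ) < 2 ^ k := by positivity
    have hmγ : 0 < ((2 : ℝ) ^ k) ^ (-γ) := Real.rpow_pos_of_pos hm _
    rcases (weight_nonneg S v).eq_or_lt with hW | hW
    · rw [pr_eq_zero fun T => by rw [← hW, sqn_cenVec_eq_zero hW.symm]; simp]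
      positivity
    obtain ⟨κ, hκ0, hκ1, hκ2⟩ := exists_light_partition hS (fun x => sqn (v x))
      (fun x => sqn_nonneg _) hW (R := ((2 : ℝ) ^ k) ^ (1 / (4 * c) : ℝ))
      (Real.one_le_rpow hm1 (by positivity))
    rw [rpow_inv_pow_le hm hc] at hκ0
    set P : Option (Fin c) → Finset (Key c A) := fun o => S.filter fun x => κ x = o with hP
    have hPS : ∀ o, P o ⊆ S := fun o => Finset.filter_subset _ _
    have hPcard : ∀ o, ((P o).card : ℝ) ≤ S.card := fun o => by
      exact_mod_cast Finset.card_le_card (hPS o)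
    have hnone : pr (fun T : Tables c k A => u ^ c * weight S v < sqn (cenVec (P none) v T)) ≤
        (C + c) * S.card * ((2 : ℝ) ^ k) ^ (-γ) := by
      refine (pr_mono fun T hT => ?_).trans ((pr_exists_card_filter_le hu (P none) hκ0 hQ).trans ?_)
      · by_contra! hcon
        have h1 := sqn_cenVec_le_of_card_le hQ.1 hcon
        push_cast at h1
        have h2 := mul_le_mul_of_nonneg_left (weight_mono (hPS none) v)
          (by positivity : (0 : ℝ) ≤ u ^ c)
        linarith
      · have := hPcard none
        have h0 : (0 : ℝ) ≤ c := Nat.cast_nonneg _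
        gcongr
        linarith
    have hsome : ∀ i, pr (fun T : Tables c k A =>
        (1 + D) * weight S v < sqn (cenVec (P (some i)) v T)) ≤
          (C + c) * S.card * ((2 : ℝ) ^ k) ^ (-γ) := by
      intro i
      by_cases hi : i ∈ J
      · refine (pr_light_sqn_cenVec_le hc (by linarith) p.succ_ne_zero hp' hQ hW
          (weight_mono (hPS _) v) (hκ1 i) (fun a => ?_) hK₁ (K := K)).trans ?_
        · refine ih A k (J.erase i) _ v Q ?_ ((hS.mono (hPS _)).filter i a) hQ
          rw [Finset.card_erase_of_mem hi]; omega
        · have := hPcard (some i)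
          have h0 : (0 : ℝ) ≤ c := Nat.cast_nonneg _
          rw [← hC]
          gcongr
          linarith
      · have h1 : P (some i) = ∅ := hκ2 i hi
        rw [h1, pr_eq_zero fun T => ?_]
        · positivity
        · simp only [sqn, cenVec, Finset.sum_empty]
          simp only [ne_eq, OfNat.ofNat_ne_zero, not_false_eq_true, zero_pow,
            Finset.sum_const_zero, not_lt]
          positivity
    have key : pr (fun T : Tables c k A =>
        (c + 1) * (c * (1 + D) + u ^ c) * weight S v < sqn (cenVec S v T)) ≤
        pr (fun T : Tables c k A => u ^ c * weight S v < sqn (cenVec (P none) v T) ∨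
          ∃ i ∈ Finset.univ, (1 + D) * weight S v < sqn (cenVec (P (some i)) v T)) := by
      refine pr_mono fun T hT => ?_
      by_contra! hcon
      -- Cauchy–Schwarz over the `c + 1` classes, which is the source of the factor `c + 1` in the
      -- constant.
      have h1 : sqn (cenVec S v T) ≤ (c + 1) * ∑ o, sqn (cenVec (P o) v T) := by
        have h2 := sqn_sum_le Finset.univ fun o => cenVec (P o) v T
        have h3 : (fun j => ∑ o, cenVec (P o) v T j) = cenVec S v T :=
          funext fun j => (cenVec_eq_sum_partition S κ v T j).symm
        rw [h3] at h2
        simpa using h2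
      rw [Fintype.sum_option] at h1
      have h2 : ∑ i, sqn (cenVec (P (some i)) v T) ≤ c * ((1 + D) * weight S v) := by
        refine (Finset.sum_le_sum fun i hi => hcon.2 i hi).trans_eq ?_
        simp
      have h3 := mul_le_mul_of_nonneg_left (add_le_add hcon.1 h2)
        (by positivity : (0 : ℝ) ≤ c + 1)
      nlinarith
    refine key.trans ((pr_or_le _ _).trans ?_)
    refine (add_le_add hnone ((pr_exists_le _ _).trans
      (Finset.sum_le_sum fun i _ => hsome i))).trans_eq ?_
    simp only [Finset.sum_const, Finset.card_univ, Fintype.card_fin, nsmul_eq_mul]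
    ring

/-! ### Variance and conditioning on a query -/

section Variance

variable {c k : ℕ} {A : Type*}

/-- The variance of `∑_{x ∈ S} v(x, h(x))` for pairwise independent hash values. -/
noncomputable def sumVar (S : Finset (Key c A)) (v : Key c A → Bin k → ℝ) : ℝ :=
  ∑ x ∈ S, 𝔼 b, cen v x b ^ 2

lemma sq_cenVec_zero (S : Finset (Key c A)) (v : Key c A → Bin k → ℝ) (T : Tables c k A) :
    cenVec S v T 0 ^ 2 = ∑ x ∈ S, ∑ x' ∈ S, cen v x (T.hash x) * cen v x' (T.hash x') := by
  simp only [cenVec, add_zero]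
  rw [sq, Finset.sum_mul_sum]

lemma expect_sq_cen (v : Key c A → Bin k → ℝ) (x : Key c A) :
    𝔼 b, cen v x b ^ 2 = sqn (cen v x) / 2 ^ k := by
  rw [Fintype.expect_eq_sum_div_card, card_bin]
  push_cast; rfl

lemma sumVar_le (S : Finset (Key c A)) (v : Key c A → Bin k → ℝ) :
    sumVar S v ≤ weight S v / 2 ^ k := by
  rw [sumVar, weight, Finset.sum_div]
  refine Finset.sum_le_sum fun x _ => ?_
  rw [expect_sq_cen]
  exact div_le_div_of_nonneg_right (sqn_cen_le v x) (by positivity)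

/-- Centring removes at most the fraction |Q| / m ≤ 3/5 of each squared norm. Without `hk` the range
could be a single point, where the variance vanishes. -/
lemma weight_div_le_sumVar (hk : 1 ≤ k) (S : Finset (Key c A)) {v : Key c A → Bin k → ℝ}
    {Q : Finset (Bin k)} (hQ : SmallSupport v Q) : weight S v / 2 ^ k ≤ 5 / 2 * sumVar S v := by
  have hm : (0 : ℝ) < 2 ^ k := by positivity
  have hm2 : (2 : ℝ) ≤ 2 ^ k := by
    calc (2 : ℝ) = 2 ^ 1 := by norm_num
      _ ≤ 2 ^ k := pow_le_pow_right₀ one_le_two hk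
  -- Indeed (|Q| / m)^4 ≤ m^(-3) ≤ 1/8 < (3/5)^4.
  have hQm : (Q.card : ℝ) / 2 ^ k ≤ 3 / 5 := by
    have h0 : (0 : ℝ) ≤ (Q.card : ℝ) := Nat.cast_nonneg _
    have h1 : (Q.card : ℝ) ^ 4 ≤ 2 ^ k := by
      calc (Q.card : ℝ) ^ 4 ≤ (((2 : ℝ) ^ k) ^ (1 / 4 : ℝ)) ^ 4 := pow_le_pow_left₀ h0 hQ.2 4
        _ = 2 ^ k := by
          rw [← Real.rpow_natCast (((2 : ℝ) ^ k) ^ (1 / 4 : ℝ)), ← Real.rpow_mul hm.le]; norm_num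
    rw [div_le_iff₀ hm]
    generalize (2 : ℝ) ^ k = m at *
    refine le_of_pow_le_pow_left₀ four_ne_zero (by positivity) (h1.trans ?_)
    have h3 : 8 ≤ m ^ 3 := by
      calc (8 : ℝ) = 2 ^ 3 := by norm_num
        _ ≤ m ^ 3 := pow_le_pow_left₀ (by norm_num) hm2 3
    nlinarith
  rw [sumVar, weight, Finset.sum_div, Finset.mul_sum]
  refine Finset.sum_le_sum fun x _ => ?_
  rw [expect_sq_cen, ← mul_div_assoc]
  refine div_le_div_of_nonneg_right ?_ hm.le
  have h1 : sqn (v x) = sqn (cen v x) + 2 ^ k * (𝔼 b, v x b) ^ 2 := by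
    have h2 := sqn_add (cen v x) fun _ => 𝔼 b, v x b
    rw [← Finset.sum_mul, sum_cen] at h2
    simp only [cen, sub_add_cancel] at h2
    rw [h2]
    simp [sqn, cen]
  have h2 : 2 ^ k * (𝔼 b, v x b) ^ 2 ≤ (Q.card : ℝ) / 2 ^ k * sqn (v x) := by
    have h3 : (∑ b, v x b) ^ 2 ≤ Q.card * sqn (v x) := by
      have := ft_sq_le (v x) 0 Q (hQ.1 x)
      simpa [ft, chi, sgn, sqn] using this
    rw [Fintype.expect_eq_sum_div_card, card_bin, div_mul_eq_mul_div, le_div_iff₀ hm]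
    refine le_trans (le_of_eq ?_) h3
    push_cast
    field_simp
  nlinarith [mul_le_mul_of_nonneg_right hQm (sqn_nonneg (v x))]

end Variance

section Query

variable {c k : ℕ} {A : Type*} [Fintype A] [DecidableEq A]

/-- The expectation of `f` conditioned on `h(q) = y`. -/
noncomputable def exq (q : Key c A) (y : Bin k) (f : Tables c k A → ℝ) : ℝ :=
  2 ^ k * 𝔼 T : Tables c k A, Set.indicator {b | b = y} (1 : Bin k → ℝ) (T.hash q) * f T

/-- The probability of an event conditioned on `h(q) = y`. -/
noncomputable def prq (q : Key c A) (y : Bin k) (p : Tables c k A → Prop) : ℝ :=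
  exq q y (Set.indicator {T | p T} 1)

variable (q : Key c A) (y : Bin k)

lemma exq_mono_on {f g : Tables c k A → ℝ} (h : ∀ T, T.hash q = y → f T ≤ g T) :
    exq q y f ≤ exq q y g := by
  refine mul_le_mul_of_nonneg_left (expect_mono fun T => ?_) (by positivity)
  by_cases hT : T.hash q = y
  · exact mul_le_mul_of_nonneg_left (h T hT) (indicator_nonneg (fun b => b = y) _)
  · rw [Set.indicator_of_notMem (by exact hT), zero_mul, zero_mul]

lemma exq_congr_on {f g : Tables c k A → ℝ} (h : ∀ T, T.hash q = y → f T = g T) :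
    exq q y f = exq q y g :=
  le_antisymm (exq_mono_on q y fun T hT => (h T hT).le)
    (exq_mono_on q y fun T hT => (h T hT).ge)

lemma exq_add (f g : Tables c k A → ℝ) :
    exq q y (fun T => f T + g T) = exq q y f + exq q y g := by
  simp only [exq, mul_add, Finset.expect_add_distrib]

lemma exq_sum {ι : Type*} (s : Finset ι) (f : ι → Tables c k A → ℝ) :
    exq q y (fun T => ∑ i ∈ s, f i T) = ∑ i ∈ s, exq q y (f i) := by
  simp only [exq, Finset.mul_sum, Finset.expect_sum_comm]

lemma exq_const_mul (a : ℝ) (f : Tables c k A → ℝ) :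
    exq q y (fun T => a * f T) = a * exq q y f := by
  simp only [exq, mul_left_comm _ a, ← Finset.mul_expect]

lemma expect_indicator_eq :
    𝔼 b : Bin k, Set.indicator {b | b = y} (1 : Bin k → ℝ) b = 1 / 2 ^ k := by
  have := expect_indicator_mem {y}
  simpa using this

lemma exq_of_invariant (i : Fin c) {f : Tables c k A → ℝ}
    (hf : ∀ s T, f (addRow T i (Pi.single (q i) s)) = f T) : exq q y f = 𝔼 T, f T := by
  rw [exq, expect_hash_mul i q _ f hf, expect_indicator_eq]
  field_simp

lemma exq_const [NeZero c] (a : ℝ) : exq q y (fun _ => a) = a := by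
  rw [exq_of_invariant q y 0 fun _ _ => rfl]
  exact Finset.expect_const Finset.univ_nonempty a

lemma sum_exq (f : Tables c k A → ℝ) : ∑ y : Bin k, exq q y f = 2 ^ k * 𝔼 T, f T := by
  simp only [exq]
  rw [← Finset.mul_sum, ← Finset.expect_sum_comm]
  congr 1
  refine Finset.expect_congr rfl fun T _ => ?_
  rw [← Finset.sum_mul]
  simp [Set.indicator_apply]

lemma prq_mono_on {p p' : Tables c k A → Prop} (h : ∀ T, T.hash q = y → p T → p' T) :
    prq q y p ≤ prq q y p' :=
  exq_mono_on q y fun T hT => indicator_le_of_imp (indicator_nonneg p' T) fun hp => by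
    rw [Set.indicator_of_mem (by exact h T hT hp)]; rfl

lemma prq_le_one [NeZero c] (p : Tables c k A → Prop) : prq q y p ≤ 1 :=
  (exq_mono_on q y fun _ _ => indicator_le_of_imp (f := fun _ => 1) zero_le_one
    fun _ => le_rfl).trans_eq (exq_const q y 1)

lemma prq_nonneg (p : Tables c k A → Prop) : 0 ≤ prq q y p :=
  mul_nonneg (by positivity) (expect_nonneg fun T =>
    mul_nonneg (indicator_nonneg (fun b => b = y) _) (indicator_nonneg p T))

lemma prq_le (p : Tables c k A → Prop) : prq q y p ≤ 2 ^ k * pr p := by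
  refine mul_le_mul_of_nonneg_left (expect_mono fun T => ?_) (by positivity)
  refine mul_le_of_le_one_left (indicator_nonneg p T) ?_
  exact indicator_le_of_imp (p := fun b => b = y) (f := fun _ => 1) zero_le_one fun _ => le_rfl

lemma prq_eq_zero {p : Tables c k A → Prop} (h : ∀ T, T.hash q = y → ¬ p T) : prq q y p = 0 := by
  refine le_antisymm ?_ (prq_nonneg q y p)
  refine (prq_mono_on q y (p' := fun _ => False) h).trans_eq ?_
  simp [prq, exq]

lemma prq_or_le (p p' : Tables c k A → Prop) :
    prq q y (fun T => p T ∨ p' T) ≤ prq q y p + prq q y p' := by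
  unfold prq
  rw [← exq_add]
  refine exq_mono_on q y fun T _ => ?_
  refine indicator_le_of_imp (p := fun T => p T ∨ p' T)
    (f := fun T => Set.indicator {T | p T} (1 : Tables c k A → ℝ) T + Set.indicator {T | p' T} 1 T)
    (add_nonneg (indicator_nonneg p T) (indicator_nonneg p' T)) ?_
  rintro (hp | hp)
  · have := indicator_nonneg p' T
    rw [Set.indicator_of_mem (show T ∈ {T | p T} from hp)]; simpa using this
  · have := indicator_nonneg p T
    rw [Set.indicator_of_mem (show T ∈ {T | p' T} from hp)]; simpa using this

lemma prq_exists_le {ι : Type*} (s : Finset ι) (p : ι → Tables c k A → Prop) :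
    prq q y (fun T => ∃ i ∈ s, p i T) ≤ ∑ i ∈ s, prq q y (p i) := by
  unfold prq
  rw [← exq_sum]
  refine exq_mono_on q y fun T _ => ?_
  refine indicator_le_of_imp (p := fun T => ∃ i ∈ s, p i T)
    (f := fun T => ∑ i ∈ s, Set.indicator {T | p i T} (1 : Tables c k A → ℝ) T)
    (Finset.sum_nonneg fun i _ => indicator_nonneg (p i) T) ?_
  rintro ⟨i, hi, hp⟩
  refine le_trans ?_ (Finset.single_le_sum
    (f := fun i => Set.indicator {T | p i T} (1 : Tables c k A → ℝ) T)
    (fun i _ => indicator_nonneg (p i) T) hi)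
  change 1 ≤ Set.indicator {T | p i T} (1 : Tables c k A → ℝ) T
  rw [Set.indicator_of_mem (by exact hp)]; rfl

lemma prq_le_div {p : Tables c k A → Prop} {f : Tables c k A → ℝ} {a : ℝ} (ha : 0 < a)
    (h0 : ∀ T, 0 ≤ f T) (h : ∀ T, p T → a ≤ f T) : prq q y p ≤ exq q y f / a := by
  rw [div_eq_inv_mul, ← exq_const_mul]
  exact exq_mono_on q y fun T _ => indicator_le_of_imp (f := fun T => a⁻¹ * f T)
    (mul_nonneg (inv_nonneg.2 ha.le) (h0 T)) fun hp => by
      rw [← inv_mul_cancel₀ ha.ne']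
      exact mul_le_mul_of_nonneg_left (h T hp) (inv_nonneg.2 ha.le)

lemma prq_eq_pr (i : Fin c) {p : Tables c k A → Prop}
    (hp : ∀ s T, p (addRow T i (Pi.single (q i) s)) ↔ p T) : prq q y p = pr p :=
  exq_of_invariant q y i fun s T => by
    by_cases h : p T
    · rw [Set.indicator_of_mem (by exact (hp s T).2 h), Set.indicator_of_mem (by exact h)]; rfl
    · rw [Set.indicator_of_notMem (by exact fun h' => h ((hp s T).1 h')),
        Set.indicator_of_notMem (by exact h)]

lemma pr_le_of_prq_le {p : Tables c k A → Prop} {C : ℝ} (h : ∀ y : Bin k, prq q y p ≤ C) :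
    pr p ≤ C := by
  have h1 := Finset.sum_le_sum fun y (_ : y ∈ (Finset.univ : Finset (Bin k))) => h y
  have h2 : ∑ y : Bin k, prq q y p = 2 ^ k * pr p := sum_exq q _
  rw [h2, Finset.sum_const, Finset.card_univ, card_bin, nsmul_eq_mul] at h1
  push_cast at h1
  exact le_of_mul_le_mul_left h1 (by positivity)

lemma exq_hash {x : Key c A} (hx : x ≠ q) (u : Bin k → ℝ) :
    exq q y (fun T => u (T.hash x)) = 𝔼 b, u b := by
  obtain ⟨i, hi⟩ := Function.ne_iff.1 hx
  have h := expect_hash_mul (k := k) i x u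
    (fun T => Set.indicator {b | b = y} (1 : Bin k → ℝ) (T.hash q)) fun s T => by
      rw [hash_addRow_single_of_ne T hi.symm s]
  have : NeZero c := ⟨fun h => by subst h; exact i.elim0⟩
  rw [exq]
  simp_rw [mul_comm _ (u _)]
  rw [h, expect_hash, expect_indicator_eq]
  field_simp

/-- In a position separating `x` and `x'`, the query agrees with at most one of them. The other uses
a table entry seen by neither remaining key, so its factor averages to zero. Which key this is
depends on `q`, hence the two mean-zero hypotheses. -/
lemma exq_hash_mul_hash {x x' : Key c A} (h : x ≠ x') {u u' : Bin k → ℝ} (hu : 𝔼 b, u b = 0)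
    (hu' : 𝔼 b, u' b = 0) :
    exq q y (fun T => u (T.hash x) * u' (T.hash x')) = 0 := by
  obtain ⟨i, hi⟩ := Function.ne_iff.1 h
  have key : ∀ (x x' : Key c A) (u u' : Bin k → ℝ), x i ≠ x' i → q i ≠ x i → 𝔼 b, u b = 0 →
      exq q y (fun T => u (T.hash x) * u' (T.hash x')) = 0 := by
    intro x x' u u' hi hqi hu
    have h1 := expect_hash_mul (k := k) i x u
      (fun T => Set.indicator {b | b = y} (1 : Bin k → ℝ) (T.hash q) * u' (T.hash x')) fun s T => by
        rw [hash_addRow_single_of_ne T hqi s, hash_addRow_single_of_ne T hi.symm s]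
    rw [exq]
    simp_rw [mul_left_comm _ (u _)]
    rw [h1, hu, zero_mul, mul_zero]
  by_cases hq : q i = x i
  · simp_rw [mul_comm (u _)]
    exact key x' x u' u hi.symm (hq ▸ hi) hu'
  · exact key x x' u u' hi hq hu

lemma expect_hash_mul_hash {x x' : Key c A} (h : x ≠ x') {u u' : Bin k → ℝ}
    (hu : 𝔼 b, u b = 0) : 𝔼 T : Tables c k A, u (T.hash x) * u' (T.hash x') = 0 := by
  obtain ⟨i, hi⟩ := Function.ne_iff.1 h
  rw [expect_hash_mul (k := k) i x u (fun T => u' (T.hash x')) fun s T => by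
    rw [hash_addRow_single_of_ne T hi.symm s], hu, zero_mul]

lemma exq_sq_cenVec {S : Finset (Key c A)} (hq : q ∉ S) (v : Key c A → Bin k → ℝ) :
    exq q y (fun T => cenVec S v T 0 ^ 2) = sumVar S v := by
  have hne : ∀ x ∈ S, x ≠ q := fun x hx h => hq (h ▸ hx)
  simp_rw [sq_cenVec_zero]
  rw [exq_sum]
  refine Finset.sum_congr rfl fun x hx => ?_
  rw [exq_sum, Finset.sum_eq_single_of_mem x hx]
  · simp_rw [← sq]
    exact exq_hash q y (hne x hx) fun b => cen v x b ^ 2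
  · intro x' hx' h
    exact exq_hash_mul_hash q y h.symm (expect_cen v x) (expect_cen v x')

lemma expect_sq_cenVec [NeZero c] (S : Finset (Key c A)) (v : Key c A → Bin k → ℝ) :
    𝔼 T : Tables c k A, cenVec S v T 0 ^ 2 = sumVar S v := by
  simp_rw [sq_cenVec_zero]
  rw [Finset.expect_sum_comm]
  refine Finset.sum_congr rfl fun x hx => ?_
  rw [Finset.expect_sum_comm, Finset.sum_eq_single_of_mem x hx]
  · simp_rw [← sq]
    exact expect_hash x fun b => cen v x b ^ 2
  · intro x' _ h
    exact expect_hash_mul_hash h.symm (expect_cen v x)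

lemma exq_cenVec {S : Finset (Key c A)} (hq : q ∉ S) (v : Key c A → Bin k → ℝ) :
    exq q y (fun T => cenVec S v T 0) = 0 := by
  simp only [cenVec, add_zero]
  rw [exq_sum]
  refine Finset.sum_eq_zero fun x hx => ?_
  rw [exq_hash q y (fun h => hq (h ▸ hx)) (cen v x), expect_cen]

lemma expect_cenVec [NeZero c] (S : Finset (Key c A)) (v : Key c A → Bin k → ℝ) (j : Bin k) :
    𝔼 T : Tables c k A, cenVec S v T j = 0 := by
  simp only [cenVec]
  rw [Finset.expect_sum_comm]
  refine Finset.sum_eq_zero fun x _ => ?_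
  have h := expect_hash (k := k) x fun b => cen v x (b + j)
  rw [h, ← expect_cen v x]
  exact Fintype.expect_equiv (Equiv.addRight j) _ _ fun _ => rfl

end Query

/-! ### Bennett's function and its tail -/

section Bennett

lemma bennett_zero : bennett 0 = 0 := by simp [bennett]

lemma hasDerivAt_bennett {x : ℝ} (hx : 0 ≤ x) : HasDerivAt bennett (Real.log (x + 1)) x := by
  have hx1 : x + 1 ≠ 0 := by linarith
  have h1 : HasDerivAt (fun x : ℝ => x + 1) 1 x := (hasDerivAt_id x).add_const 1
  have h2 := (h1.mul (h1.log hx1)).sub (hasDerivAt_id x)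
  refine h2.congr_deriv ?_
  field_simp
  ring

lemma nonneg_of_hasDerivAt {f f' : ℝ → ℝ} (h0 : f 0 = 0) (hf : ∀ x, 0 ≤ x → HasDerivAt f (f' x) x)
    (hf' : ∀ x, 0 ≤ x → 0 ≤ f' x) {x : ℝ} (hx : 0 ≤ x) : 0 ≤ f x := by
  have h : MonotoneOn f (Set.Ici 0) := by
    refine monotoneOn_of_deriv_nonneg (convex_Ici 0)
      (fun x hx => (hf x hx).continuousAt.continuousWithinAt)
      (fun x hx => (hf x (interior_subset hx)).differentiableAt.differentiableWithinAt)
      fun x hx => ?_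
    rw [(hf x (interior_subset hx)).deriv]
    exact hf' x (interior_subset hx)
  rw [← h0]
  exact h Set.self_mem_Ici hx hx

lemma mul_bennett_le {l x : ℝ} (hl : 1 ≤ l) (hx : 0 ≤ x) : l * bennett x ≤ bennett (l * x) := by
  have h := nonneg_of_hasDerivAt (f := fun x => bennett (l * x) - l * bennett x)
    (f' := fun x => Real.log (l * x + 1) * l - l * Real.log (x + 1)) (by simp [bennett_zero])
    (fun x hx => by
      have h1 : HasDerivAt (fun x => l * x) l x := by simpa using (hasDerivAt_id x).const_mul l
      exact ((hasDerivAt_bennett (by positivity : 0 ≤ l * x)).comp x h1).sub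
        ((hasDerivAt_bennett hx).const_mul l))
    (fun x hx => by
      have := Real.log_le_log (by linarith : 0 < x + 1) (by nlinarith : x + 1 ≤ l * x + 1)
      nlinarith) hx
  simpa using h

/-- Comparing derivatives reduces this to Bernoulli's inequality 1 + l x ≤ (1 + x)^l. It lets
constant factors in the deviation or the variance be moved into κ. -/
lemma bennett_mul_le {l x : ℝ} (hl : 1 ≤ l) (hx : 0 ≤ x) : bennett (l * x) ≤ l ^ 2 * bennett x := by
  have h := nonneg_of_hasDerivAt (f := fun x => l ^ 2 * bennett x - bennett (l * x))
    (f' := fun x => l ^ 2 * Real.log (x + 1) - Real.log (l * x + 1) * l) (by simp [bennett_zero])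
    (fun x hx => by
      have h1 : HasDerivAt (fun x => l * x) l x := by simpa using (hasDerivAt_id x).const_mul l
      exact ((hasDerivAt_bennett hx).const_mul (l ^ 2)).sub
        ((hasDerivAt_bennett (by positivity : 0 ≤ l * x)).comp x h1))
    (fun x hx => by
      have h1 : l * x + 1 ≤ (1 + x) ^ l := by
        have := one_add_mul_self_le_rpow_one_add (by linarith : -1 ≤ x) hl
        linarith
      have h2 := Real.log_le_log (by positivity) h1
      rw [Real.log_rpow (by linarith), add_comm 1 x] at h2
      nlinarith) hx
  simpa using h

lemma bennett_nonneg {x : ℝ} (hx : 0 ≤ x) : 0 ≤ bennett x :=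
  nonneg_of_hasDerivAt bennett_zero (fun _ => hasDerivAt_bennett)
    (fun x hx => Real.log_nonneg (by linarith)) hx

lemma bennett_mono {x y : ℝ} (hx : 0 ≤ x) (hxy : x ≤ y) : bennett x ≤ bennett y := by
  rcases hx.eq_or_lt with rfl | hx
  · rw [bennett_zero]; exact bennett_nonneg hxy
  have h1 : 1 ≤ y / x := (one_le_div hx).2 hxy
  have h2 := mul_bennett_le h1 hx.le
  rw [div_mul_cancel₀ y hx.ne'] at h2
  exact (le_mul_of_one_le_left (bennett_nonneg hx.le) h1).trans h2

lemma bennett_le_mul_log {x : ℝ} (hx : 0 ≤ x) : bennett x ≤ x * Real.log (1 + x) := by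
  have := Real.log_le_sub_one_of_pos (by linarith : 0 < x + 1)
  rw [bennett, add_comm 1 x]; linarith

lemma bennett_le_sq {x : ℝ} (hx : 0 ≤ x) : bennett x ≤ x ^ 2 := by
  have h1 := bennett_le_mul_log hx
  have h2 := Real.log_le_sub_one_of_pos (by linarith : 0 < 1 + x)
  nlinarith

lemma sq_div_le_bennett {x : ℝ} (hx : 0 ≤ x) : x ^ 2 / (x + 2) ≤ bennett x := by
  have h := Real.le_log_one_add_of_nonneg hx
  rw [div_le_iff₀ (by linarith)] at h ⊢
  rw [bennett, add_comm x 1]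
  nlinarith

lemma mul_log_sub_le_bennett {x : ℝ} (hx : 0 ≤ x) : x * (Real.log (1 + x) - 1) ≤ bennett x := by
  have := Real.log_nonneg (by linarith : 1 ≤ 1 + x)
  rw [bennett, add_comm x 1]; nlinarith

lemma bennettTail_nonneg (κ s t : ℝ) : 0 ≤ bennettTail κ s t := by
  unfold bennettTail
  split_ifs
  · exact le_rfl
  · exact (Real.exp_pos _).le

lemma bennettTail_of_pos {s : ℝ} (hs : 0 < s) (κ t : ℝ) :
    bennettTail κ s t = Real.exp (-(κ * (s * bennett (t / s)))) := if_neg hs.ne'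

lemma bennettTail_zero (κ t : ℝ) : bennettTail κ 0 t = 0 := if_pos rfl

variable {κ s t : ℝ}

lemma bennettTail_anti {κ' : ℝ} (hs : 0 ≤ s) (ht : 0 ≤ t) (h : κ' ≤ κ) :
    bennettTail κ s t ≤ bennettTail κ' s t := by
  rcases hs.eq_or_lt with rfl | hs
  · rw [bennettTail_zero, bennettTail_zero]
  rw [bennettTail_of_pos hs, bennettTail_of_pos hs, Real.exp_le_exp, neg_le_neg_iff]
  exact mul_le_mul_of_nonneg_right h (mul_nonneg hs.le (bennett_nonneg (by positivity)))

lemma bennettTail_mono_var {s' : ℝ} (hκ : 0 ≤ κ) (hs : 0 ≤ s) (h : s ≤ s') (ht : 0 ≤ t) :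
    bennettTail κ s t ≤ bennettTail κ s' t := by
  rcases hs.eq_or_lt with rfl | hs
  · rw [bennettTail_zero]; exact bennettTail_nonneg _ _ _
  have hs' : 0 < s' := hs.trans_le h
  rw [bennettTail_of_pos hs, bennettTail_of_pos hs', Real.exp_le_exp, neg_le_neg_iff]
  refine mul_le_mul_of_nonneg_left ?_ hκ
  have h1 := mul_bennett_le ((one_le_div hs).2 h) (by positivity : 0 ≤ t / s')
  have h2 : s' / s * (t / s') = t / s := by field_simp
  rw [h2] at h1
  calc s' * bennett (t / s') = s * (s' / s * bennett (t / s')) := by field_simp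
    _ ≤ s * bennett (t / s) := mul_le_mul_of_nonneg_left h1 hs.le

lemma bennettTail_div_le {l : ℝ} (hκ : 0 ≤ κ) (hs : 0 ≤ s) (ht : 0 ≤ t) (hl : 1 ≤ l) :
    bennettTail κ s (t / l) ≤ bennettTail (κ / l ^ 2) s t := by
  rcases hs.eq_or_lt with rfl | hs
  · rw [bennettTail_zero, bennettTail_zero]
  have hl0 : 0 < l := by linarith
  rw [bennettTail_of_pos hs, bennettTail_of_pos hs, Real.exp_le_exp, neg_le_neg_iff]
  have h1 := bennett_mul_le hl (by positivity : 0 ≤ t / l / s)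
  have h2 : l * (t / l / s) = t / s := by field_simp
  rw [h2] at h1
  calc κ / l ^ 2 * (s * bennett (t / s)) ≤ κ / l ^ 2 * (s * (l ^ 2 * bennett (t / l / s))) := by
        gcongr
    _ = _ := by field_simp

lemma bennettTail_mul_var_le {l : ℝ} (hκ : 0 ≤ κ) (hs : 0 ≤ s) (ht : 0 ≤ t) (hl : 1 ≤ l) :
    bennettTail κ (l * s) t ≤ bennettTail (κ / l) s t := by
  rcases hs.eq_or_lt with rfl | hs
  · rw [mul_zero, bennettTail_zero, bennettTail_zero]
  have hl0 : 0 < l := by linarith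
  rw [bennettTail_of_pos hs, bennettTail_of_pos (by positivity), Real.exp_le_exp, neg_le_neg_iff]
  have h1 := bennett_mul_le hl (by positivity : 0 ≤ t / (l * s))
  have h2 : l * (t / (l * s)) = t / s := by field_simp
  rw [h2] at h1
  calc κ / l * (s * bennett (t / s)) ≤ κ / l * (s * (l ^ 2 * bennett (t / (l * s)))) := by
        gcongr
    _ = _ := by field_simp

/-- For bounded deviations Chebyshev is already as strong as Bennett: the inverse tail is at most (1
+ t/s)^(t/R), which Bernoulli bounds by 1 + t²/s. No additive error arises here. -/
lemma le_two_mul_bennettTail {R p : ℝ} (hR : 1 ≤ R) (hs : 0 < s) (ht : 0 < t) (htR : t ≤ R)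
    (hp1 : p ≤ 1) (hp : p ≤ s / t ^ 2) : p ≤ 2 * bennettTail (1 / R) s t := by
  have hR0 : 0 < R := by linarith
  rw [bennettTail_of_pos hs, Real.exp_neg]
  have hb : Real.exp (1 / R * (s * bennett (t / s))) ≤ 1 + t ^ 2 / s := by
    have h1 := bennett_le_mul_log (by positivity : 0 ≤ t / s)
    have h2 : 1 / R * (s * bennett (t / s)) ≤ Real.log (1 + t / s) * (t / R) := by
      calc _ ≤ 1 / R * (s * (t / s * Real.log (1 + t / s))) := by gcongr
        _ = _ := by field_simp
    refine (Real.exp_le_exp.2 h2).trans ?_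
    rw [← Real.rpow_def_of_pos (by positivity)]
    have h3 := rpow_one_add_le_one_add_mul_self (by linarith [div_pos ht hs] : -1 ≤ t / s)
      (by positivity : 0 ≤ t / R) ((div_le_one hR0).2 htR)
    refine h3.trans ?_
    have h4 : t / R * (t / s) ≤ t * (t / s) :=
      mul_le_mul_of_nonneg_right (div_le_self ht.le hR) (by positivity)
    have h5 : t * (t / s) = t ^ 2 / s := by ring
    linarith
  have h6 : p * (1 + t ^ 2 / s) ≤ 2 := by
    have h7 : p * (t ^ 2 / s) ≤ 1 := by
      rw [le_div_iff₀ (by positivity)] at hp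
      rw [mul_div_assoc', div_le_one hs]; exact hp
    linarith
  rw [← div_eq_mul_inv, le_div_iff₀ (Real.exp_pos _)]
  rcases le_or_gt p 0 with h | h
  · nlinarith [Real.exp_pos (1 / R * (s * bennett (t / s)))]
  · exact (mul_le_mul_of_nonneg_left hb h.le).trans h6

end Bennett

/-! ### Choice of the truncation level -/

section TruncationLevel

/-- A level `M` at which the contributions of the characters can be truncated: they exceed it with
small probability, and Bennett's inequality for variables bounded by `M` is still strong enough. -/
lemma exists_truncation_level {κ D δ : ℝ} (hκ : 0 < κ) (hD : 1 ≤ D) (hδ : 0 < δ) (γ : ℝ) :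
    ∃ κ' C : ℝ, 0 < κ' ∧ 0 ≤ C ∧ ∀ m s : ℝ, 1 ≤ m → 0 < s → ∃ M : ℝ, 0 < M ∧
      bennettTail κ (s / m ^ δ) M ≤ C * m ^ (-(γ + 1)) ∧
      ∀ t, 0 < t → Real.exp (-(D * s / M ^ 2 * bennett (t * M / (D * s)))) ≤
        bennettTail κ' s t + C * m ^ (-γ) := by
  have hD0 : 0 < D := by linarith
  -- `D ≤ M₀` keeps t M₀ / (D s) above t / s; the other term makes κ M₀ δ / 2 at least γ + 1.
  set M₀ : ℝ := max D (2 * (γ + 1) / (κ * δ)) with hM₀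
  have hM₀D : D ≤ M₀ := le_max_left _ _
  have hM₀γ : γ + 1 ≤ κ * M₀ * (δ / 2) := by
    have : 2 * (γ + 1) / (κ * δ) ≤ M₀ := le_max_right _ _
    rw [div_le_iff₀ (by positivity)] at this
    linarith
  have hM₀0 : 0 < M₀ := hD0.trans_le hM₀D
  obtain ⟨C₁, hC₁0, hC₁⟩ := exists_exp_neg_rpow_le (a := κ / 3) (η := δ / 8) (by positivity)
    (by positivity) (γ + 1)
  obtain ⟨C₂, hC₂0, hC₂⟩ := exists_exp_neg_rpow_le (a := 1 / 3) (η := δ / 4) (by positivity)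
    (by positivity) γ
  refine ⟨min (D / M₀ ^ 2) (1 / (3 * D)), Real.exp (κ * M₀) + C₁ + C₂,
    lt_min (by positivity) (by positivity), by positivity, fun m s hm hs => ?_⟩
  have hm0 : 0 < m := by linarith
  have hmp : ∀ e : ℝ, 0 < m ^ e := fun e => Real.rpow_pos_of_pos hm0 e
  -- For small s the group variance is at most m^(-δ/2), so a constant level is exceeded only with
  -- probability a large negative power of m. For large s the level may grow almost like √s.
  rcases le_or_gt s (m ^ (δ / 2)) with hsm | hsm
  · refine ⟨M₀, hM₀0, ?_, fun t ht => ?_⟩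
    · have h1 : s / m ^ δ ≤ m ^ (-(δ / 2)) := by
        rw [div_le_iff₀ (hmp _), ← Real.rpow_add hm0]
        convert hsm using 2; ring
      refine (bennettTail_mono_var hκ.le (by have := hmp δ; positivity) h1 hM₀0.le).trans ?_
      rw [bennettTail_of_pos (hmp _), Real.rpow_neg hm0.le, div_inv_eq_mul]
      set w := m ^ (δ / 2) with hw
      have hw0 : 0 < w := hmp _
      have h2 := mul_log_sub_le_bennett (by positivity : 0 ≤ M₀ * w)
      have h3 : Real.log w ≤ Real.log (1 + M₀ * w) :=
        Real.log_le_log hw0 (by nlinarith)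
      have h4 : κ * M₀ * (Real.log w - 1) ≤ κ * (w⁻¹ * bennett (M₀ * w)) := by
        calc κ * M₀ * (Real.log w - 1) ≤ κ * M₀ * (Real.log (1 + M₀ * w) - 1) := by gcongr
          _ = κ * (w⁻¹ * (M₀ * w * (Real.log (1 + M₀ * w) - 1))) := by field_simp
          _ ≤ _ := by gcongr
      have h5 : Real.exp (-(κ * (w⁻¹ * bennett (M₀ * w)))) ≤
          Real.exp (κ * M₀) * m ^ (-(κ * M₀ * (δ / 2))) := by
        rw [Real.rpow_def_of_pos hm0, ← Real.exp_add, Real.exp_le_exp]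
        rw [hw, Real.log_rpow hm0] at h4
        linarith
      refine h5.trans ?_
      have h6 : m ^ (-(κ * M₀ * (δ / 2))) ≤ m ^ (-(γ + 1)) :=
        Real.rpow_le_rpow_of_exponent_le hm (by linarith)
      have := hmp (-(γ + 1))
      calc _ ≤ Real.exp (κ * M₀) * m ^ (-(γ + 1)) := by gcongr
        _ ≤ _ := by gcongr; linarith
    · have h1 : D / M₀ ^ 2 * (s * bennett (t / s)) ≤
          D * s / M₀ ^ 2 * bennett (t * M₀ / (D * s)) := by
        have h2 : bennett (t / s) ≤ bennett (t * M₀ / (D * s)) := by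
          refine bennett_mono (by positivity) ?_
          rw [div_le_div_iff₀ hs (by positivity)]
          have : t * s * D ≤ t * s * M₀ := mul_le_mul_of_nonneg_left hM₀D (by positivity)
          nlinarith
        calc _ = D * s / M₀ ^ 2 * bennett (t / s) := by ring
          _ ≤ _ := by gcongr
      have h3 : Real.exp (-(D * s / M₀ ^ 2 * bennett (t * M₀ / (D * s)))) ≤
          bennettTail (D / M₀ ^ 2) s t := by
        rw [bennettTail_of_pos hs, Real.exp_le_exp]; linarith
      have h4 := bennettTail_anti hs.le ht.le (min_le_left (D / M₀ ^ 2) (1 / (3 * D)))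
      have := hmp (-γ)
      have : 0 ≤ (Real.exp (κ * M₀) + C₁ + C₂) * m ^ (-γ) := by positivity
      linarith
  · set M : ℝ := Real.sqrt s * m ^ (-(δ / 8)) with hM
    have hM0 : 0 < M := mul_pos (Real.sqrt_pos.2 hs) (hmp _)
    have hM2 : M ^ 2 = s * m ^ (-(δ / 4)) := by
      rw [hM, mul_pow, Real.sq_sqrt hs.le, ← Real.rpow_natCast, ← Real.rpow_mul hm0.le]
      congr 2; push_cast; ring
    refine ⟨M, hM0, ?_, fun t ht => ?_⟩
    · set s' := s / m ^ δ with hs'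
      have hs'0 : 0 < s' := div_pos hs (hmp _)
      rw [bennettTail_of_pos hs'0]
      have h1 := sq_div_le_bennett (by positivity : 0 ≤ M / s')
      have h2 : M ^ 2 / (M + 2 * s') ≤ s' * bennett (M / s') := by
        calc M ^ 2 / (M + 2 * s') = s' * ((M / s') ^ 2 / (M / s' + 2)) := by field_simp
          _ ≤ _ := by gcongr
      have h3 : M * m ^ (δ / 8) ≤ M ^ 2 := by
        have h4 : m ^ (δ / 8) ≤ M := by
          have h5 : m ^ (δ / 4) ≤ Real.sqrt s := by
            refine Real.le_sqrt_of_sq_le ?_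
            rw [← Real.rpow_natCast, ← Real.rpow_mul hm0.le]
            have e : δ / 4 * ((2 : ℕ) : ℝ) = δ / 2 := by push_cast; ring
            rw [e]; exact hsm.le
          calc m ^ (δ / 8) = m ^ (δ / 4) * m ^ (-(δ / 8)) := by
                rw [← Real.rpow_add hm0]; congr 1; ring
            _ ≤ M := mul_le_mul_of_nonneg_right h5 (hmp _).le
        rw [sq]
        exact mul_le_mul_of_nonneg_left h4 hM0.le
      have h4 : s' * m ^ (δ / 8) ≤ M ^ 2 := by
        rw [hM2, hs', div_eq_mul_inv, ← Real.rpow_neg hm0.le, mul_assoc, ← Real.rpow_add hm0]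
        refine mul_le_mul_of_nonneg_left (Real.rpow_le_rpow_of_exponent_le hm ?_) hs.le
        linarith
      have h5 : m ^ (δ / 8) / 3 ≤ M ^ 2 / (M + 2 * s') := by
        rw [div_le_div_iff₀ (by norm_num) (by positivity)]
        linarith
      have h6 : κ / 3 * m ^ (δ / 8) ≤ κ * (s' * bennett (M / s')) := by
        have := mul_le_mul_of_nonneg_left (h5.trans h2) hκ.le
        linarith
      refine (Real.exp_le_exp.2 (neg_le_neg h6)).trans ((hC₁ m hm).trans ?_)
      have := hmp (-(γ + 1))
      have := Real.exp_pos (κ * M₀)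
      gcongr
      linarith
    · set y := t * M / (D * s) with hy
      have hy0 : 0 < y := by positivity
      have h1 := sq_div_le_bennett hy0.le
      have hpos : 0 < D * s / M ^ 2 := by positivity
      -- For y ≤ 1 Bennett is in its Gaussian range, where M plays no role. For y > 1 its exponent
      -- is at least D m^(δ/4) / 3, so the tail is absorbed in the additive error.
      rcases le_or_gt y 1 with hy1 | hy1
      · have h2 : y ^ 2 / 3 ≤ bennett y := by
          refine le_trans ?_ h1
          gcongr
          linarith
        have h3 : 1 / (3 * D) * (s * bennett (t / s)) ≤ D * s / M ^ 2 * bennett y := by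
          calc 1 / (3 * D) * (s * bennett (t / s)) ≤ 1 / (3 * D) * (s * (t / s) ^ 2) := by
                gcongr; exact bennett_le_sq (by positivity)
            _ = D * s / M ^ 2 * (y ^ 2 / 3) := by rw [hy]; field_simp
            _ ≤ _ := by gcongr
        have h4 : Real.exp (-(D * s / M ^ 2 * bennett y)) ≤ bennettTail (1 / (3 * D)) s t := by
          rw [bennettTail_of_pos hs, Real.exp_le_exp]; linarith
        have h5 := bennettTail_anti hs.le ht.le (min_le_right (D / M₀ ^ 2) (1 / (3 * D)))
        have := hmp (-γ)
        have : 0 ≤ (Real.exp (κ * M₀) + C₁ + C₂) * m ^ (-γ) := by positivity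
        linarith
      · have h2 : 1 / 3 ≤ bennett y := by
          refine le_trans ?_ h1
          rw [div_le_div_iff₀ (by norm_num) (by linarith)]
          nlinarith
        have h3 : D * s / M ^ 2 = D * m ^ (δ / 4) := by
          rw [hM2, Real.rpow_neg hm0.le]; field_simp
        have h4 : 1 / 3 * m ^ (δ / 4) ≤ D * s / M ^ 2 * bennett y := by
          rw [h3]
          have h5 : m ^ (δ / 4) ≤ D * m ^ (δ / 4) := le_mul_of_one_le_left (hmp _).le hD
          have := mul_le_mul h5 h2 (by norm_num) (by have := hmp (δ / 4); positivity)
          linarith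
        refine (Real.exp_le_exp.2 (neg_le_neg h4)).trans ((hC₂ m hm).trans ?_)
        have h5 := bennettTail_nonneg (min (D / M₀ ^ 2) (1 / (3 * D))) s t
        have h6 : C₂ * m ^ (-γ) ≤ (Real.exp (κ * M₀) + C₁ + C₂) * m ^ (-γ) := by
          have := hmp (-γ)
          have := Real.exp_pos (κ * M₀)
          gcongr
          linarith
        linarith

end TruncationLevel

/-! ### Bennett's inequality for independent sums -/

section IndependentSums

lemma hasSum_exp_sub (x : ℝ) :
    HasSum (fun n : ℕ => x ^ (n + 2) / (n + 2).factorial) (Real.exp x - 1 - x) := by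
  have h := NormedSpace.expSeries_div_hasSum_exp (𝔸 := ℝ) x
  rw [← Real.exp_eq_exp_ℝ] at h
  have h2 := (hasSum_nat_add_iff' 2).2 h
  have h3 : ∑ i ∈ Finset.range 2, x ^ i / (i.factorial : ℝ) = 1 + x := by
    simp [Finset.sum_range_succ]
  rw [h3, ← sub_sub] at h2
  exact h2

/-- Compare the exponential series from the quadratic term on: x^n ≤ y^n for every n. -/
lemma exp_le_one_add_add {x y : ℝ} (hy : 0 < y) (hxy : |x| ≤ y) :
    Real.exp x ≤ 1 + x + x ^ 2 / y ^ 2 * (Real.exp y - 1 - y) := by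
  have h := hasSum_le (fun n => ?_) (hasSum_exp_sub x)
    ((hasSum_exp_sub y).mul_left (x ^ 2 / y ^ 2))
  · linarith
  · have h1 : x ^ n ≤ y ^ n :=
      (le_abs_self _).trans (by rw [abs_pow]; exact pow_le_pow_left₀ (abs_nonneg x) hxy n)
    calc x ^ (n + 2) / ((n + 2).factorial : ℝ) = x ^ 2 * x ^ n / (n + 2).factorial := by
          rw [pow_add]; ring
      _ ≤ x ^ 2 * y ^ n / (n + 2).factorial := by gcongr
      _ = x ^ 2 / y ^ 2 * (y ^ (n + 2) / (n + 2).factorial) := by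
          rw [pow_add]; field_simp

variable {k : ℕ} {A : Type*} [Fintype A] [DecidableEq A]

lemma pr_le_sum_le {X : A → Bin k → ℝ} {M σ t : ℝ} (hM : 0 < M) (hσ : 0 < σ) (ht : 0 < t)
    (hX0 : ∀ a, 𝔼 b, X a b = 0) (hXM : ∀ a b, |X a b| ≤ M) (hXσ : ∑ a, 𝔼 b, X a b ^ 2 ≤ σ) :
    pr (fun g : A → Bin k => t ≤ ∑ a, X a (g a)) ≤
      Real.exp (-(σ / M ^ 2 * bennett (t * M / σ))) := by
  set y := t * M / σ with hy
  have hy0 : 0 < y := by positivity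
  -- The minimiser of the Chernoff exponent σ (e^(lM) - 1 - lM) / M² - l t.
  set l := Real.log (1 + y) / M with hl
  have hlog : 0 < Real.log (1 + y) := Real.log_pos (by linarith)
  have hl0 : 0 < l := div_pos hlog hM
  have hlM : l * M = Real.log (1 + y) := by rw [hl]; field_simp
  set φ := Real.exp (l * M) - 1 - l * M with hφ
  have hφ0 : 0 ≤ φ := by linarith [Real.add_one_le_exp (l * M)]
  have h1 : ∀ a, 𝔼 b, Real.exp (l * X a b) ≤ Real.exp ((𝔼 b, X a b ^ 2) * (φ / M ^ 2)) := by
    intro a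
    have h2 : ∀ b, Real.exp (l * X a b) ≤ 1 + l * X a b + X a b ^ 2 * (φ / M ^ 2) := by
      intro b
      have h3 : |l * X a b| ≤ l * M := by
        rw [abs_mul, abs_of_pos hl0]
        exact mul_le_mul_of_nonneg_left (hXM a b) hl0.le
      refine (exp_le_one_add_add (mul_pos hl0 hM) h3).trans_eq ?_
      rw [← hφ]; field_simp
    refine (expect_mono h2).trans ?_
    rw [Finset.expect_add_distrib, Finset.expect_add_distrib, ← Finset.mul_expect, hX0,
      ← Finset.expect_mul, Finset.expect_const Finset.univ_nonempty]
    linarith [Real.add_one_le_exp ((𝔼 b, X a b ^ 2) * (φ / M ^ 2))]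
  have h4 : 𝔼 g : A → Bin k, Real.exp (l * ∑ a, X a (g a)) ≤ Real.exp (σ * (φ / M ^ 2)) := by
    simp_rw [Finset.mul_sum, Real.exp_sum]
    rw [expect_prod_pi fun a b => Real.exp (l * X a b)]
    refine (Finset.prod_le_prod (fun a _ => expect_nonneg fun _ => (Real.exp_pos _).le)
      fun a _ => h1 a).trans ?_
    rw [← Real.exp_sum, ← Finset.sum_mul, Real.exp_le_exp]
    exact mul_le_mul_of_nonneg_right hXσ (by positivity)
  refine (pr_le_div (f := fun g : A → Bin k => Real.exp (l * ∑ a, X a (g a)))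
    (Real.exp_pos (l * t)) (fun _ => (Real.exp_pos _).le)
    fun g hg => Real.exp_le_exp.2 (mul_le_mul_of_nonneg_left hg hl0.le)).trans ?_
  rw [div_le_iff₀ (Real.exp_pos _), ← Real.exp_add]
  refine h4.trans (Real.exp_le_exp.2 (le_of_eq ?_))
  have h5 : Real.exp (l * M) = 1 + y := by rw [hlM, Real.exp_log (by linarith)]
  have h6 : l * t = σ / M ^ 2 * (Real.log (1 + y) * y) := by
    rw [hl, hy]; field_simp
  rw [hφ, h5, h6, hlM, bennett, add_comm y 1]
  ring

lemma pr_le_abs_sum_le {X : A → Bin k → ℝ} {M σ t : ℝ} (hM : 0 < M) (hσ : 0 < σ) (ht : 0 < t)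
    (hX0 : ∀ a, 𝔼 b, X a b = 0) (hXM : ∀ a b, |X a b| ≤ M) (hXσ : ∑ a, 𝔼 b, X a b ^ 2 ≤ σ) :
    pr (fun g : A → Bin k => t ≤ |∑ a, X a (g a)|) ≤
      2 * Real.exp (-(σ / M ^ 2 * bennett (t * M / σ))) := by
  have h1 := pr_le_sum_le hM hσ ht hX0 hXM hXσ
  have h2 := pr_le_sum_le (X := fun a b => -X a b) hM hσ ht
    (fun a => by rw [Finset.expect_neg_distrib, hX0, neg_zero])
    (fun a b => by rw [abs_neg]; exact hXM a b) (by simpa using hXσ)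
  rw [two_mul]
  refine le_trans (pr_mono fun g hg => ?_) ((pr_or_le _ _).trans (add_le_add h1 h2))
  rw [Finset.sum_neg_distrib]
  exact le_abs.1 hg

end IndependentSums

/-! ### Tail bounds for the classes of the partition -/

section LightTail

variable {c k : ℕ} {A : Type*}

lemma cenVec_shift (S : Finset (Key c A)) (v : Key c A → Bin k → ℝ) (T : Tables c k A)
    (j : Bin k) : cenVec S (fun x b => v x (b + j)) T 0 = cenVec S v T j := by
  refine Finset.sum_congr rfl fun x _ => ?_
  have h : 𝔼 b, v x (b + j) = 𝔼 b, v x b :=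
    Fintype.expect_equiv (Equiv.addRight j) _ _ fun _ => rfl
  simp only [cen, h, add_zero]

lemma weight_shift (S : Finset (Key c A)) (v : Key c A → Bin k → ℝ) (j : Bin k) :
    weight S (fun x b => v x (b + j)) = weight S v :=
  Finset.sum_congr rfl fun x _ => sqn_shift (v x) j

variable [Fintype A] [DecidableEq A]

/-- The tail of the sum over keys whose characters in position `i` are light, given that the sums
over the keys with a common character have small squared deviations and are rarely large. -/
lemma pr_light_tail_le {γ D K K₂ B W M t : ℝ} (hD : 0 < D) (hM : 0 < M) (ht : 0 < t)
    (S : Finset (Key c A)) (v : Key c A → Bin k → ℝ) (i : Fin c) (hW : 0 < W)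
    (hS : weight S v ≤ W) (hB : 0 ≤ B)
    (hsq : ∀ a, pr (fun T : Tables c k A => D * weight (S.filter fun x => x i = a) v <
        sqn (cenVec (S.filter fun x => x i = a) v T)) ≤
      K * (S.filter fun x => x i = a).card * ((2 : ℝ) ^ k) ^ (-γ))
    (hmax : ∀ a, (S.filter fun x => x i = a).Nonempty → ∀ j : Bin k,
      pr (fun T : Tables c k A => M ≤ |cenVec (S.filter fun x => x i = a) v T j|) ≤
        (B + K₂ * (S.filter fun x => x i = a).card) * ((2 : ℝ) ^ k) ^ (-(γ + 1))) :
    pr (fun T : Tables c k A => t ≤ |cenVec S v T 0|) ≤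
      2 * Real.exp (-(D * (W / 2 ^ k) / M ^ 2 * bennett (t * M / (D * (W / 2 ^ k))))) +
        (K + B + K₂) * S.card * ((2 : ℝ) ^ k) ^ (-γ) := by
  have hm : (0 : ℝ) < 2 ^ k := by positivity
  have hmγ := Real.rpow_pos_of_pos hm (-γ)
  set G : A → Finset (Key c A) := fun a => S.filter fun x => x i = a with hG
  have hmax' : ∀ a, pr (fun T : Tables c k A => ∃ j ∈ (Finset.univ : Finset (Bin k)),
      M ≤ |cenVec (G a) v T j|) ≤ (B + K₂) * ((2 : ℝ) ^ k) ^ (-γ) * (G a).card := by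
    intro a
    rcases (G a).eq_empty_or_nonempty with h | h
    · rw [h, pr_eq_zero fun T => by simpa [cenVec] using hM]
      simp
    · refine (pr_exists_le _ _).trans ((Finset.sum_le_sum fun j _ => hmax a h j).trans ?_)
      rw [Finset.sum_const, Finset.card_univ, card_bin, nsmul_eq_mul, neg_add,
        Real.rpow_add hm, Real.rpow_neg_one]
      -- Nonemptiness lets the term `B`, which has no size factor, be charged to the size of the
      -- group.
      have h1 : (1 : ℝ) ≤ (G a).card := by exact_mod_cast h.card_pos
      push_cast
      calc (2 : ℝ) ^ k * ((B + K₂ * (G a).card) * (((2 : ℝ) ^ k) ^ (-γ) * ((2 : ℝ) ^ k)⁻¹)) =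
            (B * 1 + K₂ * (G a).card) * ((2 : ℝ) ^ k) ^ (-γ) := by field_simp
        _ ≤ (B * (G a).card + K₂ * (G a).card) * ((2 : ℝ) ^ k) ^ (-γ) := by gcongr
        _ = _ := by ring
  have key := pr_le_of_resample i (fun T : Tables c k A =>
      (∃ a, D * weight (G a) v < sqn (cenVec (G a) v T)) ∨
      (∃ a, ∃ j ∈ (Finset.univ : Finset (Bin k)), M ≤ |cenVec (G a) v T j|))
    (fun T => t ≤ |cenVec S v T 0|)
    (e := 2 * Real.exp (-(D * (W / 2 ^ k) / M ^ 2 * bennett (t * M / (D * (W / 2 ^ k))))))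
    (by positivity) fun T hT => ?_
  · refine key.trans ?_
    have h1 := pr_exists_char_le S i (fun a (T : Tables c k A) =>
      D * weight (G a) v < sqn (cenVec (G a) v T))
      (C := K * ((2 : ℝ) ^ k) ^ (-γ)) fun a => (hsq a).trans_eq (by ring)
    have h2 := pr_exists_char_le S i (fun a (T : Tables c k A) =>
      ∃ j ∈ (Finset.univ : Finset (Bin k)), M ≤ |cenVec (G a) v T j|) hmax'
    have h3 := (pr_or_le _ _).trans (add_le_add h1 h2)
    linarith
  · push Not at hT
    have h1 : ∀ g : A → Bin k, cenVec S v (addRow T i g) 0 = ∑ a, cenVec (G a) v T (g a) := by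
      intro g
      rw [cenVec_addRow]
      simp_rw [zero_add]
      rfl
    simp_rw [h1]
    refine pr_le_abs_sum_le hM (by positivity) ht (fun a => ?_)
      (fun a b => (hT.2 a b (Finset.mem_univ b)).le) ?_
    · rw [Fintype.expect_eq_sum_div_card, sum_cenVec, zero_div]
    · have h2 : ∀ a, 𝔼 b, cenVec (G a) v T b ^ 2 ≤ D * weight (G a) v / 2 ^ k := by
        intro a
        rw [Fintype.expect_eq_sum_div_card, card_bin]
        push_cast
        exact div_le_div_of_nonneg_right (hT.1 a) hm.le
      refine (Finset.sum_le_sum fun a _ => h2 a).trans ?_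
      rw [← Finset.sum_div, ← Finset.mul_sum, sum_weight_filter, ← mul_div_assoc]
      gcongr

end LightTail

section BoundedTail

variable {c k : ℕ} {A : Type*}

lemma abs_expect_le_one {f : Bin k → ℝ} (h : ∀ b, |f b| ≤ 1) : |𝔼 b, f b| ≤ 1 :=
  (Finset.abs_expect_le _ _).trans (expect_le_of_le h)

lemma abs_cen_le_two {v : Key c A → Bin k → ℝ} (hv : ∀ x b, |v x b| ≤ 1) (x : Key c A)
    (b : Bin k) : |cen v x b| ≤ 2 := by
  have h1 := abs_sub (v x b) (𝔼 b', v x b')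
  have h2 := abs_expect_le_one (hv x)
  have h3 := hv x b
  rw [cen]; linarith

lemma abs_expect_le_card_div {f : Bin k → ℝ} (hf : ∀ b, |f b| ≤ 1) {Q : Finset (Bin k)}
    (hQ : ∀ b, f b ≠ 0 → b ∈ Q) : |𝔼 b, f b| ≤ Q.card / 2 ^ k := by
  rw [← expect_indicator_mem]
  refine (Finset.abs_expect_le _ _).trans (expect_mono fun b => ?_)
  by_cases hb : b ∈ Q
  · rw [Set.indicator_of_mem (Finset.mem_coe.2 hb)]; exact hf b
  · rw [Set.indicator_of_notMem (by simpa using hb), not_imp_comm.1 (hQ b) hb, abs_zero]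

/-- The hits contribute at most `r`; the extra 1 bounds the mean, since |H| |Q| / m ≤ m^(-1/2). -/
lemma abs_cenVec_le_of_card_le {H : Finset (Key c A)} {v : Key c A → Bin k → ℝ}
    {Q : Finset (Bin k)} (hv : ∀ x b, |v x b| ≤ 1) (hQ : SmallSupport v Q)
    (hH : (H.card : ℝ) ≤ ((2 : ℝ) ^ k) ^ (1 / 4 : ℝ)) {T : Tables c k A} {r : ℕ}
    (h : (H.filter fun x => T.hash x ∈ Q).card ≤ r) : |cenVec H v T 0| ≤ r + 1 := by
  have hm : (0 : ℝ) < 2 ^ k := by positivity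
  have hm1 : (1 : ℝ) ≤ 2 ^ k := one_le_pow₀ one_le_two
  have h1 : cenVec H v T 0 = ∑ x ∈ H, v x (T.hash x) - ∑ x ∈ H, 𝔼 b, v x b := by
    simp [cenVec, cen]
  have h2 : |∑ x ∈ H, v x (T.hash x)| ≤ r := by
    have h3 : ∑ x ∈ H, v x (T.hash x) =
        ∑ x ∈ H.filter (fun x => T.hash x ∈ Q), v x (T.hash x) :=
      (Finset.sum_filter_of_ne fun x _ hx => hQ.1 x _ hx).symm
    rw [h3]
    refine (Finset.abs_sum_le_sum_abs _ _).trans ((Finset.sum_le_card_nsmul _ _ 1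
      fun x _ => hv x _).trans ?_)
    rw [nsmul_eq_mul, mul_one]
    exact_mod_cast h
  have h4 : |∑ x ∈ H, 𝔼 b, v x b| ≤ 1 := by
    refine (Finset.abs_sum_le_sum_abs _ _).trans ((Finset.sum_le_card_nsmul _ _ _
      fun x _ => abs_expect_le_card_div (hv x) (hQ.1 x)).trans ?_)
    rw [nsmul_eq_mul, mul_div_assoc', div_le_one hm]
    calc (H.card : ℝ) * Q.card ≤ ((2 : ℝ) ^ k) ^ (1 / 4 : ℝ) * ((2 : ℝ) ^ k) ^ (1 / 4 : ℝ) :=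
          mul_le_mul hH hQ.2 (Nat.cast_nonneg _) (Real.rpow_nonneg hm.le _)
      _ = ((2 : ℝ) ^ k) ^ (1 / 2 : ℝ) := by rw [← Real.rpow_add hm]; norm_num
      _ ≤ ((2 : ℝ) ^ k) ^ (1 : ℝ) := Real.rpow_le_rpow_of_exponent_le hm1 (by norm_num)
      _ = 2 ^ k := Real.rpow_one _
  rw [h1]
  exact (abs_sub _ _).trans (add_le_add h2 h4)

variable [Fintype A] [DecidableEq A]

lemma prq_tail_le_of_le [NeZero c] {q : Key c A} (y : Bin k) {S : Finset (Key c A)} (hq : q ∉ S)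
    (v : Key c A → Bin k → ℝ) {W R t : ℝ} (hW : 0 < W) (hS : weight S v ≤ W) (hR : 1 ≤ R)
    (ht : 0 < t) (htR : t ≤ R) :
    prq q y (fun T => t ≤ |cenVec S v T 0|) ≤ 2 * bennettTail (1 / R) (W / 2 ^ k) t := by
  refine le_two_mul_bennettTail hR (by positivity) ht htR (prq_le_one q y _) ?_
  refine (prq_le_div q y (f := fun T => cenVec S v T 0 ^ 2) (pow_pos ht 2)
    (fun T => sq_nonneg _) fun T hT => ?_).trans ?_
  · rw [← sq_abs (cenVec S v T 0)]
    exact pow_le_pow_left₀ ht.le hT 2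
  · rw [exq_sq_cenVec q y hq]
    refine div_le_div_of_nonneg_right ((sumVar_le S v).trans ?_) (by positivity)
    exact div_le_div_of_nonneg_right hS (by positivity)

/-- Deviations up to u^c + 1 fall to Chebyshev. Larger ones force more than u^c hits, and
conditioning on the query multiplies the probability of that by at most m, hence `γ + 2`. -/
lemma prq_small_tail_le [NeZero c] {γ : ℝ} {u : ℕ} (hu : 2 * (γ + 2) ≤ u) {q : Key c A}
    (y : Bin k) {H : Finset (Key c A)} (hq : q ∉ H)
    (hH : (H.card : ℝ) ≤ ((2 : ℝ) ^ k) ^ (1 / 4 : ℝ)) {v : Key c A → Bin k → ℝ}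
    {Q : Finset (Bin k)} (hQ : SmallSupport v Q) (hv : ∀ x b, |v x b| ≤ 1) {W t : ℝ} (hW : 0 < W)
    (hS : weight H v ≤ W) (ht : 0 < t) :
    prq q y (fun T => t ≤ |cenVec H v T 0|) ≤
      2 * bennettTail (1 / ((u : ℝ) ^ c + 1)) (W / 2 ^ k) t +
        c * H.card * ((2 : ℝ) ^ k) ^ (-γ) := by
  have hm : (0 : ℝ) < 2 ^ k := by positivity
  rcases le_or_gt t ((u : ℝ) ^ c + 1) with h | h
  · have h1 := prq_tail_le_of_le y hq v hW hS (le_add_of_nonneg_left (by positivity)) ht h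
    have h2 : 0 ≤ c * H.card * ((2 : ℝ) ^ k) ^ (-γ) := by positivity
    linarith
  · have h1 := pr_exists_card_filter_le (γ := γ + 1) (u := u) (by linarith) H hH hQ
    have h2 : prq q y (fun T => t ≤ |cenVec H v T 0|) ≤ 2 ^ k *
        pr (fun T : Tables c k A => ∃ j : Bin k,
          u ^ c < (H.filter fun x => T.hash x + j ∈ Q).card) := by
      refine (prq_mono_on q y fun T _ hT => ?_).trans (prq_le q y _)
      refine ⟨0, ?_⟩
      by_contra! hcon
      simp only [add_zero] at hcon
      have h3 := abs_cenVec_le_of_card_le hv hQ hH hcon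
      push_cast at h3
      linarith
    refine (h2.trans (mul_le_mul_of_nonneg_left h1 hm.le)).trans ?_
    have h3 := bennettTail_nonneg (1 / ((u : ℝ) ^ c + 1)) (W / 2 ^ k) t
    rw [neg_add, Real.rpow_add hm, Real.rpow_neg_one]
    field_simp
    nlinarith [mul_nonneg h3 hm.le]

end BoundedTail

/-- The tail bound for `∑_{x ∈ S} v(x, h(x))` conditioned on the hash value of a key outside of
`S`, for sets of keys that agree outside of a set of `n` positions. -/
lemma exists_tail_bound {c : ℕ} (hc : 0 < c) (n : ℕ) : ∀ γ : ℝ,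
    ∃ K₁ κ K₂ : ℝ, 0 < K₁ ∧ 0 < κ ∧ 0 ≤ K₂ ∧ ∀ (A : Type u) [Fintype A] [DecidableEq A] (k : ℕ)
      (J : Finset (Fin c)) (S : Finset (Key c A)) (v : Key c A → Bin k → ℝ) (Q : Finset (Bin k))
      (q : Key c A) (y : Bin k), J.card ≤ n → AgreeOff J S → SmallSupport v Q →
      (∀ x b, |v x b| ≤ 1) → q ∉ S → ∀ t : ℝ, 0 < t →
      prq q y (fun T => t ≤ |cenVec S v T 0|) ≤
        K₁ * bennettTail κ (weight S v / 2 ^ k) t + K₂ * S.card * ((2 : ℝ) ^ k) ^ (-γ) := by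
  have : NeZero c := ⟨hc.ne'⟩
  have hzero : ∀ {A : Type u} [Fintype A] [DecidableEq A] {k : ℕ} {S : Finset (Key c A)}
      {v : Key c A → Bin k → ℝ} (q : Key c A) (y : Bin k) {t : ℝ}, 0 < t → weight S v = 0 →
      prq q y (fun T => t ≤ |cenVec S v T 0|) = 0 := fun q y t ht hW =>
    prq_eq_zero q y fun T _ => by
      rw [cenVec_eq_zero_of_weight_eq_zero hW, abs_zero]; exact not_le.2 ht
  induction n with
  | zero =>
    refine fun γ => ⟨2, 1 / 2, 0, two_pos, one_half_pos, le_rfl,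
      fun A _ _ k J S v Q q y hJ hS hQ hv hq t ht => ?_⟩
    rw [zero_mul, zero_mul, add_zero]
    rw [Finset.card_eq_zero.1 (Nat.le_zero.1 hJ)] at hS
    rcases (weight_nonneg S v).eq_or_lt with hW | hW
    · rw [hzero q y ht hW.symm]
      exact mul_nonneg zero_le_two (bennettTail_nonneg _ _ _)
    rcases le_or_gt t 2 with h | h
    · exact prq_tail_le_of_le y hq v hW le_rfl one_le_two ht h
    · rw [prq_eq_zero q y fun T _ => not_le.2 (lt_of_le_of_lt ?_ h)]
      · exact mul_nonneg zero_le_two (bennettTail_nonneg _ _ _)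
      · refine (Finset.abs_sum_le_sum_abs _ _).trans ((Finset.sum_le_card_nsmul _ _ _
          fun x _ => abs_cen_le_two hv x _).trans ?_)
        have h1 : (S.card : ℝ) ≤ 1 := by exact_mod_cast hS.card_le_one
        rw [nsmul_eq_mul]; linarith
  | succ n ih =>
    intro γ
    -- The group bound is needed for all m shifts at once, which costs one power of m; this is why γ
    -- is quantified inside the induction.
    obtain ⟨K₁, κ, K₂, hK₁, hκ, hK₂, ih⟩ := ih (γ + 1)
    obtain ⟨D, K, hD, hK, hsq⟩ := exists_square_bound.{u} hc n γ
    obtain ⟨κ', C, hκ', hC, htr⟩ := exists_truncation_level hκ hD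
      (δ := 1 / (4 * c)) (by positivity) γ
    obtain ⟨u, hu⟩ := exists_nat_ge (2 * (γ + 2))
    have hu0 : (0 : ℝ) < 1 / ((u : ℝ) ^ c + 1) := by positivity
    set κm := min (1 / ((u : ℝ) ^ c + 1)) (min κ κ') with hκm
    have hκm0 : 0 < κm := lt_min hu0 (lt_min hκ hκ')
    set K₁' := 2 + K₁ with hK₁'
    set K₂' := c + K₂ + 2 * C + (K + K₁ * C + K₂) with hK₂'
    -- The number of pieces: the keys without light characters, and each of the c classes split by
    -- agreement with `q`.
    set N : ℝ := 2 * c + 1 with hN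
    have hN1 : 1 ≤ N := by rw [hN]; linarith [(Nat.cast_nonneg c : (0 : ℝ) ≤ c)]
    refine ⟨N * K₁', κm / N ^ 2, N * K₂', by positivity, by positivity, by positivity,
      fun A _ _ k J S v Q q y hJ hS hQ hv hq t ht => ?_⟩
    have hm1 : (1 : ℝ) ≤ 2 ^ k := one_le_pow₀ one_le_two
    have hm : (0 : ℝ) < 2 ^ k := by positivity
    have hmγ : 0 < ((2 : ℝ) ^ k) ^ (-γ) := Real.rpow_pos_of_pos hm _
    have hmγ1 : ((2 : ℝ) ^ k) ^ (-(γ + 1)) ≤ ((2 : ℝ) ^ k) ^ (-γ) :=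
      Real.rpow_le_rpow_of_exponent_le hm1 (by linarith)
    rcases (weight_nonneg S v).eq_or_lt with hW | hW
    · rw [hzero q y ht hW.symm]
      have := bennettTail_nonneg (κm / N ^ 2) (weight S v / 2 ^ k) t
      positivity
    have hcard : (1 : ℝ) ≤ S.card := by
      have : S.Nonempty := by
        by_contra! h
        rw [h] at hW
        exact lt_irrefl _ hW
      exact_mod_cast this.card_pos
    set W := weight S v with hWdef
    set s := W / 2 ^ k with hs
    have hs0 : 0 < s := by positivity
    set t' := t / N with ht'
    have ht'0 : 0 < t' := by positivity
    obtain ⟨κf, hκ0, hκ1, hκ2⟩ := exists_light_partition hS (fun x => sqn (v x))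
      (fun x => sqn_nonneg _) hW (R := ((2 : ℝ) ^ k) ^ (1 / (4 * c) : ℝ))
      (Real.one_le_rpow hm1 (by positivity))
    rw [rpow_inv_pow_le hm hc] at hκ0
    set P : Option (Fin c) → Finset (Key c A) := fun o => S.filter fun x => κf x = o with hP
    have hPS : ∀ o, P o ⊆ S := fun o => Finset.filter_subset _ _
    set E := K₁' * bennettTail κm s t' + K₂' * S.card * ((2 : ℝ) ^ k) ^ (-γ) with hE
    have hE_of : ∀ {p a κ₀ b l : ℝ}, p ≤ a * bennettTail κ₀ s t' + b * l * ((2 : ℝ) ^ k) ^ (-γ) →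
        a ≤ K₁' → 0 ≤ a → κm ≤ κ₀ → b ≤ K₂' → 0 ≤ b → l ≤ S.card → p ≤ E := by
      intro p a κ₀ b l hp ha ha0 hκ₀ hb hb0 hl
      have h1 := bennettTail_anti hs0.le ht'0.le hκ₀
      have h2 := bennettTail_nonneg κm s t'
      refine hp.trans (add_le_add ?_ ?_)
      · exact (mul_le_mul_of_nonneg_left h1 ha0).trans (mul_le_mul_of_nonneg_right ha h2)
      · refine mul_le_mul_of_nonneg_right ?_ hmγ.le
        exact (mul_le_mul_of_nonneg_left hl hb0).trans
          (mul_le_mul_of_nonneg_right hb (Nat.cast_nonneg _))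
    have hcR : (0 : ℝ) ≤ c := Nat.cast_nonneg c
    have hKC : 0 ≤ K₁ * C := by positivity
    have hE0 : 0 ≤ E := by
      have := bennettTail_nonneg κm s t'
      positivity
    have hsub : ∀ {S' : Finset (Key c A)}, S' ⊆ S → (S'.card : ℝ) ≤ S.card := fun h => by
      exact_mod_cast Finset.card_le_card h
    have hnone : prq q y (fun T => t' ≤ |cenVec (P none) v T 0|) ≤ E := by
      refine hE_of (prq_small_tail_le hu y (fun h => hq (hPS _ h)) hκ0 hQ hv hW
        (weight_mono (hPS _) v) ht'0) ?_ zero_le_two (min_le_left _ _) ?_ hcR (hsub (hPS _))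
      · linarith
      · linarith
    have hqi : ∀ i, prq q y (fun T =>
        t' ≤ |cenVec ((P (some i)).filter fun x => x i = q i) v T 0|) ≤ E := by
      intro i
      have hsub' : ((P (some i)).filter fun x => x i = q i) ⊆ S :=
        (Finset.filter_subset _ _).trans (hPS _)
      by_cases hi : i ∈ J
      · refine hE_of ((ih A k (J.erase i) _ v Q q y (by
            rw [Finset.card_erase_of_mem hi]; omega) ((hS.mono (hPS _)).filter i (q i)) hQ hv
            (fun h => hq (hsub' h)) t' ht'0).trans (add_le_add
            (mul_le_mul_of_nonneg_left (bennettTail_mono_var hκ.le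
              (div_nonneg (weight_nonneg _ _) hm.le)
              (div_le_div_of_nonneg_right (weight_mono hsub' v) hm.le) ht'0.le) hK₁.le)
            (mul_le_mul_of_nonneg_left hmγ1 (by positivity))))
          ?_ hK₁.le ((min_le_right _ _).trans (min_le_left _ _)) ?_ hK₂ (hsub hsub')
        · linarith
        · linarith
      · have h1 : P (some i) = ∅ := hκ2 i hi
        rw [h1, hzero q y ht'0 (by simp [weight])]
        exact hE0
    have hlight : ∀ i, prq q y (fun T =>
        t' ≤ |cenVec ((P (some i)).filter fun x => x i ≠ q i) v T 0|) ≤ E := by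
      intro i
      by_cases hi : i ∈ J
      swap
      · have h1 : P (some i) = ∅ := hκ2 i hi
        rw [h1, hzero q y ht'0 (by simp [weight])]
        exact hE0
      set S' := (P (some i)).filter fun x => x i ≠ q i with hS'
      have hS'P : S' ⊆ P (some i) := Finset.filter_subset _ _
      have hS'S : S' ⊆ S := hS'P.trans (hPS _)
      have hJe : (J.erase i).card ≤ n := by rw [Finset.card_erase_of_mem hi]; omega
      have hagree : ∀ a, AgreeOff (J.erase i) (S'.filter fun x => x i = a) :=
        fun a => (hS.mono hS'S).filter i a
      have hinv : ∀ (b : Bin k) (T : Tables c k A),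
          cenVec S' v (addRow T i (Pi.single (q i) b)) 0 = cenVec S' v T 0 := by
        intro b T
        refine Finset.sum_congr rfl fun x hx => ?_
        rw [hash_addRow_single_of_ne T (Finset.mem_filter.1 hx).2]
      -- No key of `S'` uses the entry `q i` of table `i`, which alone makes `h(q)` uniform, so the
      -- conditioning can be dropped.
      rw [prq_eq_pr q y i fun b T => by rw [hinv]]
      obtain ⟨M, hM, hM1, hM2⟩ := htr (2 ^ k) s hm1 hs0
      have hl := pr_light_tail_le (K := K) (K₂ := K₂) (B := K₁ * C) (γ := γ) (by linarith : 0 < D)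
        hM ht'0 S' v i hW (weight_mono hS'S v) hKC
        (fun a => hsq A k (J.erase i) _ v Q hJe (hagree a) hQ) (fun a ha j => ?_)
      · have h1 := hM2 t' ht'0
        have h2 : C * ((2 : ℝ) ^ k) ^ (-γ) ≤ C * S.card * ((2 : ℝ) ^ k) ^ (-γ) := by
          refine mul_le_mul_of_nonneg_right ?_ hmγ.le
          exact le_mul_of_one_le_right hC hcard
        have h3 : (K + K₁ * C + K₂) * S'.card * ((2 : ℝ) ^ k) ^ (-γ) ≤
            (K + K₁ * C + K₂) * S.card * ((2 : ℝ) ^ k) ^ (-γ) := by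
          have := hsub hS'S
          gcongr
        refine hE_of (a := 2) (κ₀ := κ') (b := 2 * C + (K + K₁ * C + K₂)) (l := S.card)
          ?_ ?_ zero_le_two ((min_le_right _ _).trans (min_le_right _ _)) ?_ (by positivity) le_rfl
        · linarith
        · linarith
        · linarith
      · obtain ⟨x, hx⟩ := ha
        have hxa := Finset.mem_filter.1 hx
        have hxq : a ≠ q i := hxa.2 ▸ (Finset.mem_filter.1 hxa.1).2
        -- The induction hypothesis is conditional; as `q` is outside the group it holds for every
        -- hash value of `q`, and averaging removes the condition.
        refine pr_le_of_prq_le q fun y' => ?_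
        have h1 := ih A k (J.erase i) _ (fun x b => v x (b + j)) _ q y' hJe (hagree a)
          (hQ.shift j) (fun x b => hv x _)
          (fun h => hxq (Finset.mem_filter.1 h).2.symm) M hM
        simp_rw [cenVec_shift, weight_shift] at h1
        have h2 : weight (S'.filter fun x => x i = a) v / 2 ^ k ≤
            s / ((2 : ℝ) ^ k) ^ (1 / (4 * c) : ℝ) := by
          rw [hs, div_right_comm]
          refine div_le_div_of_nonneg_right ?_ hm.le
          exact (weight_mono (Finset.filter_subset_filter _ hS'P) v).trans (hκ1 i a)
        have h3 := (bennettTail_mono_var hκ.le (div_nonneg (weight_nonneg _ _) hm.le) h2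
          hM.le).trans hM1
        have h4 := mul_le_mul_of_nonneg_left h3 hK₁.le
        linarith
    have hsplit : ∀ T : Tables c k A, t ≤ |cenVec S v T 0| →
        t' ≤ |cenVec (P none) v T 0| ∨ ((∃ i ∈ (Finset.univ : Finset (Fin c)),
          t' ≤ |cenVec ((P (some i)).filter fun x => x i = q i) v T 0|) ∨
          ∃ i ∈ (Finset.univ : Finset (Fin c)),
            t' ≤ |cenVec ((P (some i)).filter fun x => x i ≠ q i) v T 0|) := by
      intro T hT
      by_contra! hcon
      have h1 : cenVec S v T 0 = cenVec (P none) v T 0 +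
          (∑ i, cenVec ((P (some i)).filter fun x => x i = q i) v T 0 +
            ∑ i, cenVec ((P (some i)).filter fun x => x i ≠ q i) v T 0) := by
        rw [cenVec_eq_sum_partition S κf v T 0, Fintype.sum_option, ← Finset.sum_add_distrib]
        congr 1
        refine Finset.sum_congr rfl fun i _ => ?_
        exact (Finset.sum_filter_add_sum_filter_not _ _ _).symm
      have h2 : |∑ i, cenVec ((P (some i)).filter fun x => x i = q i) v T 0| ≤ c * t' := by
        refine (Finset.abs_sum_le_sum_abs _ _).trans ((Finset.sum_le_card_nsmul _ _ t'
          fun i hi => (hcon.2.1 i hi).le).trans_eq ?_)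
        simp
      have h3 : |∑ i, cenVec ((P (some i)).filter fun x => x i ≠ q i) v T 0| ≤ c * t' := by
        refine (Finset.abs_sum_le_sum_abs _ _).trans ((Finset.sum_le_card_nsmul _ _ t'
          fun i hi => (hcon.2.2 i hi).le).trans_eq ?_)
        simp
      have h4 : N * t' = t := by rw [ht']; field_simp
      have h5 : |cenVec S v T 0| < t := by
        rw [h1]
        refine (abs_add_le _ _).trans_lt ?_
        have h6 := abs_add_le (∑ i, cenVec ((P (some i)).filter fun x => x i = q i) v T 0)
          (∑ i, cenVec ((P (some i)).filter fun x => x i ≠ q i) v T 0)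
        rw [← h4, hN]
        linarith [hcon.1]
      linarith
    have hfinal : prq q y (fun T => t ≤ |cenVec S v T 0|) ≤ N * E := by
      refine (prq_mono_on q y fun T _ hT => hsplit T hT).trans ((prq_or_le q y _ _).trans ?_)
      have h1 := (prq_exists_le q y (Finset.univ : Finset (Fin c)) fun i T =>
        t' ≤ |cenVec ((P (some i)).filter fun x => x i = q i) v T 0|).trans
          (Finset.sum_le_sum fun i _ => hqi i)
      have h2 := (prq_exists_le q y (Finset.univ : Finset (Fin c)) fun i T =>
        t' ≤ |cenVec ((P (some i)).filter fun x => x i ≠ q i) v T 0|).trans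
          (Finset.sum_le_sum fun i _ => hlight i)
      have h3 := prq_or_le q y (fun T => ∃ i ∈ (Finset.univ : Finset (Fin c)),
          t' ≤ |cenVec ((P (some i)).filter fun x => x i = q i) v T 0|)
        (fun T => ∃ i ∈ (Finset.univ : Finset (Fin c)),
          t' ≤ |cenVec ((P (some i)).filter fun x => x i ≠ q i) v T 0|)
      simp only [Finset.sum_const, Finset.card_univ, Fintype.card_fin, nsmul_eq_mul] at h1 h2
      rw [hN]
      linarith
    refine hfinal.trans ?_
    have h1 := bennettTail_div_le hκm0.le hs0.le ht.le hN1
    have h2 := mul_le_mul_of_nonneg_left h1 (by positivity : 0 ≤ N * K₁')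
    rw [hE, mul_add]
    linarith

/-! ### From averages to the measures of the statement -/

section Measures

variable {c k : ℕ} {A : Type*}

instance : DiscreteMeasurableSpace (Tables c k A) := ⟨fun _ => trivial⟩

variable [Fintype A] [DecidableEq A]

instance : IsProbabilityMeasure (law c k A) :=
  isProbabilityMeasure_uniformOn Set.finite_univ Set.univ_nonempty

lemma integral_law (f : Tables c k A → ℝ) : ∫ T, f T ∂(law c k A) = 𝔼 T, f T := by
  rw [integral_fintype Integrable.of_finite, Fintype.expect_eq_sum_div_card, Finset.sum_div]
  refine Finset.sum_congr rfl fun T _ => ?_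
  have h : (law c k A).real {T} = 1 / Fintype.card (Tables c k A) := by
    rw [measureReal_def, law, uniformOn_univ, Measure.count_singleton]
    simp
  rw [h, smul_eq_mul]; ring

lemma law_real (p : Tables c k A → Prop) : (law c k A).real {T | p T} = pr p := by
  rw [← integral_indicator_one (MeasurableSet.of_discrete), integral_law]
  rfl

lemma law_real_hash [NeZero c] (q : Key c A) (y : Bin k) :
    (law c k A).real {T | T.hash q = y} = 1 / 2 ^ k := by
  rw [law_real, pr, ← expect_indicator_eq y]
  exact expect_hash q (Set.indicator {b | b = y} (1 : Bin k → ℝ))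

lemma integral_queryLaw [NeZero c] (q : Key c A) (y : Bin k) (f : Tables c k A → ℝ) :
    ∫ T, f T ∂(queryLaw q y) = exq q y f := by
  have h1 := law_real_hash q y
  rw [measureReal_def] at h1
  rw [queryLaw, ProbabilityTheory.cond, integral_smul_measure, ENNReal.toReal_inv, h1,
    ← integral_indicator (MeasurableSet.of_discrete), integral_law, exq, one_div, inv_inv,
    smul_eq_mul]
  congr 1
  refine Finset.expect_congr rfl fun T _ => ?_
  by_cases hT : T.hash q = y
  · rw [Set.indicator_of_mem (by exact hT), Set.indicator_of_mem (by exact hT), Pi.one_apply,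
      one_mul]
  · rw [Set.indicator_of_notMem (by exact hT), Set.indicator_of_notMem (by exact hT), zero_mul]

lemma queryLaw_real [NeZero c] (q : Key c A) (y : Bin k) (p : Tables c k A → Prop) :
    (queryLaw q y).real {T | p T} = prq q y p := by
  rw [← integral_indicator_one (MeasurableSet.of_discrete), integral_queryLaw]
  rfl

end Measures

/-! ### Means and variances under both laws -/

section Moments

variable {c k : ℕ} {A : Type*}

lemma valueSum_eq (S : Finset (Key c A)) (v : Key c A → Bin k → ℝ) :
    valueSum S v = shiftedSum S v (0 : Bin k) := by
  funext T
  simp [valueSum, shiftedSum]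

lemma bennettTail_weight_le (hk : 1 ≤ k) (S : Finset (Key c A)) {v : Key c A → Bin k → ℝ}
    {Q : Finset (Bin k)} (hQ : SmallSupport v Q) {κ t : ℝ} (hκ : 0 ≤ κ) (ht : 0 ≤ t) :
    bennettTail κ (weight S v / 2 ^ k) t ≤ bennettTail (κ / (5 / 2)) (sumVar S v) t := by
  have h0 : 0 ≤ sumVar S v :=
    Finset.sum_nonneg fun x _ => expect_nonneg fun b => sq_nonneg _
  refine (bennettTail_mono_var hκ (div_nonneg (weight_nonneg S v) (by positivity))
    (weight_div_le_sumVar hk S hQ) ht).trans ?_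
  exact bennettTail_mul_var_le hκ h0 ht (by norm_num)

variable [Fintype A] [DecidableEq A]

lemma integral_shiftedSum_law [NeZero c] (S : Finset (Key c A)) (v : Key c A → Bin k → ℝ)
    (j : Bin k) : ∫ T, shiftedSum S v j T ∂(law c k A) = ∑ x ∈ S, 𝔼 b, v x b := by
  rw [integral_law]
  simp_rw [← cenVec_add_const]
  rw [Finset.expect_add_distrib, expect_cenVec, Finset.expect_const Finset.univ_nonempty, zero_add]

lemma shiftedSum_sub_integral_law [NeZero c] (S : Finset (Key c A)) (v : Key c A → Bin k → ℝ)
    (j : Bin k) (T : Tables c k A) :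
    shiftedSum S v j T - ∫ T', shiftedSum S v j T' ∂(law c k A) = cenVec S v T j := by
  rw [integral_shiftedSum_law, ← cenVec_add_const, add_sub_cancel_right]

/-- Given `h(q) = y` the contribution of `q` is the constant `v q (y + j)`, and the remaining keys
keep their unconditional means. -/
lemma shiftedSum_sub_integral_queryLaw [NeZero c] (S : Finset (Key c A))
    (v : Key c A → Bin k → ℝ) (q : Key c A) (y : Bin k) (j : Bin k) {T : Tables c k A}
    (hT : T.hash q = y) :
    shiftedSum S v j T - ∫ T', shiftedSum S v j T' ∂(queryLaw q y) =
      cenVec (S.erase q) v T j := by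
  obtain ⟨a, ha⟩ : ∃ a, ∀ T : Tables c k A, T.hash q = y →
      shiftedSum S v j T = cenVec (S.erase q) v T j + a := by
    by_cases hq : q ∈ S
    · refine ⟨∑ x ∈ S.erase q, (𝔼 b, v x b) + v q (y + j), fun T hT => ?_⟩
      rw [← add_assoc, cenVec_add_const, shiftedSum, shiftedSum, ← hT, Finset.sum_erase_add S _ hq]
    · refine ⟨∑ x ∈ S.erase q, (𝔼 b, v x b), fun T _ => ?_⟩
      rw [cenVec_add_const, Finset.erase_eq_of_notMem hq]
  have h1 : exq q y (fun T => cenVec (S.erase q) v T j) = 0 := by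
    have := exq_cenVec q y (Finset.notMem_erase q S) fun x b => v x (b + j)
    simpa only [cenVec_shift] using this
  rw [integral_queryLaw, exq_congr_on q y ha, exq_add, h1, exq_const, ha T hT]
  ring

lemma variance_law [NeZero c] (S : Finset (Key c A)) (v : Key c A → Bin k → ℝ) :
    Var[valueSum S v; law c k A] = sumVar S v := by
  rw [variance_eq_integral (Measurable.of_discrete).aemeasurable, valueSum_eq]
  simp_rw [shiftedSum_sub_integral_law]
  rw [integral_law, expect_sq_cenVec]

lemma variance_queryLaw [NeZero c] (S : Finset (Key c A)) (v : Key c A → Bin k → ℝ)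
    (q : Key c A) (y : Bin k) :
    Var[valueSum S v; queryLaw q y] = sumVar (S.erase q) v := by
  rw [variance_eq_integral (Measurable.of_discrete).aemeasurable, valueSum_eq, integral_queryLaw,
    ← exq_sq_cenVec q y (Finset.notMem_erase q S)]
  exact exq_congr_on q y fun T hT => by rw [shiftedSum_sub_integral_queryLaw S v q y 0 hT]

end Moments

/-! ### The unconditional tail and the theorem -/

section Final

variable {c k : ℕ} {A : Type*} [Fintype A] [DecidableEq A]

lemma pr_tail_single_le [NeZero c] {v : Key c A → Bin k → ℝ} (hv : ∀ x b, |v x b| ≤ 1)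
    (q : Key c A) {W t : ℝ} (hW : 0 < W) (hq : weight {q} v ≤ W) (ht : 0 < t) :
    pr (fun T : Tables c k A => t ≤ |cenVec {q} v T 0|) ≤
      2 * bennettTail (1 / 2) (W / 2 ^ k) t := by
  rcases le_or_gt t 2 with h | h
  · refine le_two_mul_bennettTail one_le_two (by positivity) ht h (pr_le_one _) ?_
    refine (pr_le_div (f := fun T => cenVec {q} v T 0 ^ 2) (pow_pos ht 2)
      (fun T => sq_nonneg _) fun T hT => ?_).trans ?_
    · rw [← sq_abs (cenVec {q} v T 0)]
      exact pow_le_pow_left₀ ht.le hT 2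
    · rw [expect_sq_cenVec]
      refine div_le_div_of_nonneg_right ((sumVar_le _ v).trans ?_) (by positivity)
      exact div_le_div_of_nonneg_right hq (by positivity)
  · rw [pr_eq_zero fun T => not_le.2 (lt_of_le_of_lt ?_ h)]
    · exact mul_nonneg zero_le_two (bennettTail_nonneg _ _ _)
    · rw [cenVec, Finset.sum_singleton]
      exact abs_cen_le_two hv _ _

/-- Removing one key `q` of `S` makes the conditional bound available for every value of `h(q)`,
hence also on average; `q` itself has deviation at most 2. Each piece gets half of `t`, whence the
division of κ by 4. -/
lemma pr_tail_le [NeZero c] {K₁ κ E : ℝ} (hK₁ : 0 ≤ K₁) (hκ : 0 ≤ κ) (hE : 0 ≤ E)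
    {S : Finset (Key c A)} {v : Key c A → Bin k → ℝ} (hv : ∀ x b, |v x b| ≤ 1)
    (h : ∀ (q : Key c A) (y : Bin k) (t : ℝ), 0 < t →
      prq q y (fun T => t ≤ |cenVec (S.erase q) v T 0|) ≤
        K₁ * bennettTail κ (weight (S.erase q) v / 2 ^ k) t + E) {t : ℝ} (ht : 0 < t) :
    pr (fun T : Tables c k A => t ≤ |cenVec S v T 0|) ≤
      (K₁ + 2) * bennettTail (min κ (1 / 2) / 4) (weight S v / 2 ^ k) t + E := by
  have hs : 0 ≤ weight S v / 2 ^ k := div_nonneg (weight_nonneg S v) (by positivity)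
  have hb := bennettTail_nonneg (min κ (1 / 2) / 4) (weight S v / 2 ^ k) t
  rcases (weight_nonneg S v).eq_or_lt with hW | hW
  · rw [pr_eq_zero fun T => by
      rw [cenVec_eq_zero_of_weight_eq_zero hW.symm, abs_zero]; exact not_le.2 ht]
    positivity
  obtain ⟨q, hq⟩ : S.Nonempty := by
    by_contra! h
    rw [h] at hW
    exact lt_irrefl _ hW
  have ht2 : 0 < t / 2 := half_pos ht
  have hκm : 0 ≤ min κ (1 / 2) := le_min hκ (by norm_num)
  have hcomp : ∀ κ₀, min κ (1 / 2) ≤ κ₀ → bennettTail κ₀ (weight S v / 2 ^ k) (t / 2) ≤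
      bennettTail (min κ (1 / 2) / 4) (weight S v / 2 ^ k) t := by
    intro κ₀ h0
    refine (bennettTail_anti hs ht2.le h0).trans ((bennettTail_div_le hκm hs ht.le
      one_le_two).trans_eq ?_)
    norm_num
  have h1 : pr (fun T : Tables c k A => t / 2 ≤ |cenVec (S.erase q) v T 0|) ≤
      K₁ * bennettTail (min κ (1 / 2) / 4) (weight S v / 2 ^ k) t + E := by
    refine pr_le_of_prq_le q fun y => (h q y _ ht2).trans (add_le_add ?_ le_rfl)
    refine mul_le_mul_of_nonneg_left (le_trans ?_ (hcomp κ (min_le_left _ _))) hK₁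
    exact bennettTail_mono_var hκ (div_nonneg (weight_nonneg _ v) (by positivity))
      (div_le_div_of_nonneg_right (weight_mono (Finset.erase_subset q S) v) (by positivity)) ht2.le
  have h2 := (pr_tail_single_le hv q hW
    (weight_mono (Finset.singleton_subset_iff.2 hq) v) ht2).trans
    (mul_le_mul_of_nonneg_left (hcomp (1 / 2) (min_le_right _ _)) zero_le_two)
  refine (pr_mono fun T hT => ?_).trans ((pr_or_le _ _).trans ((add_le_add h1 h2).trans_eq ?_))
  · by_contra! hcon
    have h3 : cenVec S v T 0 = cenVec (S.erase q) v T 0 + cenVec {q} v T 0 := by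
      rw [cenVec, cenVec, cenVec, Finset.sum_singleton, Finset.sum_erase_add S _ hq]
    have h4 := abs_add_le (cenVec (S.erase q) v T 0) (cenVec {q} v T 0)
    rw [← h3] at h4
    linarith
  · ring

end Final

end SimpleTabulation

theorem theorem4 (c : ℕ) (hc : 1 ≤ c) (γ : ℝ) (hγ : 1 ≤ γ) :
    ∃ K₁ κ D : ℝ, 0 < K₁ ∧ 0 < κ ∧ 0 < D ∧
      ∀ ε : ℝ, ε < 1 / 4 → ∃ K₂ : ℝ, 0 < K₂ ∧
        ∀ (A : Type*) [Finite A] (k : ℕ), 1 ≤ k →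
        ∀ (S : Finset (SimpleTabulation.Key c A))
          (v : SimpleTabulation.Key c A → SimpleTabulation.Bin k → ℝ),
          (∀ x b, v x b ∈ Set.Icc (-1 : ℝ) 1) →
          (Set.ncard {b : SimpleTabulation.Bin k | ∃ x, v x b ≠ 0} : ℝ) ≤ ((2 : ℝ) ^ k) ^ ε →
          SimpleTabulation.QueryInvariantly (fun P : Measure (SimpleTabulation.Tables c k A) =>
            SimpleTabulation.StronglyConcentrated P (SimpleTabulation.valueSum S v) K₁ κ
              (K₂ * (S.card / ((2 : ℝ) ^ k) ^ γ))) ∧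
          ∃ μ : ℝ,
            (∀ j : SimpleTabulation.Bin k,
              ∫ T, SimpleTabulation.shiftedSum S v j T ∂(SimpleTabulation.law c k A) = μ) ∧
            SimpleTabulation.QueryInvariantly (fun P : Measure (SimpleTabulation.Tables c k A) =>
              SimpleTabulation.SquaresBounded P S v (fun _ => μ) D
                (K₂ * (S.card / ((2 : ℝ) ^ k) ^ γ))) ∧
            SimpleTabulation.QueryInvariantly (fun P : Measure (SimpleTabulation.Tables c k A) =>
              SimpleTabulation.SquaresBounded P S v
                (fun j => ∫ T, SimpleTabulation.shiftedSum S v j T ∂P) D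
                (K₂ * (S.card / ((2 : ℝ) ^ k) ^ γ))) := by
  have : NeZero c := ⟨by omega⟩
  have hc0 : 0 < c := hc
  obtain ⟨K₁, κ, K₂, hK₁, hκ, hK₂, htail⟩ := SimpleTabulation.exists_tail_bound hc0 c γ
  -- The spare power of m pays for conditioning on the query.
  obtain ⟨D, K, hD, hK, hsq⟩ := SimpleTabulation.exists_square_bound hc0 c (γ + 1)
  -- The 1/2 is for the single removed key, the 4 for halving `t`, and 5/2 for replacing the weight
  -- by the variance.
  set κ' := min κ (1 / 2) / 4 / (5 / 2) with hκ'
  have hκm : 0 < min κ (1 / 2) := lt_min hκ (by norm_num)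
  refine ⟨K₁ + 2, κ', D, by positivity, by positivity, by linarith, fun ε hε =>
    ⟨K₂ + K + 1, by positivity, fun A _ k hk S v hv hQ => ?_⟩⟩
  classical
  have := Fintype.ofFinite A
  have hm : (0 : ℝ) < 2 ^ k := by positivity
  have hm1 : (1 : ℝ) ≤ 2 ^ k := one_le_pow₀ one_le_two
  have hmγ := Real.rpow_pos_of_pos hm γ
  have hv1 : ∀ x b, |v x b| ≤ 1 := fun x b => abs_le.2 (hv x b)
  obtain ⟨Q, hQs⟩ : ∃ Q, SimpleTabulation.SmallSupport v Q := by
    refine ⟨(Set.toFinite {b : SimpleTabulation.Bin k | ∃ x, v x b ≠ 0}).toFinset,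
      fun x b hb => by simpa using ⟨x, hb⟩, ?_⟩
    rw [← Set.ncard_eq_toFinset_card]
    exact hQ.trans (Real.rpow_le_rpow_of_exponent_le hm1 hε.le)
  have hJ : (Finset.univ : Finset (Fin c)).card ≤ c := by simp
  have hag : ∀ S : Finset (SimpleTabulation.Key c A), SimpleTabulation.AgreeOff Finset.univ S :=
    fun _ _ _ _ _ i hi => (hi (Finset.mem_univ i)).elim
  have herr : ∀ a : ℝ, a ≤ K₂ + K + 1 → ∀ S' : Finset (SimpleTabulation.Key c A), S' ⊆ S → 0 ≤ a →
      a * S'.card * ((2 : ℝ) ^ k) ^ (-γ) ≤ (K₂ + K + 1) * (S.card / ((2 : ℝ) ^ k) ^ γ) := by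
    intro a ha S' hS' ha0
    have h1 : (S'.card : ℝ) ≤ S.card := by exact_mod_cast Finset.card_le_card hS'
    rw [Real.rpow_neg hm.le, ← div_eq_mul_inv, mul_div_assoc]
    gcongr
  have herr0 : 0 ≤ (K₂ + K + 1) * (S.card / ((2 : ℝ) ^ k) ^ γ) := by positivity
  have hprq : ∀ (q : SimpleTabulation.Key c A) (y : SimpleTabulation.Bin k) (t : ℝ), 0 < t →
      SimpleTabulation.prq q y
        (fun T => t ≤ |SimpleTabulation.cenVec (S.erase q) v T 0|) ≤
      K₁ * SimpleTabulation.bennettTail κ (SimpleTabulation.weight (S.erase q) v / 2 ^ k) t +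
        (K₂ + K + 1) * (S.card / ((2 : ℝ) ^ k) ^ γ) := fun q y t ht =>
    (htail A k Finset.univ (S.erase q) v Q q y hJ (hag _) hQs hv1
      (Finset.notMem_erase q S) t ht).trans
      (add_le_add le_rfl (herr K₂ (by linarith) _ (Finset.erase_subset q S) hK₂))
  have hsqS : ∀ S' ⊆ S, 2 ^ k * SimpleTabulation.pr (fun T : SimpleTabulation.Tables c k A =>
      D * SimpleTabulation.weight S v < SimpleTabulation.sqn (SimpleTabulation.cenVec S' v T)) ≤
        (K₂ + K + 1) * (S.card / ((2 : ℝ) ^ k) ^ γ) := by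
    intro S' hS'
    refine le_trans ?_ (herr K (by linarith) S' hS' hK)
    have h1 := hsq A k Finset.univ S' v Q hJ (hag _) hQs
    have h2 : SimpleTabulation.pr (fun T : SimpleTabulation.Tables c k A =>
        D * SimpleTabulation.weight S v <
          SimpleTabulation.sqn (SimpleTabulation.cenVec S' v T)) ≤ _ :=
      (SimpleTabulation.pr_mono fun T hT => (mul_le_mul_of_nonneg_left
        (SimpleTabulation.weight_mono hS' v) (by linarith)).trans_lt hT).trans h1
    refine (mul_le_mul_of_nonneg_left h2 hm.le).trans_eq ?_
    rw [neg_add, Real.rpow_add hm, Real.rpow_neg_one]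
    field_simp
  have hsq1 : SimpleTabulation.pr (fun T : SimpleTabulation.Tables c k A =>
      D * SimpleTabulation.weight S v < SimpleTabulation.sqn (SimpleTabulation.cenVec S v T)) ≤
        (K₂ + K + 1) * (S.card / ((2 : ℝ) ^ k) ^ γ) :=
    (le_mul_of_one_le_left (SimpleTabulation.pr_nonneg _) hm1).trans (hsqS S subset_rfl)
  refine ⟨⟨fun t ht => ?_, fun q y t ht => ?_⟩, ∑ x ∈ S, 𝔼 b, v x b,
    SimpleTabulation.integral_shiftedSum_law S v, ⟨?_, fun q y => ?_⟩, ?_, fun q y => ?_⟩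
  · rw [SimpleTabulation.variance_law, SimpleTabulation.law_real, SimpleTabulation.valueSum_eq]
    simp_rw [SimpleTabulation.shiftedSum_sub_integral_law]
    refine (SimpleTabulation.pr_tail_le hK₁.le hκ.le herr0 hv1 hprq ht).trans ?_
    refine add_le_add (mul_le_mul_of_nonneg_left ?_ (by linarith)) le_rfl
    exact SimpleTabulation.bennettTail_weight_le hk S hQs (by positivity) ht.le
  · rw [SimpleTabulation.variance_queryLaw, SimpleTabulation.queryLaw_real,
      SimpleTabulation.valueSum_eq]
    refine (SimpleTabulation.prq_mono_on q y fun T hT hTt => ?_).trans ((hprq q y t ht).trans ?_)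
    · rwa [SimpleTabulation.shiftedSum_sub_integral_queryLaw S v q y 0 hT] at hTt
    refine add_le_add ?_ le_rfl
    have hs : 0 ≤ SimpleTabulation.weight (S.erase q) v / 2 ^ k :=
      div_nonneg (SimpleTabulation.weight_nonneg _ v) hm.le
    refine mul_le_mul (by linarith) ?_ (SimpleTabulation.bennettTail_nonneg _ _ _) (by linarith)
    refine (SimpleTabulation.bennettTail_anti hs ht.le ?_).trans
      (SimpleTabulation.bennettTail_weight_le hk (S.erase q) hQs
        (κ := min κ (1 / 2) / 4) (by positivity) ht.le)
    linarith [min_le_left κ (1 / 2)]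
  · refine le_of_eq_of_le (SimpleTabulation.law_real _) ?_
    simp_rw [← SimpleTabulation.cenVec_add_const, add_sub_cancel_right]
    exact hsq1
  · refine le_of_eq_of_le (SimpleTabulation.queryLaw_real q y _) ?_
    simp_rw [← SimpleTabulation.cenVec_add_const, add_sub_cancel_right]
    exact (SimpleTabulation.prq_le q y _).trans (hsqS S subset_rfl)
  · refine le_of_eq_of_le (SimpleTabulation.law_real _) ?_
    simp_rw [SimpleTabulation.shiftedSum_sub_integral_law]
    exact hsq1
  · refine le_of_eq_of_le (SimpleTabulation.queryLaw_real q y _) ?_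
    refine (SimpleTabulation.prq_mono_on q y fun T hT hTt => ?_).trans
      ((SimpleTabulation.prq_le q y _).trans (hsqS (S.erase q) (Finset.erase_subset q S)))
    simp_rw [SimpleTabulation.shiftedSum_sub_integral_queryLaw S v q y _ hT] at hTt
    exact hTt
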